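/- **Proposition 3.8 (spectral decomposition for $U_q(C^{(1)}_n)$).** *Setting.* Let $n\ge 1$, and let $K$ be a field of characteristic $0$ containing elements $q^{1/2}$, $i$, $x$, $y$ with $i^2=-1$, $q=(q^{1/2})^2\neq0$ not a root of unity, $x,y\ne0$, and such that $z=x/y$ is not an integer power of $q$ (for instance $K=\mathbb C(q^{1/2})(x,y)$). Put $[m]=\frac{q^m-q^{-m}}{q-q^{-1}}$, $[m]!=\prod_{k=1}^m[k]$, ${l\brack k}=\frac{[l]!}{[k]!\,[l-k]!}$. Let $V$ be the $K$-vector space with basis $|\mathbf m\rangle$, $\mathbf m\in(\mathbb Z_{\ge0})^n$, let $\mathbf e_j$ be the $j$-th unit vector, and for $\epsilon=\pm$ let $V^\epsilon$ be the span of the $|\mathbf m\rangle$ with $(-1)^{m_1+\cdots+m_n}=\epsilon1$. The $q$-oscillator representation $\pi_x$ of $U_q(C_n^{(1)})$ on $V$ is $$e_0|\mathbf m\rangle=x|\mathbf m+2\mathbf e_1\rangle,\quad f_0|\mathbf m\rangle=\tfrac{[m_1][m_1-1]}{[2]^2}x^{-1}|\mathbf m-2\mathbf e_1\rangle,\quad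 k_0|\mathbf m\rangle=-q^{2m_1+1}|\mathbf m\rangle,$$ $$e_j|\mathbf m\rangle=[m_j]|\mathbf m-\mathbf e_j+\mathbf e_{j+1}\rangle,\quad f_j|\mathbf m\rangle=[m_{j+1}]|\mathbf m+\mathbf e_j-\mathbf e_{j+1}\rangle,\quad k_j|\mathbf m\rangle=q^{-m_j+m_{j+1}}|\mathbf m\rangle\quad(1\le j\le n-1),$$ $$e_n|\mathbf m\rangle=\tfrac{[m_n][m_n-1]}{[2]^2}|\mathbf m-2\mathbf e_n\rangle,\quad f_n|\mathbf m\rangle=|\mathbf m+2\mathbf e_n\rangle,\quad k_n|\mathbf m\rangle=-q^{-2m_n-1}|\mathbf m\rangle .$$ The coproduct is $\Delta k_r^{\pm1}=k_r^{\pm1}\otimes k_r^{\pm1}$, $\Delta e_r=1\otimes e_r+e_r\otimes k_r$, $\Delta f_r=f_r\otimes1+k_r^{-1}\otimes f_r$, and $\Delta'$ is the opposite coproduct. $U_q(C_n)$ is the subalgebra generated by $e_r,f_r,k_r^{\pm1}$ with $1\le r\le n$; its action on $V$ does not involve $x$. *The $R$ matrix.* $R(z)=\bigoplus_{\epsilon_1,\epsilon_2=\pm}R^{\epsilon_1,\epsilon_2}(z)$,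 with $R^{\epsilon_1,\epsilon_2}(z)\in\mathrm{End}(V^{\epsilon_1}\otimes V^{\epsilon_2})$, satisfies $(\pi_x\otimes\pi_y)(\Delta'(g))\,R(z)=R(z)\,(\pi_x\otimes\pi_y)(\Delta(g))$ for $g=k_r,e_r,f_r$ $(0\le r\le n)$ and the normalization $$R(z)|\mathbf 0\rangle\otimes|\mathbf 0\rangle=|\mathbf 0\rangle\otimes|\mathbf 0\rangle,\qquad R(z)|\mathbf 0\rangle\otimes|\mathbf e_1\rangle=\tfrac{-iq^{1/2}}{1-z}|\mathbf 0\rangle\otimes|\mathbf e_1\rangle,$$ $$R(z)|\mathbf e_1\rangle\otimes|\mathbf 0\rangle=\tfrac{-iq^{1/2}}{1-z}|\mathbf e_1\rangle\otimes|\mathbf 0\rangle,\qquad R(z)|\mathbf e_1\rangle\otimes|\mathbf e_1\rangle=\tfrac{z-q^2}{1-zq^2}|\mathbf e_1\rangle\otimes|\mathbf e_1\rangle .$$ Let $P(u\otimes v)=v\otimes u$, and let $PR^{\epsilon_1,\epsilon_2}(z)$ be the restriction of $PR(z)$ to $V^{\epsilon_1}\otimes V^{\epsilon_2}$. *Singular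 vectors.* Put $p(+)=0$, $p(-)=1$. For $l\ge p(\epsilon)$ let $$v^\epsilon_l=\sum_{0\le k\le l,\ k\equiv p(\epsilon)\bmod 2}q^{k(2l-k-1)/2}{l\brack k}|k\mathbf e_n\rangle\otimes|(l-k)\mathbf e_n\rangle ,$$ and let $v^-_0=|\mathbf e_{n-1}\rangle\otimes|\mathbf e_n\rangle-q|\mathbf e_n\rangle\otimes|\mathbf e_{n-1}\rangle$ if $n\ge2$, and $v^-_0=0$ if $n=1$. Let $V^\epsilon_l\subset V\otimes V$ be the subspace generated by $f_1,\dots,f_n$ (acting through $\Delta$) from $v^\epsilon_l$. *Statement.* $V\otimes V$ is the direct sum of the $V^\epsilon_l$ $(\epsilon=\pm,\ l\ge0)$. Let $P^\epsilon_{2l}$ be the corresponding projector on $V^\epsilon_{2l}$. There is a unique $U_q(C_n)$-linear map $P^\epsilon_{2l+1}$ on $V\otimes V$ sending $v^\epsilon_{2l+1}$ to $v^{-\epsilon}_{2l+1}$ and all the other $v^{\epsilon'}_{l'}$ to $0$. The $R$ matrix $R(z)$ exists and is unique. For $\epsilon=\pm$, $$PR^{\epsilon,\epsilon}(z)=\sum_{l=0}^\infty\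 \prod_{j=1}^l\frac{z-q^{4j-2}}{1-q^{4j-2}z}\,P^\epsilon_{2l},\qquad PR^{\epsilon,-\epsilon}(z)=\frac{-iq^{1/2}}{1-z}\sum_{l=0}^\infty\ \prod_{j=1}^l\frac{z-q^{4j}}{1-q^{4j}z}\,P^\epsilon_{2l+1}$$ on $V^\epsilon\otimes V^\epsilon$ and on $V^\epsilon\otimes V^{-\epsilon}$ respectively; on each vector only finitely many terms of the sums are nonzero. -/

import Mathlib

open scoped TensorProduct

namespace QOscillator

noncomputable section

/-- Occupation numbers `m = (m₁, …, m_n)`. -/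
abbrev Occ (n : ℕ) : Type := Fin n → ℕ

/-- The Fock space `F^{⊗n}`: the vector space with basis `|m⟩`, `m ∈ (ℤ_{≥0})^n`. -/
abbrev Fock (K : Type*) [Field K] (n : ℕ) : Type _ := Occ n →₀ K

/-- The basis vector `|m⟩`. -/
def ket (K : Type*) [Field K] {n : ℕ} (m : Occ n) : Fock K n := Finsupp.single m 1

/-- The unit vector `𝐞_j` for `1 ≤ j ≤ n` (sites are numbered from `1`; the `a : Fin n` is
site `a + 1`). -/
def unitVec (n j : ℕ) : Occ n := fun a => if (a : ℕ) + 1 = j then 1 else 0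

/-- The entry `m_j` of `m`, for `1 ≤ j ≤ n`. -/
def entry {n : ℕ} (m : Occ n) (j : ℕ) : ℕ := ∑ a : Fin n, if (a : ℕ) + 1 = j then m a else 0

variable {K : Type*} [Field K] {n : ℕ}

/-- The `q`-integer `[m] = (q^m - q^{-m}) / (q - q^{-1})`. -/
def qInt (q : K) (m : ℕ) : K := (q ^ m - q⁻¹ ^ m) / (q - q⁻¹)

/-- The `q`-factorial `[m]!`. -/
def qFact (q : K) (m : ℕ) : K := ∏ k ∈ Finset.Icc 1 m, qInt q k

/-- The `q`-binomial coefficient `[l]! / ([k]! [l-k]!)`, used only for `k ≤ l`. -/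
def qBinom (q : K) (l k : ℕ) : K := qFact q l / (qFact q k * qFact q (l - k))

/-! ### The `q`-oscillator representation of `U_q(C_n^{(1)})` with parameter `x`

In the lowering operators the subtraction of occupation numbers is only reached with a nonzero
coefficient when it is a true subtraction, since `[0] = 0`. -/

/-- The action of `e_r`, `0 ≤ r ≤ n`. -/
def opE (n : ℕ) (q x : K) (r : ℕ) : Module.End K (Fock K n) :=
  Finsupp.linearCombination K fun m : Occ n =>
    if r = 0 then x • ket K (m + 2 • unitVec n 1)
    else if r = n then
      (qInt q (entry m n) * qInt q (entry m n - 1) / qInt q 2 ^ 2) •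
        ket K (m - 2 • unitVec n n)
    else qInt q (entry m r) • ket K (m - unitVec n r + unitVec n (r + 1))

/-- The action of `f_r`, `0 ≤ r ≤ n`. -/
def opF (n : ℕ) (q x : K) (r : ℕ) : Module.End K (Fock K n) :=
  Finsupp.linearCombination K fun m : Occ n =>
    if r = 0 then
      (qInt q (entry m 1) * qInt q (entry m 1 - 1) / qInt q 2 ^ 2 * x⁻¹) •
        ket K (m - 2 • unitVec n 1)
    else if r = n then ket K (m + 2 • unitVec n n)
    else qInt q (entry m (r + 1)) • ket K (m - unitVec n (r + 1) + unitVec n r)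

/-- The eigenvalue of `k_r` on `|m⟩`, `0 ≤ r ≤ n`. -/
def kEig (q : K) (r : ℕ) (m : Occ n) : K :=
  if r = 0 then -q ^ (2 * entry m 1 + 1)
  else if r = n then -q ^ (-2 * (entry m n : ℤ) - 1)
  else q ^ (-(entry m r : ℤ) + (entry m (r + 1) : ℤ))

/-- The action of `k_r`, `0 ≤ r ≤ n`. -/
def opK (n : ℕ) (q : K) (r : ℕ) : Module.End K (Fock K n) :=
  Finsupp.linearCombination K fun m : Occ n => kEig q r m • ket K m

/-- The action of `k_r^{-1}`, `0 ≤ r ≤ n`. -/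
def opKinv (n : ℕ) (q : K) (r : ℕ) : Module.End K (Fock K n) :=
  Finsupp.linearCombination K fun m : Occ n => (kEig q r m)⁻¹ • ket K m

/-- The underlying space of `V_x ⊗ V_y`. -/
abbrev Fock2 (K : Type*) [Field K] (n : ℕ) : Type _ := Fock K n ⊗[K] Fock K n

/-- `(π_x ⊗ π_y) Δ(k_r)`, which is also `(π_x ⊗ π_y) Δ'(k_r)`. -/
def deltaK (n : ℕ) (q : K) (r : ℕ) : Module.End K (Fock2 K n) :=
  TensorProduct.map (opK n q r) (opK n q r)

/-- `(π_x ⊗ π_y) Δ(e_r)` with `Δ e_r = 1 ⊗ e_r + e_r ⊗ k_r`. -/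
def deltaE (n : ℕ) (q x y : K) (r : ℕ) : Module.End K (Fock2 K n) :=
  TensorProduct.map LinearMap.id (opE n q y r) + TensorProduct.map (opE n q x r) (opK n q r)

/-- `(π_x ⊗ π_y) Δ(f_r)` with `Δ f_r = f_r ⊗ 1 + k_r^{-1} ⊗ f_r`. -/
def deltaF (n : ℕ) (q x y : K) (r : ℕ) : Module.End K (Fock2 K n) :=
  TensorProduct.map (opF n q x r) LinearMap.id + TensorProduct.map (opKinv n q r) (opF n q y r)

/-- `(π_x ⊗ π_y) Δ'(e_r)` for the opposite coproduct. -/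
def deltaE' (n : ℕ) (q x y : K) (r : ℕ) : Module.End K (Fock2 K n) :=
  TensorProduct.map (opE n q x r) LinearMap.id + TensorProduct.map (opK n q r) (opE n q y r)

/-- `(π_x ⊗ π_y) Δ'(f_r)` for the opposite coproduct. -/
def deltaF' (n : ℕ) (q x y : K) (r : ℕ) : Module.End K (Fock2 K n) :=
  TensorProduct.map LinearMap.id (opF n q y r) + TensorProduct.map (opF n q x r) (opKinv n q r)

/-- `V^ε`, `ε = ±1`: the span of the `|m⟩` with `(-1)^{|m|} = ε`. -/
def parityPart (K : Type*) [Field K] (n : ℕ) (ε : ℤˣ) : Submodule K (Fock K n) :=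
  Submodule.span K {v | ∃ m : Occ n, (-1 : ℤˣ) ^ (∑ a, m a) = ε ∧ v = ket K m}

/-- `V^{ε₁} ⊗ V^{ε₂}` as a subspace of `V ⊗ V`. -/
def parityBlock (K : Type*) [Field K] (n : ℕ) (ε₁ ε₂ : ℤˣ) : Submodule K (Fock2 K n) :=
  LinearMap.range (TensorProduct.mapIncl (parityPart K n ε₁) (parityPart K n ε₂))

/-- `R`, acting on `V_x ⊗ V_y`, is the quantum `R` matrix `R(z)`, `z = x / y`: it is a direct sum of
endomorphisms `R^{ε₁,ε₂}` of the `V_x^{ε₁} ⊗ V_y^{ε₂}`, each of them intertwines `Δ` and `Δ'` on the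
generators of `U_q(C_n^{(1)})`, and they have the standard normalization. The parameter `c` of the
normalization stands for `-i q^{1/2}`. -/
structure IsQuantumR (n : ℕ) (q c x y : K) (R : Module.End K (Fock2 K n)) : Prop where
  block : ∀ ε₁ ε₂ : ℤˣ, ∀ t ∈ parityBlock K n ε₁ ε₂, R t ∈ parityBlock K n ε₁ ε₂
  comm_k : ∀ r ≤ n, deltaK n q r * R = R * deltaK n q r
  comm_e : ∀ r ≤ n, deltaE' n q x y r * R = R * deltaE n q x y r
  comm_f : ∀ r ≤ n, deltaF' n q x y r * R = R * deltaF n q x y r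
  norm_pp : R (ket K 0 ⊗ₜ ket K 0) = ket K 0 ⊗ₜ ket K 0
  norm_pm : R (ket K 0 ⊗ₜ ket K (unitVec n 1)) =
    (c / (1 - x / y)) • (ket K 0 ⊗ₜ ket K (unitVec n 1))
  norm_mp : R (ket K (unitVec n 1) ⊗ₜ ket K 0) =
    (c / (1 - x / y)) • (ket K (unitVec n 1) ⊗ₜ ket K 0)
  norm_mm : R (ket K (unitVec n 1) ⊗ₜ ket K (unitVec n 1)) =
    ((x / y - q ^ 2) / (1 - x / y * q ^ 2)) •
      (ket K (unitVec n 1) ⊗ₜ ket K (unitVec n 1))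

/-- The exchange `P(u ⊗ v) = v ⊗ u` composed with `R`. -/
def permR (R : Module.End K (Fock2 K n)) : Module.End K (Fock2 K n) :=
  (TensorProduct.comm K (Fock K n) (Fock K n)).toLinearMap ∘ₗ R

/-- `p(ε) = 0` for `ε = +` and `1` for `ε = -`. -/
def parityNum (ε : ℤˣ) : ℕ := if ε = 1 then 0 else 1

/-- The singular vectors `v^ε_l` of `V ⊗ V`. The vector `v^-_0` involves `𝐞_{n-1}` and exists for
`n ≥ 2` only; for `n = 1` it is read as `0`. The exponent `k (2l - k - 1) / 2` is an integer. -/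
def singVec (n : ℕ) (q : K) (ε : ℤˣ) (l : ℕ) : Fock2 K n :=
  if ε = -1 ∧ l = 0 then
    if 2 ≤ n then
      ket K (unitVec n (n - 1)) ⊗ₜ ket K (unitVec n n) -
        q • (ket K (unitVec n n) ⊗ₜ ket K (unitVec n (n - 1)))
    else 0
  else
    ∑ k ∈ (Finset.range (l + 1)).filter (fun k => k % 2 = parityNum ε),
      (q ^ ((k : ℤ) * (2 * l - k - 1) / 2) * qBinom q l k) •
        (ket K (k • unitVec n n) ⊗ₜ ket K ((l - k) • unitVec n n))

/-- `V^ε_l`: the subspace generated by `f_1, …, f_n` from `v^ε_l`, i.e. the smallest subspace that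
contains `v^ε_l` and is stable under `Δ(f_1), …, Δ(f_n)`. (The generators with index `≥ 1` do not
involve `x` and `y`, which are put to `1` here and below.) -/
def component (n : ℕ) (q : K) (ε : ℤˣ) (l : ℕ) : Submodule K (Fock2 K n) :=
  sInf {W | singVec n q ε l ∈ W ∧ ∀ r, 1 ≤ r → r ≤ n → ∀ t ∈ W, deltaF n q 1 1 r t ∈ W}

/-- `P` is the projector of `V ⊗ V` on `V^ε_l` along all the other `V^{ε'}_{l'}`. -/
def IsProjector (n : ℕ) (q : K) (ε : ℤˣ) (l : ℕ) (P : Module.End K (Fock2 K n)) : Prop :=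
  (∀ t ∈ component n q ε l, P t = t) ∧
    ∀ (ε' : ℤˣ) (l' : ℕ), (ε', l') ≠ (ε, l) → ∀ t ∈ component n q ε' l', P t = 0

/-- `P` is linear over `U_q(C_n)`, the subalgebra with the generators of index `1, …, n`. -/
def IsClassicalLinear (n : ℕ) (q : K) (P : Module.End K (Fock2 K n)) : Prop :=
  ∀ r, 1 ≤ r → r ≤ n →
    P * deltaK n q r = deltaK n q r * P ∧
    P * deltaE n q 1 1 r = deltaE n q 1 1 r * P ∧
    P * deltaF n q 1 1 r = deltaF n q 1 1 r * P

/-- `P` is a `U_q(C_n)` linear map that sends `v^ε_l` to `v^{-ε}_l` and all the other singular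
vectors to `0`. -/
def IsTransfer (n : ℕ) (q : K) (ε : ℤˣ) (l : ℕ) (P : Module.End K (Fock2 K n)) : Prop :=
  IsClassicalLinear n q P ∧ P (singVec n q ε l) = singVec n q (-ε) l ∧
    ∀ (ε' : ℤˣ) (l' : ℕ), (ε', l') ≠ (ε, l) → P (singVec n q ε' l') = 0

end

end QOscillator

open QOscillator

/-! Everything rests on one operator, `opJ`, called `J` here. At `q = 1`, with kets read as
monomials in two sets of variables `u`, `w`, it is `Σ (u_a ∂/∂w_a + w_a ∂/∂u_a)`. It commutes with
the action of `U_q(C_n)` on `V ⊗ V`, it flips both parities, it is self-adjoint for the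
contravariant form `form2`, and it satisfies `J v^ε_l = [l] v^{-ε}_l` (`opJ_singVec`,
`opJ_singVec_zero`). So `V^ε_l` lies in a joint eigenspace `jointEig` of the parities and of `J²`,
with eigenvalue `[l]²` for the latter. Since `q` is not a root of unity, these eigenvalues separate
the pairs `(ε, l)`.

Decomposition. A linear functional that vanishes on the images of `f_1, …, f_n` and on all the
singular vectors is zero (`functional_eq_zero`): the relations coming from the `f_r` reduce its
values to those on a few families of kets, where the singular vectors finish it off. By induction on
a degree that every `f_r` raises, the components span (`iSup_component`). Joint eigenspaces for
different `(ε, l)` are orthogonal for a nondegenerate form, so they are independent, and each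
component equals its eigenspace (`component_eq_jointEig`). The transfer operator on `V^ε_l` is then
`J / [l]`.

Existence of `R`. The action of `e_0` is `y A + x B`, and `A`, `B` together with a third operator
`C` are closed under twisted commutation with `J` (`opJ_opA`, `opJ_opB`, `opJ_opC`). Hence `e_0`
takes an eigenvector of `J` with eigenvalue `[s]` to a sum of eigenvectors for `[s+2]`, `[s]`,
`[s-2]`, with explicit coefficients (`deltaE_zero_apply`). Let `D` act by `spec s` on the
`[s]`-eigenspace. As a function of `J` it commutes with `U_q(C_n)`, and it exchanges the parameters
`x`, `y` in `e_0` exactly when `spec` obeys a two-step recursion (`spec_add_two`), which the stated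
products solve. The relation for `f_0` is the adjoint of the one for `e_0`. Thus `D` is `P R(z)`,
and its values on the components are the spectral decomposition.

Uniqueness. Any intertwiner of this kind sends `v^ε_l` to a multiple of `v^{±ε}_l`
(`IsBraiding.exists_singVec`), so it is determined by one constant on each component. If it kills a
component, the relation for `e_0` forces it to kill the components with `l` shifted by 2, because
the shift coefficients vanish only when `z` is a power of `q`. The four normalization vectors start
this propagation, which reaches every component (`IsBraiding.eq_zero`). -/

namespace QOscillator

set_option linter.unusedSectionVars false
set_option linter.unusedSimpArgs false

noncomputable section

/-! ### `q`-integers -/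

section QNumbers

variable {K : Type*} [Field K]

/-- The `q`-integer `[s]` of an integer `s`. -/
def qi (q : K) (s : ℤ) : K := (q ^ s - q ^ (-s)) / (q - q⁻¹)

lemma qInt_eq_qi (q : K) (m : ℕ) : qInt q m = qi q m := by
  simp [qInt, qi, zpow_neg, inv_pow]

@[simp] lemma qi_zero (q : K) : qi q 0 = 0 := by simp [qi]

lemma qi_neg (q : K) (s : ℤ) : qi q (-s) = -qi q s := by
  simp [qi, ← neg_div]

@[simp] lemma qInt_zero (q : K) : qInt q 0 = 0 := by simp [qInt]

variable {q : K} (hq0 : q ≠ 0) (hq : ∀ k : ℕ, 1 ≤ k → q ^ k ≠ 1)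

include hq0 hq

lemma eq_zero_of_zpow_eq_one {k : ℤ} (h : q ^ k = 1) : k = 0 := by
  by_contra hk
  have h1 : q ^ k.natAbs = 1 := by
    rcases Int.natAbs_eq k with h2 | h2
    · rw [h2, zpow_natCast] at h; exact h
    · rw [h2, zpow_neg, zpow_natCast, inv_eq_one] at h; exact h
  exact hq _ (by omega) h1

lemma zpow_inj {s t : ℤ} (h : q ^ s = q ^ t) : s = t := by
  have : q ^ (s - t) = 1 := by
    rw [zpow_sub₀ hq0, h, div_self (zpow_ne_zero _ hq0)]
  have := eq_zero_of_zpow_eq_one hq0 hq this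
  omega

lemma q_sub_inv_ne : q - q⁻¹ ≠ 0 := by
  intro h
  have : q ^ (1 : ℤ) = q ^ (-1 : ℤ) := by simpa [sub_eq_zero] using h
  have := zpow_inj hq0 hq this
  omega

lemma q_sq_sub_one_ne : q ^ 2 - 1 ≠ 0 := sub_ne_zero.mpr (hq 2 one_le_two)

lemma qi_one : qi q 1 = 1 := by
  have := q_sub_inv_ne hq0 hq
  simp [qi, div_self this]

lemma qi_two : qi q 2 = q + q⁻¹ := by
  have h := q_sub_inv_ne hq0 hq
  rw [qi, div_eq_iff h, zpow_neg]
  rw [show (2 : ℤ) = ((2 : ℕ) : ℤ) from rfl, zpow_natCast]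
  field_simp
  ring

variable [CharZero K]

/-- Squaring gives `q^{2k} = 1`, so `k = 0` and `1 = -1`, impossible in characteristic 0. This is
why the denominators `q^s + q^t` met later never vanish. -/
lemma zpow_ne_neg_one (k : ℤ) : q ^ k ≠ -1 := by
  intro h
  have h2 : q ^ (k + k) = 1 := by rw [zpow_add₀ hq0, h]; ring
  have h3 := eq_zero_of_zpow_eq_one hq0 hq h2
  have h4 : k = 0 := by omega
  rw [h4, zpow_zero] at h
  have : (2 : K) = 0 := by linear_combination h
  exact two_ne_zero this

lemma zpow_add_zpow_ne_zero (s t : ℤ) : q ^ s + q ^ t ≠ 0 := by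
  intro h
  refine zpow_ne_neg_one hq0 hq (s - t) ?_
  rw [zpow_sub₀ hq0, div_eq_iff (zpow_ne_zero _ hq0)]
  linear_combination h

/-- Clearing denominators, the difference factors as `(q^s - q^t)(q^{s+t} + 1)`. The resulting
injectivity on all of `ℤ` is what lets the `[s]` serve as labels for the eigenspaces of `J`. -/
lemma qi_inj {s t : ℤ} (h : qi q s = qi q t) : s = t := by
  have h1 := q_sub_inv_ne hq0 hq
  rw [qi, qi, div_left_inj' h1, zpow_neg, zpow_neg] at h
  have h2 : (q ^ s - q ^ t) * (q ^ s * q ^ t + 1) = 0 := by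
    have hs := zpow_ne_zero s hq0
    have ht := zpow_ne_zero t hq0
    field_simp at h
    linear_combination h
  rcases mul_eq_zero.mp h2 with h3 | h3
  · exact zpow_inj hq0 hq (sub_eq_zero.mp h3)
  · rw [← zpow_add₀ hq0] at h3
    exact absurd (eq_neg_of_add_eq_zero_left h3) (zpow_ne_neg_one hq0 hq _)

lemma qi_ne_zero {s : ℤ} (h : s ≠ 0) : qi q s ≠ 0 := fun h2 =>
  h (qi_inj hq0 hq (by rw [h2, qi_zero]))

lemma qi_sq_eq {s t : ℤ} (h : qi q s ^ 2 = qi q t ^ 2) : s = t ∨ s = -t := by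
  rcases sq_eq_sq_iff_eq_or_eq_neg.mp h with h | h
  · exact Or.inl (qi_inj hq0 hq h)
  · rw [← qi_neg] at h; exact Or.inr (qi_inj hq0 hq h)

lemma qInt_ne_zero {m : ℕ} (h : m ≠ 0) : qInt q m ≠ 0 := by
  rw [qInt_eq_qi]; exact qi_ne_zero hq0 hq (by exact_mod_cast h)

lemma qFact_ne_zero (m : ℕ) : qFact q m ≠ 0 :=
  Finset.prod_ne_zero_iff.mpr fun k hk =>
    qInt_ne_zero hq0 hq (by have := (Finset.mem_Icc.mp hk).1; omega)

omit hq0 hq [CharZero K] in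
lemma qFact_succ (m : ℕ) : qFact q (m + 1) = qFact q m * qInt q (m + 1) := by
  rw [qFact, Finset.prod_Icc_succ_top (by omega), qFact]

omit hq0 hq [CharZero K] in
@[simp] lemma qFact_zero : qFact q 0 = 1 := by simp [qFact]

lemma qBinom_zero (l : ℕ) : qBinom q l 0 = 1 := by
  simp [qBinom, div_self (qFact_ne_zero hq0 hq l)]

lemma qBinom_self (l : ℕ) : qBinom q l l = 1 := by
  simp [qBinom, div_self (qFact_ne_zero hq0 hq l)]

lemma qBinom_ne_zero (l k : ℕ) : qBinom q l k ≠ 0 :=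
  div_ne_zero (qFact_ne_zero hq0 hq _)
    (mul_ne_zero (qFact_ne_zero hq0 hq _) (qFact_ne_zero hq0 hq _))

lemma qBinom_succ_right {l k : ℕ} (h : k < l) :
    qBinom q l (k + 1) * qInt q (k + 1) = qBinom q l k * qInt q (l - k) := by
  obtain ⟨d, rfl⟩ : ∃ d, l = k + 1 + d := ⟨l - (k + 1), by omega⟩
  have e1 : k + 1 + d - (k + 1) = d := by omega
  have e2 : k + 1 + d - k = d + 1 := by omega
  rw [qBinom, qBinom, e1, e2, qFact_succ, qFact_succ]
  have := qFact_ne_zero hq0 hq k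
  have := qFact_ne_zero hq0 hq d
  have := qInt_ne_zero hq0 hq (Nat.succ_ne_zero k)
  have := qInt_ne_zero hq0 hq (Nat.succ_ne_zero d)
  simp only [Nat.succ_eq_add_one] at *
  field_simp

/-- A `q`-Pascal rule, which comes from `[l+1] = q^{-(k+1)} [l-k] + q^{l-k} [k+1]`. -/
lemma qBinom_succ_succ {l k : ℕ} (h : k < l) :
    qBinom q (l + 1) (k + 1) =
      q ^ (-(k + 1 : ℤ)) * qBinom q l (k + 1) + q ^ (l - k : ℤ) * qBinom q l k := by
  obtain ⟨d, rfl⟩ : ∃ d, l = k + 1 + d := ⟨l - (k + 1), by omega⟩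
  have e1 : k + 1 + d - (k + 1) = d := by omega
  have e2 : k + 1 + d - k = d + 1 := by omega
  have e3 : k + 1 + d + 1 - (k + 1) = d + 1 := by omega
  rw [qBinom, qBinom, qBinom, e1, e2, e3, qFact_succ (k + 1 + d), qFact_succ k, qFact_succ d]
  have h1 := qFact_ne_zero hq0 hq k
  have h2 := qFact_ne_zero hq0 hq d
  have h3 := qInt_ne_zero hq0 hq (Nat.succ_ne_zero k)
  have h4 := qInt_ne_zero hq0 hq (Nat.succ_ne_zero d)
  have h5 : qInt q (k + 1 + d + 1) =
      q ^ (-(k + 1 : ℤ)) * qInt q (d + 1) + q ^ (d + 1 : ℤ) * qInt q (k + 1) := by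
    simp only [qInt_eq_qi, qi]
    have := q_sub_inv_ne hq0 hq
    field_simp
    push_cast
    simp only [mul_sub, ← zpow_add₀ hq0]
    ring_nf
  simp only [Nat.succ_eq_add_one] at *
  rw [h5]
  have e4 : ((k + 1 + d : ℕ) : ℤ) - k = d + 1 := by push_cast; ring
  rw [e4]
  field_simp

/-- The `q`-binomial theorem. -/
lemma sum_qBinom (l : ℕ) (z : K) :
    ∑ k ∈ Finset.range (l + 1), q ^ ((k : ℤ) * (l - 1)) * qBinom q l k * z ^ k =
      ∏ j ∈ Finset.range l, (1 + q ^ (2 * j) * z) := by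
  induction l with
  | zero => simp [qBinom_zero hq0 hq]
  | succ l ih =>
    -- The two extreme terms are split off on each side: the Pascal rule covers only the inner
    -- indices.
    rw [Finset.prod_range_succ, ← ih, mul_add, mul_one, Finset.sum_range_succ',
      Finset.sum_range_succ]
    rw [Finset.sum_mul]
    conv_rhs => rw [Finset.sum_range_succ', Finset.sum_range_succ (n := l)]
    rw [qBinom_zero hq0 hq, qBinom_zero hq0 hq, qBinom_self hq0 hq, qBinom_self hq0 hq]
    have : ∑ k ∈ Finset.range l, q ^ (((k + 1 : ℕ) : ℤ) * ((l + 1 : ℕ) - 1)) *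
        qBinom q (l + 1) (k + 1) * z ^ (k + 1) =
        ∑ k ∈ Finset.range l, q ^ (((k + 1 : ℕ) : ℤ) * (l - 1)) *
          qBinom q l (k + 1) * z ^ (k + 1) +
        ∑ k ∈ Finset.range l, q ^ ((k : ℤ) * (l - 1)) * qBinom q l k * z ^ k *
          (q ^ (2 * l) * z) := by
      rw [← Finset.sum_add_distrib]
      refine Finset.sum_congr rfl fun k hk => ?_
      rw [qBinom_succ_succ hq0 hq (Finset.mem_range.mp hk), mul_add, ← mul_assoc, ← mul_assoc,
        ← zpow_add₀ hq0, ← zpow_add₀ hq0, add_mul, pow_succ]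
      congr 1
      · congr 3; push_cast; ring
      · have : q ^ (((k + 1 : ℕ) : ℤ) * ((l + 1 : ℕ) - 1) + (l - k)) =
            q ^ ((k : ℤ) * (l - 1)) * q ^ (2 * l) := by
          rw [← zpow_natCast q (2 * l), ← zpow_add₀ hq0]
          congr 1; push_cast; ring
        rw [this]; ring
    rw [this]
    have e : q ^ (((l + 1 : ℕ) : ℤ) * ((l + 1 : ℕ) - 1)) =
        q ^ ((l : ℤ) * (l - 1)) * q ^ (2 * l) := by
      rw [← zpow_natCast q (2 * l), ← zpow_add₀ hq0]
      congr 1; push_cast; ring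
    rw [e]
    simp
    ring

lemma one_add_pow_ne_zero (k : ℕ) : 1 + q ^ k ≠ 0 := by
  have := zpow_ne_neg_one hq0 hq k
  rw [zpow_natCast] at this
  intro h
  exact this (by linear_combination h)

/-- Twice the sum over one parity class is the `q`-binomial product at `1` plus or minus the one at
`-1`. The latter has the zero factor `1 - 1` as soon as `l > 0`, and the factors `1 + q^{2j}` of the
former are nonzero. This number is the obstruction to a functional surviving on `v^ε_l`. -/
lemma sum_qBinom_filter_ne_zero (l s : ℕ) (hs : s < 2) (hsl : s ≤ l) :
    ∑ k ∈ (Finset.range (l + 1)).filter (fun k => k % 2 = s),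
      q ^ ((k : ℤ) * (l - 1)) * qBinom q l k ≠ 0 := by
  rcases Nat.eq_zero_or_pos l with rfl | hl
  · obtain rfl : s = 0 := by omega
    simp [qBinom_zero hq0 hq, Finset.filter_singleton]
  have h1 := sum_qBinom hq0 hq l 1
  have h2 := sum_qBinom hq0 hq l (-1)
  have h3 : ∏ j ∈ Finset.range l, (1 + q ^ (2 * j) * (-1)) = 0 :=
    Finset.prod_eq_zero (Finset.mem_range.mpr hl) (by simp)
  rw [h3] at h2
  set S := ∑ k ∈ (Finset.range (l + 1)).filter (fun k => k % 2 = s),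
      q ^ ((k : ℤ) * (l - 1)) * qBinom q l k with hS
  have key : 2 * S = ∏ j ∈ Finset.range l, (1 + q ^ (2 * j) * 1) := by
    have : 2 * S = ∑ k ∈ Finset.range (l + 1), q ^ ((k : ℤ) * (l - 1)) * qBinom q l k * 1 ^ k +
        (-1) ^ s *
          ∑ k ∈ Finset.range (l + 1), q ^ ((k : ℤ) * (l - 1)) * qBinom q l k * (-1) ^ k := by
      rw [hS, Finset.sum_filter, Finset.mul_sum, Finset.mul_sum, ← Finset.sum_add_distrib]
      refine Finset.sum_congr rfl fun k _ => ?_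
      rcases Nat.even_or_odd k with hk | hk
      · rw [hk.neg_one_pow]
        have := Nat.even_iff.mp hk
        interval_cases s <;> simp [this] <;> ring
      · rw [hk.neg_one_pow]
        have := Nat.odd_iff.mp hk
        interval_cases s <;> simp [this] <;> ring
    rw [this, h1, h2]; ring
  intro h0
  rw [h0, mul_zero] at key
  exact Finset.prod_ne_zero_iff.mpr (fun j _ => by
    rw [mul_one]; exact one_add_pow_ne_zero hq0 hq _) key.symm

end QNumbers

/-! ### Basis vectors and coordinates -/

section Kets

variable {K : Type*} [Field K] {n : ℕ}

/-- The basis vector `|m⟩ ⊗ |p⟩`. -/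
def kk (K : Type*) [Field K] {n : ℕ} (m p : Occ n) : Fock2 K n := ket K m ⊗ₜ ket K p

lemma ext_ket {W : Type*} [AddCommGroup W] [Module K W] {X Y : Fock K n →ₗ[K] W}
    (h : ∀ m, X (ket K m) = Y (ket K m)) : X = Y :=
  Finsupp.lhom_ext' fun m => LinearMap.ext_ring (h m)

lemma ext_kk {W : Type*} [AddCommGroup W] [Module K W] {X Y : Fock2 K n →ₗ[K] W}
    (h : ∀ m p, X (kk K m p) = Y (kk K m p)) : X = Y := by
  refine TensorProduct.ext (ext_ket fun m => ext_ket fun p => ?_)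
  simpa [kk] using h m p

/-- The coordinate of a vector of `V ⊗ V` at `|m⟩ ⊗ |p⟩`. -/
def coord (m p : Occ n) : Fock2 K n →ₗ[K] K :=
  Finsupp.lapply (m, p) ∘ₗ (finsuppTensorFinsupp' K (Occ n) (Occ n)).toLinearMap

lemma coord_kk (m p m' p' : Occ n) :
    coord m p (kk K m' p') = if m = m' ∧ p = p' then 1 else 0 := by
  simp only [coord, kk, ket, LinearMap.coe_comp, Function.comp_apply, LinearEquiv.coe_coe,
    finsuppTensorFinsupp'_single_tmul_single, Finsupp.lapply_apply, Finsupp.single_apply,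
    Prod.mk.injEq, mul_one]
  simp only [eq_comm]

lemma eq_zero_of_coord {u : Fock2 K n} (h : ∀ m p, coord m p u = 0) : u = 0 := by
  apply (finsuppTensorFinsupp' K (Occ n) (Occ n)).injective
  ext ⟨m, p⟩
  simpa [coord] using h m p

lemma opE_zero_ket (q x : K) (a : Fin n) (ha : (a : ℕ) = 0) (m : Occ n) :
    opE n q x 0 (ket K m) = x • ket K (m + 2 • Pi.single a 1) := by
  have : unitVec n 1 = Pi.single a 1 := by
    ext i; simp [unitVec, Pi.single_apply, Fin.ext_iff, ha]
  simp [opE, ket, this]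

lemma unitVec_eq (a : Fin n) : unitVec n ((a : ℕ) + 1) = Pi.single a 1 := by
  ext i; simp [unitVec, Pi.single_apply, Fin.ext_iff]

lemma entry_eq (m : Occ n) (a : Fin n) : entry m ((a : ℕ) + 1) = m a := by
  simp [entry, ← Fin.ext_iff]

lemma opF_zero_ket (q x : K) (a : Fin n) (ha : (a : ℕ) = 0) (m : Occ n) :
    opF n q x 0 (ket K m) = (qInt q (m a) * qInt q (m a - 1) / qInt q 2 ^ 2 * x⁻¹) •
      ket K (m - 2 • Pi.single a 1) := by
  have h1 := unitVec_eq a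
  have h2 := entry_eq m a
  rw [ha] at h1 h2
  simp only [zero_add] at h1 h2
  simp [opF, ket, h1, h2]

lemma opE_last_ket (q x : K) (a : Fin n) (ha : (a : ℕ) + 1 = n) (m : Occ n) :
    opE n q x n (ket K m) = (qInt q (m a) * qInt q (m a - 1) / qInt q 2 ^ 2) •
      ket K (m - 2 • Pi.single a 1) := by
  have h1 := unitVec_eq a
  have h2 := entry_eq m a
  rw [ha] at h1 h2
  have h3 : n ≠ 0 := by omega
  simp [opE, ket, h1, h2, h3]

lemma opF_last_ket (q x : K) (a : Fin n) (ha : (a : ℕ) + 1 = n) (m : Occ n) :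
    opF n q x n (ket K m) = ket K (m + 2 • Pi.single a 1) := by
  have h1 := unitVec_eq a
  rw [ha] at h1
  have h3 : n ≠ 0 := by omega
  simp [opF, ket, h1, h3]

lemma opE_mid_ket (q x : K) (a b : Fin n) (hab : (b : ℕ) = a + 1) (m : Occ n) :
    opE n q x ((a : ℕ) + 1) (ket K m) =
      qInt q (m a) • ket K (m - Pi.single a 1 + Pi.single b 1) := by
  have h1 := unitVec_eq a
  have h2 := entry_eq m a
  have h3 := unitVec_eq b
  have h4 : (a : ℕ) + 1 ≠ n := by omega
  rw [hab] at h3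
  simp [opE, ket, h1, h2, h3, h4]

lemma opF_mid_ket (q x : K) (a b : Fin n) (hab : (b : ℕ) = a + 1) (m : Occ n) :
    opF n q x ((a : ℕ) + 1) (ket K m) =
      qInt q (m b) • ket K (m - Pi.single b 1 + Pi.single a 1) := by
  have h1 := unitVec_eq a
  have h2 := entry_eq m b
  have h3 := unitVec_eq b
  have h4 : (a : ℕ) + 1 ≠ n := by omega
  rw [hab] at h3 h2
  simp [opF, ket, h1, h2, h3, h4]

lemma opK_ket (q : K) (r : ℕ) (m : Occ n) : opK n q r (ket K m) = kEig q r m • ket K m := by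
  simp [opK, ket]

lemma opKinv_ket (q : K) (r : ℕ) (m : Occ n) :
    opKinv n q r (ket K m) = (kEig q r m)⁻¹ • ket K m := by
  simp [opKinv, ket]

lemma kEig_zero (q : K) (a : Fin n) (ha : (a : ℕ) = 0) (m : Occ n) :
    kEig q 0 m = -q ^ (2 * m a + 1) := by
  have h2 := entry_eq m a
  rw [ha] at h2
  simp only [zero_add] at h2
  simp [kEig, h2]

lemma kEig_last (q : K) (a : Fin n) (ha : (a : ℕ) + 1 = n) (m : Occ n) :
    kEig q n m = -q ^ (-2 * (m a : ℤ) - 1) := by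
  have h2 := entry_eq m a
  rw [ha] at h2
  have h3 : n ≠ 0 := by omega
  simp [kEig, h2, h3]

lemma kEig_mid (q : K) (a b : Fin n) (hab : (b : ℕ) = a + 1) (m : Occ n) :
    kEig q ((a : ℕ) + 1) m = q ^ (-(m a : ℤ) + m b) := by
  have h1 := entry_eq m a
  have h2 := entry_eq m b
  have h4 : (a : ℕ) + 1 ≠ n := by omega
  rw [hab] at h2
  simp [kEig, h1, h2, h4]

lemma kEig_ne_zero {q : K} (hq0 : q ≠ 0) (r : ℕ) (m : Occ n) : kEig q r m ≠ 0 := by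
  unfold kEig
  split_ifs
  · exact neg_ne_zero.mpr (pow_ne_zero _ hq0)
  · exact neg_ne_zero.mpr (zpow_ne_zero _ hq0)
  · exact zpow_ne_zero _ hq0

lemma opK_mul_opKinv {q : K} (hq0 : q ≠ 0) (r : ℕ) : opK n q r ∘ₗ opKinv n q r = LinearMap.id :=
  ext_ket fun m => by simp [opK_ket, opKinv_ket, smul_smul, inv_mul_cancel₀ (kEig_ne_zero hq0 r m)]

lemma opKinv_mul_opK {q : K} (hq0 : q ≠ 0) (r : ℕ) : opKinv n q r ∘ₗ opK n q r = LinearMap.id :=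
  ext_ket fun m => by simp [opK_ket, opKinv_ket, smul_smul, mul_inv_cancel₀ (kEig_ne_zero hq0 r m)]

/-- The Dynkin nodes other than `0`: either an inner node or the last one. -/
lemma node_cases {r : ℕ} (h1 : 1 ≤ r) (h2 : r ≤ n) :
    (∃ a b : Fin n, (b : ℕ) = a + 1 ∧ r = a + 1) ∨ ∃ a : Fin n, (a : ℕ) + 1 = n ∧ n = r := by
  rcases h2.lt_or_eq with h | rfl
  · exact Or.inl ⟨⟨r - 1, by omega⟩, ⟨r, h⟩, by simp; omega, by simp; omega⟩
  · exact Or.inr ⟨⟨r - 1, by omega⟩, by simp; omega, rfl⟩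

lemma opE_congr (q x x' : K) {r : ℕ} (hr : r ≠ 0) : opE n q x r = opE n q x' r := by
  simp [opE, hr]

lemma opF_congr (q x x' : K) {r : ℕ} (hr : r ≠ 0) : opF n q x r = opF n q x' r := by
  simp [opF, hr]

lemma deltaE_congr (q x y : K) {r : ℕ} (hr : r ≠ 0) : deltaE n q x y r = deltaE n q 1 1 r := by
  rw [deltaE, deltaE, opE_congr q x 1 hr, opE_congr q y 1 hr]

lemma deltaF_congr (q x y : K) {r : ℕ} (hr : r ≠ 0) : deltaF n q x y r = deltaF n q 1 1 r := by
  rw [deltaF, deltaF, opF_congr q x 1 hr, opF_congr q y 1 hr]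

end Kets

/-! ### The contravariant form -/

section Form

variable {K : Type*} [Field K] {n : ℕ}

/-- The squared norm of `|m⟩`. -/
def ketNorm (q : K) (m : Occ n) : K := ∏ a, q ^ (m a).choose 2 * qFact q (m a)

/-- The contravariant form on `V`. -/
def form1 (n : ℕ) (q : K) : Fock K n →ₗ[K] Fock K n →ₗ[K] K :=
  Finsupp.linearCombination K fun m : Occ n => ketNorm q m • Finsupp.lapply m

lemma form1_ket (q : K) (m m' : Occ n) :
    form1 n q (ket K m) (ket K m') = if m = m' then ketNorm q m else 0 := by
  simp [form1, ket, Finsupp.single_apply, eq_comm]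

/-- The contravariant form on `V ⊗ V`. -/
def form2 (n : ℕ) (q : K) : Fock2 K n →ₗ[K] Fock2 K n →ₗ[K] K :=
  LinearMap.BilinForm.tmul (form1 n q) (form1 n q)

lemma form2_tmul (q : K) (u u' v v' : Fock K n) :
    form2 n q (u ⊗ₜ v) (u' ⊗ₜ v') = form1 n q u u' * form1 n q v v' := by
  simp [form2, mul_comm]

lemma form2_kk (q : K) (u : Fock2 K n) (m p : Occ n) :
    form2 n q u (kk K m p) = ketNorm q m * ketNorm q p * coord m p u := by
  have : (form2 n q).flip (kk K m p) = (ketNorm q m * ketNorm q p) • coord m p := by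
    refine ext_kk fun m' p' => ?_
    rw [LinearMap.flip_apply, LinearMap.smul_apply, coord_kk, kk, kk, form2_tmul, form1_ket,
      form1_ket]
    by_cases h1 : m = m' <;> by_cases h2 : p = p' <;> simp [h1, h2, eq_comm]
  exact LinearMap.congr_fun this u

lemma form2_symm (q : K) (u v : Fock2 K n) : form2 n q u v = form2 n q v u := by
  have : (form2 n q).flip = form2 n q := by
    refine ext_kk fun m p => ext_kk fun m' p' => ?_
    rw [LinearMap.flip_apply, form2_kk, form2_kk, coord_kk, coord_kk]
    by_cases h1 : m = m' <;> by_cases h2 : p = p' <;> simp [h1, h2, eq_comm]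
  exact LinearMap.congr_fun₂ this v u

/-- `Y` is the adjoint of `X` for the form `B`. -/
def IsAdj {V : Type*} [AddCommMonoid V] [Module K V] (B : V →ₗ[K] V →ₗ[K] K)
    (X Y : Module.End K V) : Prop := ∀ u v, B (X u) v = B u (Y v)

namespace IsAdj

variable {V : Type*} [AddCommMonoid V] [Module K V] {B : V →ₗ[K] V →ₗ[K] K}
  {X Y X' Y' : Module.End K V}

lemma mul (h : IsAdj B X Y) (h' : IsAdj B X' Y') : IsAdj B (X * X') (Y' * Y) :=
  fun u v => by rw [Module.End.mul_apply, h, h', Module.End.mul_apply]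

lemma add (h : IsAdj B X Y) (h' : IsAdj B X' Y') : IsAdj B (X + X') (Y + Y') :=
  fun u v => by simp [h u v, h' u v]

lemma smul (c : K) (h : IsAdj B X Y) : IsAdj B (c • X) (c • Y) :=
  fun u v => by simp [h u v]

lemma sum {ι : Type*} (s : Finset ι) {X Y : ι → Module.End K V}
    (h : ∀ i ∈ s, IsAdj B (X i) (Y i)) : IsAdj B (∑ i ∈ s, X i) (∑ i ∈ s, Y i) := by
  classical
  induction s using Finset.induction_on with
  | empty => intro u v; simp
  | insert a s ha ih =>
    rw [Finset.sum_insert ha, Finset.sum_insert ha]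
    exact (h a (by simp)).add (ih fun i hi => h i (by simp [hi]))

lemma id : IsAdj B LinearMap.id LinearMap.id := fun _ _ => rfl

lemma symm (hB : ∀ u v, B u v = B v u) (h : IsAdj B X Y) : IsAdj B Y X :=
  fun u v => by rw [hB, ← h, hB]

end IsAdj

lemma isAdj_map {q : K} {X Y X' Y' : Module.End K (Fock K n)} (h : IsAdj (form1 n q) X Y)
    (h' : IsAdj (form1 n q) X' Y') :
    IsAdj (form2 n q) (TensorProduct.map X X') (TensorProduct.map Y Y') := by
  have : (form2 n q).comp (TensorProduct.map X X') =
      (form2 n q).compl₂ (TensorProduct.map Y Y') := by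
    refine ext_kk fun m p => ext_kk fun m' p' => ?_
    simp only [LinearMap.coe_comp, Function.comp_apply, LinearMap.compl₂_apply, kk,
      TensorProduct.map_tmul]
    rw [form2_tmul, form2_tmul, h, h']
  exact fun u v => LinearMap.congr_fun₂ this u v

lemma isAdj_of_ket {q : K} {X Y : Module.End K (Fock K n)}
    (h : ∀ m m', form1 n q (X (ket K m)) (ket K m') = form1 n q (ket K m) (Y (ket K m'))) :
    IsAdj (form1 n q) X Y := by
  have : (form1 n q).comp X = (form1 n q).compl₂ Y :=
    ext_ket fun m => ext_ket fun m' => h m m'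
  exact fun u v => LinearMap.congr_fun₂ this u v

lemma isAdj_diag {q : K} {X : Module.End K (Fock K n)} (c : Occ n → K)
    (h : ∀ m, X (ket K m) = c m • ket K m) : IsAdj (form1 n q) X X :=
  isAdj_of_ket fun m m' => by
    rw [h, h, map_smul, map_smul, LinearMap.smul_apply, form1_ket]
    by_cases hm : m = m' <;> simp [hm]

/-- The weight in `ketNorm` is chosen for this ratio: lowering with coefficient `[m_a]` becomes
adjoint to raising with coefficient `q^{-m_a}`, which produces the factor `k_r` in the adjoint of
`e_r`. -/
lemma ketNorm_add_single (q : K) (m : Occ n) (a : Fin n) :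
    ketNorm q (m + Pi.single a 1) = ketNorm q m * (q ^ m a * qInt q (m a + 1)) := by
  rw [ketNorm, ketNorm, ← Finset.mul_prod_erase _ _ (Finset.mem_univ a),
    ← Finset.mul_prod_erase _ (fun i => q ^ (m i).choose 2 * qFact q (m i)) (Finset.mem_univ a)]
  have : ∏ i ∈ Finset.univ.erase a, q ^ ((m + Pi.single a 1 : Occ n) i).choose 2 *
      qFact q ((m + Pi.single a 1 : Occ n) i) =
      ∏ i ∈ Finset.univ.erase a, q ^ (m i).choose 2 * qFact q (m i) :=
    Finset.prod_congr rfl fun i hi => by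
      simp [Pi.single_eq_of_ne (Finset.ne_of_mem_erase hi)]
  rw [this]
  simp only [Pi.add_apply, Pi.single_eq_same, qFact_succ, Nat.choose_succ_succ' (m a) 1,
    Nat.choose_one_right, pow_add]
  ring

/-- A weighted raising operator and a weighted lowering operator are adjoint. -/
lemma isAdj_raise_lower {q : K} {X Y : Module.End K (Fock K n)} (a : Fin n) (c d : Occ n → K)
    (hX : ∀ m, X (ket K m) = c m • ket K (m + Pi.single a 1))
    (hY : ∀ m, Y (ket K m) = d m • ket K (m - Pi.single a 1))
    (h0 : ∀ m, m a = 0 → d m = 0)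
    (hcd : ∀ m, d (m + Pi.single a 1) = c m * (q ^ m a * qInt q (m a + 1))) :
    IsAdj (form1 n q) X Y := by
  refine isAdj_of_ket fun m m' => ?_
  rw [hX, hY, map_smul, map_smul, LinearMap.smul_apply, form1_ket, form1_ket]
  by_cases h : m' a = 0
  · have : m + Pi.single a 1 ≠ m' := by rintro rfl; simp at h
    simp [this, h0 m' h]
  · obtain ⟨m', rfl⟩ : ∃ m'', m' = m'' + Pi.single a 1 := ⟨m' - Pi.single a 1, by
      ext i
      by_cases hi : i = a
      · subst hi; simp; omega
      · simp [hi]⟩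
    rw [hcd, add_tsub_cancel_right]
    by_cases hm : m = m'
    · subst hm; simp [ketNorm_add_single]; ring
    · simp [hm]

/-- The weighted raising operator `|m⟩ ↦ c(m) |m + e_a⟩`. -/
def raise (a : Fin n) (c : Occ n → K) : Module.End K (Fock K n) :=
  Finsupp.linearCombination K fun m : Occ n => c m • ket K (m + Pi.single a 1)

/-- The weighted lowering operator `|m⟩ ↦ c(m) |m - e_a⟩`. -/
def lower (a : Fin n) (c : Occ n → K) : Module.End K (Fock K n) :=
  Finsupp.linearCombination K fun m : Occ n => c m • ket K (m - Pi.single a 1)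

@[simp] lemma raise_ket (a : Fin n) (c : Occ n → K) (m : Occ n) :
    raise a c (ket K m) = c m • ket K (m + Pi.single a 1) := by
  simp [raise, ket]

@[simp] lemma lower_ket (a : Fin n) (c : Occ n → K) (m : Occ n) :
    lower a c (ket K m) = c m • ket K (m - Pi.single a 1) := by
  simp [lower, ket]

lemma isAdj_raise {q : K} (a : Fin n) (c d : Occ n → K) (h0 : ∀ m, m a = 0 → d m = 0)
    (hcd : ∀ m, d (m + Pi.single a 1) = c m * (q ^ m a * qInt q (m a + 1))) :
    IsAdj (form1 n q) (raise a c) (lower a d) :=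
  isAdj_raise_lower a c d (raise_ket a c) (lower_ket a d) h0 hcd

lemma form1_symm (q : K) (u v : Fock K n) : form1 n q u v = form1 n q v u := by
  have : (form1 n q).flip = form1 n q := by
    refine ext_ket fun m => ext_ket fun m' => ?_
    rw [LinearMap.flip_apply, form1_ket, form1_ket]
    by_cases h1 : m = m' <;> simp [h1, eq_comm]
  exact LinearMap.congr_fun₂ this v u

/-! ### Nondegeneracy of the form and adjoints of the raising generators -/

section Generic

variable {q : K} (hq0 : q ≠ 0) (hq : ∀ k : ℕ, 1 ≤ k → q ^ k ≠ 1) [CharZero K]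
include hq0 hq

lemma ketNorm_ne_zero (m : Occ n) : ketNorm q m ≠ 0 :=
  Finset.prod_ne_zero_iff.mpr fun _ _ =>
    mul_ne_zero (pow_ne_zero _ hq0) (qFact_ne_zero hq0 hq _)

lemma form2_nondeg {u : Fock2 K n} (h : ∀ v, form2 n q u v = 0) : u = 0 :=
  eq_zero_of_coord fun m p => by
    have := h (kk K m p)
    rw [form2_kk] at this
    exact (mul_eq_zero.mp this).resolve_left
      (mul_ne_zero (ketNorm_ne_zero hq0 hq m) (ketNorm_ne_zero hq0 hq p))

lemma form2_nondeg' {u : Fock2 K n} (h : ∀ v, form2 n q v u = 0) : u = 0 :=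
  form2_nondeg hq0 hq fun v => by rw [form2_symm, h]

/-- Nondegeneracy makes adjoints unique, so that a commutation relation for `f_r` can be exchanged
for one for `e_r`. -/
lemma IsAdj.unique {X Y Y' : Module.End K (Fock2 K n)} (h : IsAdj (form2 n q) X Y)
    (h' : IsAdj (form2 n q) X Y') : Y = Y' := by
  refine LinearMap.ext fun v => ?_
  rw [← sub_eq_zero]
  exact form2_nondeg' hq0 hq fun u => by rw [map_sub, ← h, ← h', sub_self]

/-- The adjoint of `e_r` on `V` is a multiple of `k_r f_r`. -/
lemma isAdj_opE {r : ℕ} (h1 : 1 ≤ r) (h2 : r ≤ n) :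
    ∃ c : K, c ≠ 0 ∧ IsAdj (form1 n q) (opE n q 1 r) (c • (opK n q r ∘ₗ opF n q 1 r)) := by
  have hdn : ∀ a : Fin n, IsAdj (form1 n q) (lower a fun m => qInt q (m a))
      (raise a fun m => q ^ (-(m a : ℤ))) := fun a => by
    refine IsAdj.symm (form1_symm q) (isAdj_raise a _ _ (fun m hm => by simp [hm]) fun m => ?_)
    rw [← mul_assoc, ← zpow_natCast q (m a), ← zpow_add₀ hq0]
    simp
  rcases node_cases h1 h2 with ⟨a, b, hab, rfl⟩ | ⟨a, ha, rfl⟩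
  -- The adjoint carries `q^{-m_a + m_b - 1} [m_b]` whereas `k_r f_r` carries `q^{-m_a + m_b - 2}
  -- [m_b]`, hence the constant `q`.
  · refine ⟨q, hq0, ?_⟩
    have hne : a ≠ b := by rintro rfl; omega
    have hup : IsAdj (form1 n q) (raise b fun _ => 1)
        (lower b fun m => q ^ (m b - 1) * qInt q (m b)) :=
      isAdj_raise b _ _ (fun m hm => by simp [hm]) fun m => by simp
    have := hup.mul (hdn a)
    have e1 : opE n q 1 ((a : ℕ) + 1) =
        raise b (fun _ => 1) * lower a fun m => qInt q (m a) :=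
      ext_ket fun m => by simp [opE_mid_ket q 1 a b hab]
    rw [e1]
    convert this using 1
    refine ext_ket fun m => ?_
    simp only [LinearMap.smul_apply, LinearMap.comp_apply, opF_mid_ket q 1 a b hab, map_smul,
      opK_ket, kEig_mid q a b hab, Module.End.mul_apply, lower_ket, raise_ket, smul_smul]
    by_cases hb : m b = 0
    · simp [hb]
    · congr 1
      simp only [Pi.add_apply, Pi.sub_apply, Pi.single_eq_same, Pi.single_eq_of_ne hne,
        Pi.single_eq_of_ne hne.symm, add_zero, tsub_zero]
      obtain ⟨k, hk⟩ := Nat.exists_eq_succ_of_ne_zero hb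
      rw [hk]
      simp only [Nat.succ_eq_add_one, Nat.add_sub_cancel]
      rw [← zpow_natCast q k, show (-((m a + 1 : ℕ) : ℤ) + (k : ℤ)) = -(m a : ℤ) + k + (-1) by
        push_cast; ring, zpow_add₀ hq0, zpow_add₀ hq0, zpow_neg_one]
      field_simp
  · have hq2 : qInt q 2 ≠ 0 := qInt_ne_zero hq0 hq two_ne_zero
    -- The adjoint carries `q^{-2m_a-1} / [2]²` and `k_n f_n` carries `-q^{-2m_a-5}`; the constant
    -- is their ratio.
    refine ⟨-q ^ 4 / qInt q 2 ^ 2, div_ne_zero (neg_ne_zero.mpr (pow_ne_zero _ hq0))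
      (pow_ne_zero _ hq2), ?_⟩
    have e1 : opE n q 1 n = (1 / qInt q 2 ^ 2) • ((lower a fun m => qInt q (m a)) *
        lower a fun m => qInt q (m a)) :=
      ext_ket fun m => by
        simp only [opE_last_ket q 1 a ha, LinearMap.smul_apply, Module.End.mul_apply, lower_ket,
          map_smul, smul_smul, Pi.sub_apply, Pi.single_eq_same, tsub_tsub]
        rw [show Pi.single a 1 + Pi.single a 1 = (2 • Pi.single a 1 : Occ n) from
          (two_smul _ _).symm]
        congr 1
        ring
    rw [e1]
    convert ((hdn a).mul (hdn a)).smul (1 / qInt q 2 ^ 2) using 1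
    refine ext_ket fun m => ?_
    simp only [LinearMap.smul_apply, LinearMap.comp_apply, opF_last_ket q 1 a ha, map_smul,
      opK_ket, kEig_last q a ha, Module.End.mul_apply, raise_ket, smul_smul, add_assoc]
    rw [show Pi.single a 1 + Pi.single a 1 = (2 • Pi.single a 1 : Occ n) from
          (two_smul _ _).symm]
    congr 1
    simp only [Pi.add_apply, Pi.smul_apply, Pi.single_eq_same, smul_eq_mul, mul_one]
    have e2 : q ^ (-2 * ((m a + 2 : ℕ) : ℤ) - 1) = q ^ (-(m a : ℤ)) * q ^ (-((m a + 1 : ℕ) : ℤ)) /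
        q ^ 4 := by
      rw [← zpow_add₀ hq0, ← zpow_natCast q 4, ← zpow_sub₀ hq0]
      congr 1; push_cast; ring
    rw [e2]
    have := pow_ne_zero 4 hq0
    field_simp

/-- With `e* = c k f` the adjoint of `1 ⊗ e + e ⊗ k` is `c (1 ⊗ k f + k f ⊗ k)`, which is `c (k ⊗
k)(k^{-1} ⊗ f + f ⊗ 1)`. -/
lemma isAdj_deltaE {r : ℕ} (h1 : 1 ≤ r) (h2 : r ≤ n) :
    ∃ c : K, c ≠ 0 ∧
      IsAdj (form2 n q) (deltaE n q 1 1 r) (c • (deltaK n q r * deltaF n q 1 1 r)) := by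
  obtain ⟨c, hc, h⟩ := isAdj_opE (n := n) hq0 hq h1 h2
  refine ⟨c, hc, ?_⟩
  have hK : IsAdj (form1 n q) (opK n q r) (opK n q r) := isAdj_diag _ (opK_ket q r)
  have := (isAdj_map (IsAdj.id (B := form1 n q)) h).add (isAdj_map h hK)
  refine (congrArg (IsAdj (form2 n q) (deltaE n q 1 1 r)) ?_).mp this
  rw [deltaK, deltaF, mul_add, Module.End.mul_eq_comp, Module.End.mul_eq_comp,
    ← TensorProduct.map_comp, ← TensorProduct.map_comp, opK_mul_opKinv hq0, LinearMap.comp_id,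
    TensorProduct.map_smul_left, TensorProduct.map_smul_right, smul_add, add_comm]

end Generic

end Form

/-! ### Weighted shifts on the integer lattice

Kets are embedded in the lattice of integer occupation numbers, where weighted shifts can be
composed without regard to the boundary. -/

section Lattice

variable {K : Type*} [Field K] {n : ℕ}

/-- Pairs of integer occupation numbers. -/
abbrev Lat (n : ℕ) : Type := (Fin n → ℤ) × (Fin n → ℤ)

/-- Occupation numbers as integers. -/
def up (m : Occ n) : Fin n → ℤ := fun a => m a

@[simp] lemma up_apply (m : Occ n) (a : Fin n) : up m a = m a := rfl

lemma up_injective : Function.Injective (up : Occ n → Fin n → ℤ) := fun m m' h => by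
  ext a; simpa using congrFun h a

lemma up_add_single (m : Occ n) (a : Fin n) (k : ℕ) :
    up (m + Pi.single a k) = up m + Pi.single a (k : ℤ) := by
  ext i
  by_cases h : i = a
  · subst h; simp
  · simp [h]

lemma up_sub_single (m : Occ n) (a : Fin n) (k : ℕ) (h : k ≤ m a) :
    up (m - Pi.single a k) = up m - Pi.single a (k : ℤ) := by
  ext i
  by_cases hi : i = a
  · subst hi; simp [h]
  · simp [hi]

/-- The embedding of `V ⊗ V` in the space of finitely supported functions on the lattice. -/
def iota (K : Type*) [Field K] (n : ℕ) : Fock2 K n →ₗ[K] (Lat n →₀ K) :=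
  Finsupp.lmapDomain K K (fun mp : Occ n × Occ n => (up mp.1, up mp.2)) ∘ₗ
    (finsuppTensorFinsupp' K (Occ n) (Occ n)).toLinearMap

lemma iota_kk (m p : Occ n) : iota K n (kk K m p) = Finsupp.single (up m, up p) 1 := by
  simp [iota, kk, ket]

lemma iota_injective : Function.Injective (iota K n) := by
  rw [iota, LinearMap.coe_comp]
  refine (Finsupp.mapDomain_injective ?_).comp (LinearEquiv.injective _)
  rintro ⟨m, p⟩ ⟨m', p'⟩ h
  simp only [Prod.mk.injEq] at h
  exact Prod.ext (up_injective h.1) (up_injective h.2)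

/-- The weighted shift `|μ⟩ ↦ c(μ) |μ + δ⟩`. -/
def ws (c : Lat n → K) (δ : Lat n) : Module.End K (Lat n →₀ K) :=
  Finsupp.linearCombination K fun μ : Lat n => Finsupp.single (μ + δ) (c μ)

@[simp] lemma ws_single (c : Lat n → K) (δ μ : Lat n) :
    ws c δ (Finsupp.single μ 1) = Finsupp.single (μ + δ) (c μ) := by
  simp [ws]

lemma ext_single {W : Type*} [AddCommGroup W] [Module K W] {X Y : (Lat n →₀ K) →ₗ[K] W}
    (h : ∀ μ, X (Finsupp.single μ 1) = Y (Finsupp.single μ 1)) : X = Y :=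
  Finsupp.lhom_ext' fun m => LinearMap.ext_ring (h m)

lemma ws_mul (c c' : Lat n → K) (δ δ' : Lat n) :
    ws c δ * ws c' δ' = ws (fun μ => c' μ * c (μ + δ')) (δ' + δ) :=
  ext_single fun μ => by
    rw [Module.End.mul_apply, ws_single, ws_single, ← mul_one (c' μ), ← smul_eq_mul,
      ← Finsupp.smul_single, map_smul, ws_single, Finsupp.smul_single, smul_eq_mul, add_assoc]
    simp

lemma ws_add (c c' : Lat n → K) (δ : Lat n) : ws c δ + ws c' δ = ws (c + c') δ :=
  ext_single fun μ => by simp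

lemma ws_smul (t : K) (c : Lat n → K) (δ : Lat n) : t • ws c δ = ws (t • c) δ :=
  ext_single fun μ => by simp

lemma ws_congr {c c' : Lat n → K} {δ δ' : Lat n} (hδ : δ = δ') (hc : ∀ μ, c μ = c' μ) :
    ws c δ = ws c' δ' := by
  rw [hδ, funext hc]

lemma ws_eq_zero {c : Lat n → K} {δ : Lat n} (hc : ∀ μ, c μ = 0) : ws c δ = 0 :=
  ext_single fun μ => by simp [hc]

/-- The `t`-commutator of two endomorphisms. -/
def qComm {V : Type*} [AddCommGroup V] [Module K V] (t : K) (X Y : Module.End K V) :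
    Module.End K V := X * Y - t • (Y * X)

section qCommLemmas

variable {V : Type*} [AddCommGroup V] [Module K V] (t : K) (X X' Y Y' : Module.End K V)

lemma qComm_add_left : qComm t (X + X') Y = qComm t X Y + qComm t X' Y := by
  simp only [qComm, add_mul, mul_add, smul_add]; abel

lemma qComm_add_right : qComm t X (Y + Y') = qComm t X Y + qComm t X Y' := by
  simp only [qComm, add_mul, mul_add, smul_add]; abel

lemma qComm_sum_left {ι : Type*} (s : Finset ι) (X : ι → Module.End K V) :
    qComm t (∑ i ∈ s, X i) Y = ∑ i ∈ s, qComm t (X i) Y := by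
  simp only [qComm, Finset.sum_mul, Finset.mul_sum, Finset.smul_sum, Finset.sum_sub_distrib]

end qCommLemmas

/-- Both orders of composition displace by the same amount, so a twisted commutator of shifts is
again one shift. Operator relations thereby reduce to scalar identities in powers of `q`. -/
lemma qComm_ws (t : K) (c c' : Lat n → K) (δ δ' : Lat n) :
    qComm t (ws c δ) (ws c' δ') =
      ws (fun μ => c' μ * c (μ + δ') - t * (c μ * c' (μ + δ))) (δ + δ') := by
  refine ext_single fun μ => ?_
  rw [qComm, ws_mul, ws_mul, add_comm δ' δ]
  simp only [LinearMap.sub_apply, LinearMap.smul_apply, ws_single, Finsupp.smul_single,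
    smul_eq_mul, Finsupp.single_sub]

lemma qComm_ws_eq_zero {t : K} {c c' : Lat n → K} {δ δ' : Lat n}
    (h : ∀ μ, c' μ * c (μ + δ') = t * (c μ * c' (μ + δ))) :
    qComm t (ws c δ) (ws c' δ') = 0 := by
  rw [qComm_ws]; exact ws_eq_zero fun μ => by rw [h, sub_self]

/-- `X` is the restriction of a weighted shift to the kets. -/
def IsShift (X : Module.End K (Fock K n)) (c : (Fin n → ℤ) → K) (δ : Fin n → ℤ) : Prop :=
  ∀ m, (c (up m) = 0 ∧ X (ket K m) = 0) ∨
    ∃ m', up m' = up m + δ ∧ X (ket K m) = c (up m) • ket K m'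

/-- `Y` is an extension of `X` to the lattice. -/
def IsLift (X : Module.End K (Fock2 K n)) (Y : Module.End K (Lat n →₀ K)) : Prop :=
  ∀ t, iota K n (X t) = Y (iota K n t)

namespace IsLift

variable {X X' : Module.End K (Fock2 K n)} {Y Y' : Module.End K (Lat n →₀ K)}

lemma mul (h : IsLift X Y) (h' : IsLift X' Y') : IsLift (X * X') (Y * Y') := fun t => by
  rw [Module.End.mul_apply, h, h', Module.End.mul_apply]

lemma add (h : IsLift X Y) (h' : IsLift X' Y') : IsLift (X + X') (Y + Y') := fun t => by
  simp [h t, h' t]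

lemma smul (c : K) (h : IsLift X Y) : IsLift (c • X) (c • Y) := fun t => by simp [h t]

lemma sum {ι : Type*} (s : Finset ι) {X : ι → Module.End K (Fock2 K n)}
    {Y : ι → Module.End K (Lat n →₀ K)} (h : ∀ i, IsLift (X i) (Y i)) :
    IsLift (∑ i ∈ s, X i) (∑ i ∈ s, Y i) := fun t => by
  simp [LinearMap.sum_apply, h _ t]

lemma eq (h : IsLift X Y) (h' : IsLift X' Y) : X = X' :=
  LinearMap.ext fun t => iota_injective (by rw [h, h'])

/-- The embedding `iota` is injective, so a relation between lattice operators restricts to one on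
`V ⊗ V`. -/
lemma mul_eq {X'' : Module.End K (Fock2 K n)} {Y'' : Module.End K (Lat n →₀ K)} {t : K}
    (h : IsLift X Y) (h' : IsLift X' Y') (h'' : IsLift X'' Y'') (hY : qComm t Y Y' = Y'') :
    X * X' = t • (X' * X) + X'' := by
  refine (h.mul h').eq (Y := Y * Y') ?_
  have hY' : Y * Y' = t • (Y' * Y) + Y'' := LinearMap.ext fun v => by
    rw [← hY, qComm]; simp
  rw [hY']
  exact ((h'.mul h).smul t).add h''

lemma zero : IsLift (0 : Module.End K (Fock2 K n)) 0 := fun t => by simp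

lemma commute (h : IsLift X Y) (h' : IsLift X' Y') (hY : qComm 1 Y Y' = 0) :
    X * X' = X' * X := by
  simpa using h.mul_eq h' zero hY

end IsLift

lemma isLift_map {X X' : Module.End K (Fock K n)} {c c' : (Fin n → ℤ) → K} {δ δ' : Fin n → ℤ}
    (h : IsShift X c δ) (h' : IsShift X' c' δ') :
    IsLift (TensorProduct.map X X') (ws (fun μ => c μ.1 * c' μ.2) (δ, δ')) := by
  have : iota K n ∘ₗ TensorProduct.map X X' = ws (fun μ => c μ.1 * c' μ.2) (δ, δ') ∘ₗ iota K n := by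
    refine ext_kk fun m p => ?_
    rw [LinearMap.comp_apply, LinearMap.comp_apply, iota_kk, ws_single, kk,
      TensorProduct.map_tmul]
    rcases h m with ⟨h1, h2⟩ | ⟨m', h1, h2⟩
    · simp [h1, h2]
    rcases h' p with ⟨h3, h4⟩ | ⟨p', h3, h4⟩
    · simp [h3, h4]
    rw [h2, h4, TensorProduct.smul_tmul_smul, map_smul, ← kk, iota_kk, h1, h3]
    simp
  exact fun t => LinearMap.congr_fun this t

lemma isShift_raise (a : Fin n) {c : Occ n → K} (c' : (Fin n → ℤ) → K)
    (h : ∀ m, c m = c' (up m)) : IsShift (raise a c) c' (Pi.single a 1) := fun m =>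
  Or.inr ⟨m + Pi.single a 1, by simpa using up_add_single m a 1, by rw [raise_ket, h]⟩

/-- The condition at `m_a = 0` is the boundary condition: the lattice shift would leave the image of
the kets there, unless its coefficient vanishes. -/
lemma isShift_lower (a : Fin n) {c : Occ n → K} (c' : (Fin n → ℤ) → K)
    (h : ∀ m, c m = c' (up m)) (h0 : ∀ m, m a = 0 → c m = 0) :
    IsShift (lower a c) c' (-Pi.single a 1) := fun m => by
  by_cases hm : m a = 0
  · exact Or.inl ⟨by rw [← h, h0 m hm], by simp [h0 m hm]⟩
  · refine Or.inr ⟨m - Pi.single a 1, ?_, by rw [lower_ket, h]⟩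
    simpa [sub_eq_add_neg] using up_sub_single m a 1 (by omega)

lemma isShift_id : IsShift (LinearMap.id : Module.End K (Fock K n)) (fun _ => 1) 0 := fun m =>
  Or.inr ⟨m, by simp, by simp⟩

lemma isShift_opE_zero (q x : K) (a : Fin n) (ha : (a : ℕ) = 0) :
    IsShift (opE n q x 0) (fun _ => x) (Pi.single a 2) := fun m =>
  Or.inr ⟨m + 2 • Pi.single a 1, by
    rw [← Pi.single_smul]; simpa using up_add_single m a 2, opE_zero_ket q x a ha m⟩

lemma isShift_opF_last (q x : K) (a : Fin n) (ha : (a : ℕ) + 1 = n) :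
    IsShift (opF n q x n) (fun _ => 1) (Pi.single a 2) := fun m =>
  Or.inr ⟨m + 2 • Pi.single a 1, by
    rw [← Pi.single_smul]; simpa using up_add_single m a 2, by rw [opF_last_ket q x a ha, one_smul]⟩

lemma isShift_opF_mid (q x : K) (a b : Fin n) (hab : (b : ℕ) = a + 1) :
    IsShift (opF n q x ((a : ℕ) + 1)) (fun μ => qi q (μ b)) (Pi.single a 1 - Pi.single b 1) :=
  fun m => by
    rw [opF_mid_ket q x a b hab]
    by_cases hm : m b = 0
    · left; simp [hm]
    · right
      refine ⟨_, ?_, by rw [qInt_eq_qi]; rfl⟩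
      have h1 := up_add_single (m - Pi.single b 1) a 1
      have h2 := up_sub_single m b 1 (by omega)
      rw [h1, h2]
      simp only [Nat.cast_one]
      abel

lemma isShift_of_diag {X : Module.End K (Fock K n)} {c : Occ n → K} {c' : (Fin n → ℤ) → K}
    (h : ∀ m, X (ket K m) = c m • ket K m) (hc : ∀ m, c m = c' (up m)) : IsShift X c' 0 :=
  fun m => Or.inr ⟨m, by simp, by rw [h, hc]⟩

lemma isShift_opK_zero (q : K) (a : Fin n) (ha : (a : ℕ) = 0) :
    IsShift (opK n q 0) (fun μ => -q ^ (2 * μ a + 1)) 0 :=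
  isShift_of_diag (opK_ket q 0) fun m => by
    rw [kEig_zero q a ha, up_apply]; norm_cast

lemma isShift_opK_last (q : K) (a : Fin n) (ha : (a : ℕ) + 1 = n) :
    IsShift (opK n q n) (fun μ => -q ^ (-2 * μ a - 1)) 0 :=
  isShift_of_diag (opK_ket q n) fun m => by rw [kEig_last q a ha]; rfl

lemma isShift_opKinv_last (q : K) (a : Fin n) (ha : (a : ℕ) + 1 = n) :
    IsShift (opKinv n q n) (fun μ => -q ^ (2 * μ a + 1)) 0 :=
  isShift_of_diag (opKinv_ket q n) fun m => by
    rw [kEig_last q a ha, inv_neg, ← zpow_neg]; simp [add_comm]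

lemma isShift_opK_mid (q : K) (a b : Fin n) (hab : (b : ℕ) = a + 1) :
    IsShift (opK n q ((a : ℕ) + 1)) (fun μ => q ^ (-μ a + μ b)) 0 :=
  isShift_of_diag (opK_ket q _) fun m => by rw [kEig_mid q a b hab]; rfl

lemma isShift_opKinv_mid (q : K) (a b : Fin n) (hab : (b : ℕ) = a + 1) :
    IsShift (opKinv n q ((a : ℕ) + 1)) (fun μ => q ^ (μ a - μ b)) 0 :=
  isShift_of_diag (opKinv_ket q _) fun m => by
    rw [kEig_mid q a b hab, ← zpow_neg]; simp [sub_eq_add_neg, add_comm]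

end Lattice

/-! ### The operator `J`, which commutes with `U_q(C_n)` -/

section JOp

variable {K : Type*} [Field K] {n : ℕ}

/-- The exponent of the tail of the summand of `J` at the site `a`. -/
def tail (a : Fin n) (μ : Fin n → ℤ) : ℤ := ∑ i ∈ Finset.Iio a, μ i

lemma tail_add (a : Fin n) (μ ν : Fin n → ℤ) : tail a (μ + ν) = tail a μ + tail a ν := by
  simp [tail, Finset.sum_add_distrib]

lemma tail_sub (a : Fin n) (μ ν : Fin n → ℤ) : tail a (μ - ν) = tail a μ - tail a ν := by
  simp [tail]

lemma tail_single (a b : Fin n) (k : ℤ) :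
    tail a (Pi.single b k : Fin n → ℤ) = if b < a then k else 0 := by
  simp [tail, Pi.single_apply]

lemma tail_eq_zero {a : Fin n} (ha : (a : ℕ) = 0) (μ : Fin n → ℤ) : tail a μ = 0 :=
  Finset.sum_eq_zero fun i hi => by
    have := Finset.mem_Iio.mp hi
    rw [Fin.lt_def] at this
    omega

lemma tail_succ {a b : Fin n} (hab : (b : ℕ) = a + 1) (μ : Fin n → ℤ) :
    tail b μ = tail a μ + μ a := by
  have : Finset.Iio b = insert a (Finset.Iio a) := by
    ext i
    simp only [Finset.mem_Iio, Finset.mem_insert, Fin.lt_def, Fin.ext_iff]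
    omega
  rw [tail, this, Finset.sum_insert (by simp), add_comm, tail]

/-- The summand of `J` that moves a quantum from the second to the first factor at site `a`. -/
def jUp (n : ℕ) (q : K) (a : Fin n) : Module.End K (Fock2 K n) :=
  TensorProduct.map (raise a fun m => q ^ tail a (up m))
    (lower a fun p => q ^ (-tail a (up p)) * qInt q (p a))

/-- The adjoint of `jUp`. -/
def jDown (n : ℕ) (q : K) (a : Fin n) : Module.End K (Fock2 K n) :=
  TensorProduct.map (lower a fun m => q ^ (tail a (up m) + m a - 1) * qInt q (m a))
    (raise a fun p => q ^ (-tail a (up p) - p a))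

/-- The generator `J` of the commutant of `U_q(C_n)` on `V ⊗ V`. -/
def opJ (n : ℕ) (q : K) : Module.End K (Fock2 K n) := ∑ a, (jUp n q a + jDown n q a)

/-- The extension of `jUp` to the lattice. -/
def jUpLat (q : K) (a : Fin n) : Module.End K (Lat n →₀ K) :=
  ws (fun μ => q ^ tail a μ.1 * (q ^ (-tail a μ.2) * qi q (μ.2 a))) (Pi.single a 1, -Pi.single a 1)

/-- The extension of `jDown` to the lattice. -/
def jDownLat (q : K) (a : Fin n) : Module.End K (Lat n →₀ K) :=
  ws (fun μ => q ^ (tail a μ.1 + μ.1 a - 1) * qi q (μ.1 a) * q ^ (-tail a μ.2 - μ.2 a))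
    (-Pi.single a 1, Pi.single a 1)

lemma isLift_jUp (q : K) (a : Fin n) : IsLift (jUp n q a) (jUpLat q a) := by
  have h1 : IsShift (raise a fun m => q ^ tail a (up m)) (fun μ => q ^ tail a μ)
      (Pi.single a 1) := isShift_raise a _ fun _ => rfl
  have h2 : IsShift (lower a fun p => q ^ (-tail a (up p)) * qInt q (p a))
      (fun μ => q ^ (-tail a μ) * qi q (μ a)) (-Pi.single a 1) :=
    isShift_lower a _ (fun p => by rw [qInt_eq_qi, up_apply]) fun m hm => by simp [hm]
  have h3 := isLift_map h1 h2
  rwa [jUp, jUpLat]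

lemma isLift_jDown (q : K) (a : Fin n) : IsLift (jDown n q a) (jDownLat q a) := by
  have h1 : IsShift (lower a fun m => q ^ (tail a (up m) + m a - 1) * qInt q (m a))
      (fun μ => q ^ (tail a μ + μ a - 1) * qi q (μ a)) (-Pi.single a 1) :=
    isShift_lower a _ (fun p => by rw [qInt_eq_qi, up_apply]) fun m hm => by simp [hm]
  have h2 : IsShift (raise a fun p => q ^ (-tail a (up p) - p a))
      (fun μ => q ^ (-tail a μ - μ a)) (Pi.single a 1) := isShift_raise a _ fun _ => rfl
  have h3 := isLift_map h1 h2
  rwa [jDown, jDownLat]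

lemma isLift_opJ (q : K) :
    IsLift (opJ n q) (∑ a, (jUpLat q a + jDownLat q a)) :=
  IsLift.sum _ fun a => (isLift_jUp q a).add (isLift_jDown q a)

/-- Taking adjoints exchanges `jUp` and `jDown` at each site. -/
lemma isAdj_opJ {q : K} (hq0 : q ≠ 0) : IsAdj (form2 n q) (opJ n q) (opJ n q) := by
  refine IsAdj.sum _ fun a _ => ?_
  have h : IsAdj (form2 n q) (jUp n q a) (jDown n q a) := by
    refine isAdj_map (isAdj_raise a _ _ (fun m hm => by simp [hm]) fun m => ?_)
      ((isAdj_raise a _ _ (fun m hm => by simp [hm]) fun m => ?_).symm (form1_symm q))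
    · have e1 := up_add_single m a 1
      simp only [Nat.cast_one] at e1
      rw [e1, tail_add, tail_single]
      simp only [lt_irrefl, if_false, Pi.add_apply, Pi.single_eq_same, ← mul_assoc]
      rw [← zpow_natCast q (m a), ← zpow_add₀ hq0]
      congr 2; push_cast; ring
    · have e1 := up_add_single m a 1
      simp only [Nat.cast_one] at e1
      rw [e1, tail_add, tail_single]
      simp only [lt_irrefl, if_false, Pi.add_apply, Pi.single_eq_same, ← mul_assoc]
      rw [← zpow_natCast q (m a), ← zpow_add₀ hq0]
      congr 2; push_cast; ring
  have := h.add (h.symm (form2_symm q))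
  rwa [add_comm (jDown n q a) (jUp n q a)] at this

/-- The lattice form of `1 ⊗ e_0`. -/
def aLat (K : Type*) [Field K] (a : Fin n) : Module.End K (Lat n →₀ K) :=
  ws (fun _ => 1) (0, Pi.single a 2)

/-- The lattice form of `e_0 ⊗ k_0`. -/
def bLat (q : K) (a : Fin n) : Module.End K (Lat n →₀ K) :=
  ws (fun μ => -q ^ (2 * μ.2 a + 1)) (Pi.single a 2, 0)

/-- The lattice form of the operator `C`. -/
def cLat (q : K) (a : Fin n) : Module.End K (Lat n →₀ K) :=
  ws (fun μ => q ^ μ.2 a) (Pi.single a 1, Pi.single a 1)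

/-- The operator `1 ⊗ e_0` with parameter `1`. -/
def opA (n : ℕ) (q : K) : Module.End K (Fock2 K n) :=
  TensorProduct.map LinearMap.id (opE n q 1 0)

/-- The operator `e_0 ⊗ k_0` with parameter `1`. -/
def opB (n : ℕ) (q : K) : Module.End K (Fock2 K n) :=
  TensorProduct.map (opE n q 1 0) (opK n q 0)

/-- The operator `|m⟩ ⊗ |p⟩ ↦ q^{p_a} |m + e_a⟩ ⊗ |p + e_a⟩`. -/
def opC (q : K) (a : Fin n) : Module.End K (Fock2 K n) :=
  TensorProduct.map (raise a fun _ => 1) (raise a fun p => q ^ p a)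

lemma isLift_opA (q : K) (a : Fin n) (ha : (a : ℕ) = 0) : IsLift (opA n q) (aLat K a) := by
  simpa [opA, aLat] using isLift_map isShift_id (isShift_opE_zero q 1 a ha)

lemma isLift_opB (q : K) (a : Fin n) (ha : (a : ℕ) = 0) : IsLift (opB n q) (bLat q a) := by
  simpa [opB, bLat] using isLift_map (isShift_opE_zero q 1 a ha) (isShift_opK_zero q a ha)

lemma isLift_opC (q : K) (a : Fin n) : IsLift (opC q a) (cLat q a) := by
  simpa [opC, cLat] using isLift_map (isShift_raise a (fun _ => 1) fun _ => rfl)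
    (isShift_raise a (fun μ => q ^ μ a) fun p => by simp)

lemma deltaE_zero (q x y : K) : deltaE n q x y 0 = y • opA n q + x • opB n q := by
  have h : ∀ x : K, opE n q x 0 = x • opE n q 1 0 := fun x => ext_ket fun m => by
    simp [opE, ket]
  rw [deltaE, opA, opB, h x, h y, TensorProduct.map_smul_right, TensorProduct.map_smul_left]

lemma ws_add_eq_zero {c c' : Lat n → K} {δ δ' : Lat n} (hδ : δ = δ') (hc : ∀ μ, c μ + c' μ = 0) :
    ws c δ + ws c' δ' = 0 := by
  rw [hδ, ws_add]; exact ws_eq_zero hc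

lemma add_eight_eq_zero {G : Type*} [AddCommGroup G] {u₁ u₂ d₁ d₂ v₁ v₂ w₁ w₂ : G} (h1 : u₁ = 0)
    (h2 : u₂ + v₁ = 0) (h3 : v₂ = 0) (h4 : d₁ + w₂ = 0) (h5 : d₂ = 0) (h6 : w₁ = 0) :
    u₁ + u₂ + (d₁ + d₂) + (v₁ + v₂ + (w₁ + w₂)) = 0 := by
  have : u₁ + u₂ + (d₁ + d₂) + (v₁ + v₂ + (w₁ + w₂)) =
      u₁ + (u₂ + v₁) + v₂ + (d₁ + w₂) + d₂ + w₁ := by abel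
  rw [this, h1, h2, h3, h4, h5, h6]
  simp

lemma add_four_eq_zero {G : Type*} [AddCommGroup G] {u₁ u₂ d₁ d₂ : G} (h1 : u₁ = 0)
    (h2 : u₂ + d₁ = 0) (h3 : d₂ = 0) : u₁ + u₂ + (d₁ + d₂) = 0 := by
  have : u₁ + u₂ + (d₁ + d₂) = u₁ + (u₂ + d₁) + d₂ := by abel
  simp [this, h1, h2, h3]

/-! ### Commutation of `J` with the parts of `e_0` and with the `f_r` -/

section Relations

variable {q : K} (hq0 : q ≠ 0) (hq : ∀ k : ℕ, 1 ≤ k → q ^ k ≠ 1)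
include hq0 hq

/-- Node 0 acts at the first site. At a later site adding two quanta to the second factor changes
the tail by 2, which gives the factor `q^{-2}` and nothing else. At the first site `jDown` behaves
in the same way, and `jUp` leaves the remainder `C`. -/
lemma opJ_opA (a : Fin n) (ha : (a : ℕ) = 0) :
    opJ n q * opA n q = (q ^ (-2 : ℤ)) • (opA n q * opJ n q) + (qi q 2) • opC q a := by
  refine (isLift_opJ q).mul_eq (isLift_opA q a ha) ((isLift_opC q a).smul _) ?_
  have h0 := q_sub_inv_ne hq0 hq
  have h1 := q_sq_sub_one_ne hq0 hq
  rw [qComm_sum_left, Finset.sum_eq_single a]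
  · rw [qComm_add_left, jUpLat, jDownLat, aLat, qComm_ws,
      qComm_ws_eq_zero (c := fun μ => q ^ (tail a μ.1 + μ.1 a - 1) * _ * _), add_zero, cLat,
      ws_smul]
    · refine ws_congr (by ext i <;> simp [Pi.single_apply] <;> split_ifs <;> simp) fun μ => ?_
      simp only [Prod.fst_add, Prod.snd_add, add_zero, zero_add, Pi.add_apply, Pi.sub_apply,
        Pi.neg_apply, Pi.zero_apply, tail_add, tail_sub, tail_single,
        Pi.single_eq_same, Pi.smul_apply, smul_eq_mul, tail_eq_zero ha]
      simp only [qi, zpow_add₀ hq0, zpow_neg, zpow_ofNat, mul_add, two_mul, zpow_one, zpow_zero,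
        neg_add, neg_sub, mul_neg, neg_neg, mul_zero, zpow_sub₀ hq0, mul_sub]
      field_simp
      try ring_nf
    · intro μ
      simp only [Prod.fst_add, Prod.snd_add, add_zero, zero_add, Pi.add_apply, Pi.sub_apply,
        Pi.neg_apply, Pi.zero_apply, tail_add, tail_sub, tail_single,
        Pi.single_eq_same, Pi.smul_apply, smul_eq_mul, tail_eq_zero ha]
      simp only [qi, zpow_add₀ hq0, zpow_neg, zpow_ofNat, mul_add, two_mul, zpow_one, zpow_zero,
        neg_add, neg_sub, mul_neg, neg_neg, mul_zero, zpow_sub₀ hq0, mul_sub]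
      field_simp
      try ring_nf
  · intro b _ hb
    have hab : a < b := by
      rw [Fin.lt_def, ha, Nat.pos_iff_ne_zero]; exact fun h => hb (Fin.ext (h.trans ha.symm))
    rw [qComm_add_left, jUpLat, jDownLat, aLat, qComm_ws_eq_zero, qComm_ws_eq_zero, add_zero]
    all_goals
      intro μ
      simp only [Prod.fst_add, Prod.snd_add, add_zero, zero_add, Pi.add_apply, Pi.sub_apply,
        Pi.neg_apply, Pi.zero_apply, tail_add, tail_sub, tail_single,
        Pi.single_eq_same, Pi.smul_apply, smul_eq_mul, hab, if_true, Pi.single_eq_of_ne hb, Pi.single_eq_of_ne hb.symm]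
      simp only [qi, zpow_add₀ hq0, zpow_neg, zpow_ofNat, mul_add, two_mul, zpow_one, zpow_zero,
        neg_add, neg_sub, mul_neg, neg_neg, mul_zero, zpow_sub₀ hq0, mul_sub]
      field_simp
      try ring_nf
  · simp

/-- The mirror image of `opJ_opA`: the tail of the first factor changes instead, and the remainder
comes from `jDown`. -/
lemma opJ_opB (a : Fin n) (ha : (a : ℕ) = 0) :
    opJ n q * opB n q =
      (q ^ (2 : ℤ)) • (opB n q * opJ n q) + (-q ^ (2 : ℤ) * qi q 2) • opC q a := by
  refine (isLift_opJ q).mul_eq (isLift_opB q a ha) ((isLift_opC q a).smul _) ?_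
  have h0 := q_sub_inv_ne hq0 hq
  have h1 := q_sq_sub_one_ne hq0 hq
  rw [qComm_sum_left, Finset.sum_eq_single a]
  · rw [qComm_add_left, jUpLat, jDownLat, bLat,
      qComm_ws_eq_zero (c := fun μ => q ^ tail a μ.1 * _), qComm_ws, zero_add, cLat,
      ws_smul]
    · refine ws_congr (by ext i <;> simp [Pi.single_apply] <;> split_ifs <;> simp) fun μ => ?_
      simp only [Prod.fst_add, Prod.snd_add, add_zero, zero_add, Pi.add_apply, Pi.sub_apply,
        Pi.neg_apply, Pi.zero_apply, tail_add, tail_sub, tail_single,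
        Pi.single_eq_same, Pi.smul_apply, smul_eq_mul, tail_eq_zero ha]
      simp only [qi, zpow_add₀ hq0, zpow_neg, zpow_ofNat, mul_add, two_mul, zpow_one, zpow_zero,
        neg_add, neg_sub, mul_neg, neg_neg, mul_zero, zpow_sub₀ hq0, mul_sub]
      field_simp
      try ring_nf
    · intro μ
      simp only [Prod.fst_add, Prod.snd_add, add_zero, zero_add, Pi.add_apply, Pi.sub_apply,
        Pi.neg_apply, Pi.zero_apply, tail_add, tail_sub, tail_single,
        Pi.single_eq_same, Pi.smul_apply, smul_eq_mul, tail_eq_zero ha]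
      simp only [qi, zpow_add₀ hq0, zpow_neg, zpow_ofNat, mul_add, two_mul, zpow_one, zpow_zero,
        neg_add, neg_sub, mul_neg, neg_neg, mul_zero, zpow_sub₀ hq0, mul_sub]
      field_simp
      try ring_nf
  · intro b _ hb
    have hab : a < b := by
      rw [Fin.lt_def, ha, Nat.pos_iff_ne_zero]; exact fun h => hb (Fin.ext (h.trans ha.symm))
    rw [qComm_add_left, jUpLat, jDownLat, bLat, qComm_ws_eq_zero, qComm_ws_eq_zero, add_zero]
    all_goals
      intro μ
      simp only [Prod.fst_add, Prod.snd_add, add_zero, zero_add, Pi.add_apply, Pi.sub_apply,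
        Pi.neg_apply, Pi.zero_apply, tail_add, tail_sub, tail_single,
        Pi.single_eq_same, Pi.smul_apply, smul_eq_mul, hab, if_true, Pi.single_eq_of_ne hb, Pi.single_eq_of_ne hb.symm]
      simp only [qi, zpow_add₀ hq0, zpow_neg, zpow_ofNat, mul_add, two_mul, zpow_one, zpow_zero,
        neg_add, neg_sub, mul_neg, neg_neg, mul_zero, zpow_sub₀ hq0, mul_sub]
      field_simp
      try ring_nf
  · simp

/-- This closes the system `A`, `B`, `C`. At later sites the tails of both factors grow by one and
compensate; at the first site `jUp` turns `C` into `B` and `jDown` turns it into `A`. -/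
lemma opJ_opC (a : Fin n) (ha : (a : ℕ) = 0) :
    opJ n q * opC q a = (1 : K) • (opC q a * opJ n q) + (q⁻¹ • opA n q + (-q⁻¹) • opB n q) := by
  refine (isLift_opJ q).mul_eq (isLift_opC q a)
    (((isLift_opA q a ha).smul _).add ((isLift_opB q a ha).smul _)) ?_
  have h0 := q_sub_inv_ne hq0 hq
  have h1 := q_sq_sub_one_ne hq0 hq
  rw [qComm_sum_left, Finset.sum_eq_single a]
  · rw [qComm_add_left, jUpLat, jDownLat, cLat, qComm_ws, qComm_ws, aLat, bLat, ws_smul, ws_smul,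
      add_comm]
    congr 1
    all_goals
      refine ws_congr (by ext i <;> simp [Pi.single_apply] <;> split_ifs <;> simp) fun μ => ?_
      simp only [Prod.fst_add, Prod.snd_add, add_zero, zero_add, Pi.add_apply, Pi.sub_apply,
        Pi.neg_apply, Pi.zero_apply, tail_add, tail_sub, tail_single,
        Pi.single_eq_same, Pi.smul_apply, smul_eq_mul, tail_eq_zero ha]
      simp only [qi, zpow_add₀ hq0, zpow_neg, zpow_ofNat, mul_add, two_mul, zpow_one, zpow_zero,
        neg_add, neg_sub, mul_neg, neg_neg, mul_zero, zpow_sub₀ hq0, mul_sub]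
      field_simp
      try ring_nf
  · intro b _ hb
    have hab : a < b := by
      rw [Fin.lt_def, ha, Nat.pos_iff_ne_zero]; exact fun h => hb (Fin.ext (h.trans ha.symm))
    rw [qComm_add_left, jUpLat, jDownLat, cLat, qComm_ws_eq_zero, qComm_ws_eq_zero, add_zero]
    all_goals
      intro μ
      simp only [Prod.fst_add, Prod.snd_add, add_zero, zero_add, Pi.add_apply, Pi.sub_apply,
        Pi.neg_apply, Pi.zero_apply, tail_add, tail_sub, tail_single,
        Pi.single_eq_same, Pi.smul_apply, smul_eq_mul, hab, if_true, Pi.single_eq_of_ne hb, Pi.single_eq_of_ne hb.symm]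
      simp only [qi, zpow_add₀ hq0, zpow_neg, zpow_ofNat, mul_add, two_mul, zpow_one, zpow_zero,
        neg_add, neg_sub, mul_neg, neg_neg, mul_zero, zpow_sub₀ hq0, mul_sub]
      field_simp
      try ring_nf
  · simp

/-- Only the sites `a` and `b` contribute. Of the eight commutators, `jUp a` with `k^{-1} ⊗ f`
cancels against `jUp b` with `f ⊗ 1`, `jDown a` with `f ⊗ 1` cancels against `jDown b` with `k^{-1}
⊗ f`, and the other four vanish. -/
lemma opJ_deltaF_mid (a b : Fin n) (hab : (b : ℕ) = a + 1) :
    opJ n q * deltaF n q 1 1 ((a : ℕ) + 1) = deltaF n q 1 1 ((a : ℕ) + 1) * opJ n q := by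
  have hF := (isLift_map (isShift_opF_mid q 1 a b hab) isShift_id).add
    (isLift_map (isShift_opKinv_mid q a b hab) (isShift_opF_mid q 1 a b hab))
  refine (isLift_opJ q).commute hF ?_
  have h0 := q_sub_inv_ne hq0 hq
  have h1 := q_sq_sub_one_ne hq0 hq
  have hlt : a < b := by rw [Fin.lt_def]; omega
  have hgt : ¬ b < a := not_lt.mpr hlt.le
  have hne : a ≠ b := hlt.ne
  rw [qComm_sum_left, Finset.sum_eq_add a b hne]
  · rw [qComm_add_left, qComm_add_left, qComm_add_right, qComm_add_right, qComm_add_right,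
      qComm_add_right]
    simp only [jUpLat, jDownLat]
    refine add_eight_eq_zero (G := Module.End K (Lat n →₀ K)) ?_ ?_ ?_ ?_ ?_ ?_
    on_goal 6 => refine qComm_ws_eq_zero ?_
    on_goal 5 => refine qComm_ws_eq_zero ?_
    on_goal 3 => refine qComm_ws_eq_zero ?_
    on_goal 1 => refine qComm_ws_eq_zero ?_
    on_goal 2 => rw [qComm_ws, qComm_ws]; refine ws_add_eq_zero (by ext i <;> simp [Pi.single_apply] <;> split_ifs <;> simp) ?_
    on_goal 4 => rw [qComm_ws, qComm_ws]; refine ws_add_eq_zero (by ext i <;> simp [Pi.single_apply] <;> split_ifs <;> simp) ?_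
    all_goals
      intro μ
      simp only [Prod.fst_add, Prod.snd_add, add_zero, zero_add, Pi.add_apply, Pi.sub_apply,
        Pi.neg_apply, Pi.zero_apply, tail_add, tail_sub, tail_single,
        Pi.single_eq_same, Pi.smul_apply, smul_eq_mul, tail_succ hab μ.1, tail_succ hab μ.2, hlt, hgt,
        lt_irrefl, if_true, if_false, Pi.single_eq_of_ne hne, Pi.single_eq_of_ne hne.symm]
      simp only [qi, zpow_add₀ hq0, zpow_neg, zpow_ofNat, mul_add, two_mul, zpow_one, zpow_zero,
        neg_add, neg_sub, mul_neg, neg_neg, mul_zero, zpow_sub₀ hq0, mul_sub]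
      field_simp
      try ring_nf
  · rintro c - ⟨hca, hcb⟩
    -- A third site sees both of `a`, `b` in its tail or neither, so moving a quantum between them
    -- leaves the tail unchanged.
    have hc : a < c ↔ b < c := by
      rw [Fin.lt_def, Fin.lt_def]
      have : (c : ℕ) ≠ b := fun h => hcb (Fin.ext h)
      omega
    simp only [qComm_add_left, qComm_add_right, jUpLat, jDownLat]
    rw [qComm_ws_eq_zero, qComm_ws_eq_zero, qComm_ws_eq_zero, qComm_ws_eq_zero]
    · simp
    all_goals
      intro μ
      simp only [Prod.fst_add, Prod.snd_add, add_zero, zero_add, Pi.add_apply, Pi.sub_apply,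
        Pi.neg_apply, Pi.zero_apply, tail_add, tail_sub, tail_single,
        Pi.single_eq_same, Pi.smul_apply, smul_eq_mul, hc, Pi.single_eq_of_ne hca, Pi.single_eq_of_ne hcb, Pi.single_eq_of_ne hca.symm, Pi.single_eq_of_ne hcb.symm]
      by_cases hbc : b < c
      all_goals
        simp only [hbc, if_true, if_false, sub_self, add_zero, sub_zero, neg_zero]
        ring
  · simp
  · simp

/-- The last site lies in no tail. There `jUp` against `k^{-1} ⊗ f` cancels `jDown` against `f ⊗ 1`;
the other two commutators vanish. -/
lemma opJ_deltaF_last (a : Fin n) (ha : (a : ℕ) + 1 = n) :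
    opJ n q * deltaF n q 1 1 n = deltaF n q 1 1 n * opJ n q := by
  have hF := (isLift_map (isShift_opF_last q 1 a ha) isShift_id).add
    (isLift_map (isShift_opKinv_last q a ha) (isShift_opF_last q 1 a ha))
  refine (isLift_opJ q).commute hF ?_
  have h0 := q_sub_inv_ne hq0 hq
  have h1 := q_sq_sub_one_ne hq0 hq
  rw [qComm_sum_left, Finset.sum_eq_single a]
  · rw [qComm_add_left, qComm_add_right, qComm_add_right]
    simp only [jUpLat, jDownLat]
    refine add_four_eq_zero (G := Module.End K (Lat n →₀ K)) ?_ ?_ ?_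
    on_goal 3 => refine qComm_ws_eq_zero ?_
    on_goal 1 => refine qComm_ws_eq_zero ?_
    on_goal 2 => rw [qComm_ws, qComm_ws]; refine ws_add_eq_zero (by ext i <;> simp [Pi.single_apply] <;> split_ifs <;> simp) ?_
    all_goals
      intro μ
      simp only [Prod.fst_add, Prod.snd_add, add_zero, zero_add, Pi.add_apply, Pi.sub_apply,
        Pi.neg_apply, Pi.zero_apply, tail_add, tail_sub, tail_single,
        Pi.single_eq_same, Pi.smul_apply, smul_eq_mul, lt_irrefl, if_false]
      simp only [qi, zpow_add₀ hq0, zpow_neg, zpow_ofNat, mul_add, two_mul, zpow_one, zpow_zero,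
        neg_add, neg_sub, mul_neg, neg_neg, mul_zero, zpow_sub₀ hq0, mul_sub]
      field_simp
      try ring_nf
  · rintro c - hca
    have hc : ¬ a < c := by
      rw [Fin.lt_def]; omega
    simp only [qComm_add_left, qComm_add_right, jUpLat, jDownLat]
    rw [qComm_ws_eq_zero, qComm_ws_eq_zero, qComm_ws_eq_zero, qComm_ws_eq_zero]
    · simp
    all_goals
      intro μ
      simp only [Prod.fst_add, Prod.snd_add, add_zero, zero_add, Pi.add_apply, Pi.sub_apply,
        Pi.neg_apply, Pi.zero_apply, tail_add, tail_sub, tail_single,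
        Pi.single_eq_same, Pi.smul_apply, smul_eq_mul, hc, if_false, Pi.single_eq_of_ne hca, Pi.single_eq_of_ne hca.symm]
      try ring_nf
  · simp

end Relations

end JOp

/-! ### Weights, parities and degrees -/

section Gradings

variable {K : Type*} [Field K] {n : ℕ}

lemma qComm_ws_diag {t : K} {c c' : Lat n → K} {δ : Lat n} (h : ∀ μ, c μ = t * c (μ + δ)) :
    qComm t (ws c' δ) (ws c 0) = 0 :=
  qComm_ws_eq_zero fun μ => by rw [add_zero, h]; ring

lemma qComm_diag_ws {t : K} {c c' : Lat n → K} {δ : Lat n} (h : ∀ μ, c (μ + δ) = t * c μ) :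
    qComm t (ws c 0) (ws c' δ) = 0 :=
  qComm_ws_eq_zero fun μ => by rw [add_zero, h]; ring

/-- The second property says that `k_r ⊗ k_r` does not notice a quantum passing from one factor to
the other at the same site, which is all that `J` does. -/
lemma isShift_opK (q : K) {r : ℕ} (hr : r ≤ n) (hn : 1 ≤ n) : ∃ c : (Fin n → ℤ) → K,
    IsShift (opK n q r) c 0 ∧ (q ≠ 0 → ∀ (a : Fin n) μ ν,
      c (μ + Pi.single a 1) * c (ν - Pi.single a 1) = c μ * c ν) := by
  rcases Nat.eq_zero_or_pos r with rfl | h1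
  · refine ⟨_, isShift_opK_zero q ⟨0, hn⟩ rfl, fun hq0 a μ ν => ?_⟩
    rw [neg_mul_neg, neg_mul_neg, ← zpow_add₀ hq0, ← zpow_add₀ hq0]
    congr 1
    simp only [Pi.add_apply, Pi.sub_apply]
    ring
  rcases node_cases h1 hr with ⟨a, b, hab, rfl⟩ | ⟨a, ha, rfl⟩
  · refine ⟨_, isShift_opK_mid q a b hab, fun hq0 a μ ν => ?_⟩
    rw [← zpow_add₀ hq0, ← zpow_add₀ hq0]
    congr 1
    simp only [Pi.add_apply, Pi.sub_apply]
    ring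
  · refine ⟨_, isShift_opK_last q a ha, fun hq0 a μ ν => ?_⟩
    rw [neg_mul_neg, neg_mul_neg, ← zpow_add₀ hq0, ← zpow_add₀ hq0]
    congr 1
    simp only [Pi.add_apply, Pi.sub_apply]
    ring

lemma opJ_deltaK {q : K} (hq0 : q ≠ 0) {r : ℕ} (hr : r ≤ n) :
    opJ n q * deltaK n q r = deltaK n q r * opJ n q := by
  rcases Nat.eq_zero_or_pos n with rfl | hn
  · simp [opJ]
  obtain ⟨c, hc, h⟩ := isShift_opK q hr hn
  refine (isLift_opJ q).commute (isLift_map hc hc) ?_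
  rw [qComm_sum_left]
  refine Finset.sum_eq_zero fun a _ => ?_
  rw [qComm_add_left, jUpLat, jDownLat, ← Prod.zero_eq_mk, qComm_ws_diag, qComm_ws_diag, add_zero]
  · intro μ
    have := h hq0 a μ.2 μ.1
    simp only [Prod.fst_add, Prod.snd_add, one_mul, ← sub_eq_add_neg]
    rw [mul_comm, ← this, mul_comm]
  · intro μ
    have := h hq0 a μ.1 μ.2
    simp only [Prod.fst_add, Prod.snd_add, one_mul, ← sub_eq_add_neg]
    rw [← this]

lemma isAdj_deltaK (q : K) (r : ℕ) : IsAdj (form2 n q) (deltaK n q r) (deltaK n q r) :=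
  isAdj_map (isAdj_diag _ (opK_ket q r)) (isAdj_diag _ (opK_ket q r))

/-- The parity operator `|m⟩ ↦ (-1)^{|m|} |m⟩`. -/
def sgn (K : Type*) [Field K] (n : ℕ) : Module.End K (Fock K n) :=
  Finsupp.linearCombination K fun m : Occ n => (-1 : K) ^ (∑ a, m a) • ket K m

lemma sgn_ket (m : Occ n) : sgn K n (ket K m) = (-1 : K) ^ (∑ a, m a) • ket K m := by
  simp [sgn, ket]

/-- The parity operator of the first factor. -/
def sgn1 (K : Type*) [Field K] (n : ℕ) : Module.End K (Fock2 K n) :=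
  TensorProduct.map (sgn K n) LinearMap.id

/-- The parity operator of the second factor. -/
def sgn2 (K : Type*) [Field K] (n : ℕ) : Module.End K (Fock2 K n) :=
  TensorProduct.map LinearMap.id (sgn K n)

lemma isShift_sgn : IsShift (sgn K n) (fun μ => (-1 : K) ^ (∑ a, μ a)) 0 :=
  isShift_of_diag sgn_ket fun m => by
    simp only [up_apply]
    rw [← Nat.cast_sum, zpow_natCast]

lemma isLift_sgn1 : IsLift (sgn1 K n) (ws (fun μ => (-1 : K) ^ (∑ a, μ.1 a)) 0) := by
  have h := isLift_map (isShift_sgn (K := K) (n := n)) isShift_id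
  simp only [mul_one] at h
  exact h

lemma isLift_sgn2 : IsLift (sgn2 K n) (ws (fun μ => (-1 : K) ^ (∑ a, μ.2 a)) 0) := by
  have h := isLift_map isShift_id (isShift_sgn (K := K) (n := n))
  simp only [one_mul] at h
  exact h

lemma isAdj_sgn1 (q : K) : IsAdj (form2 n q) (sgn1 K n) (sgn1 K n) :=
  isAdj_map (isAdj_diag _ sgn_ket) IsAdj.id

lemma isAdj_sgn2 (q : K) : IsAdj (form2 n q) (sgn2 K n) (sgn2 K n) :=
  isAdj_map IsAdj.id (isAdj_diag _ sgn_ket)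

lemma neg_one_zpow_sum_add (μ δ : Fin n → ℤ) : (-1 : K) ^ (∑ a, (μ + δ) a) =
    (-1 : K) ^ (∑ a, δ a) * (-1 : K) ^ (∑ a, μ a) := by
  simp only [Pi.add_apply, Finset.sum_add_distrib]
  rw [zpow_add₀ (by simp), mul_comm]

lemma sgn1Lat_ws (c : Lat n → K) (δ : Lat n) (t : K) (ht : (-1 : K) ^ (∑ a, δ.1 a) = t) :
    qComm t (ws (fun μ => (-1 : K) ^ (∑ a, μ.1 a)) 0) (ws c δ) = 0 :=
  qComm_diag_ws fun μ => by rw [Prod.fst_add, neg_one_zpow_sum_add, ht]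

lemma sgn2Lat_ws (c : Lat n → K) (δ : Lat n) (t : K) (ht : (-1 : K) ^ (∑ a, δ.2 a) = t) :
    qComm t (ws (fun μ => (-1 : K) ^ (∑ a, μ.2 a)) 0) (ws c δ) = 0 :=
  qComm_diag_ws fun μ => by rw [Prod.snd_add, neg_one_zpow_sum_add, ht]

/-- The signs by which the two parity operators commute with an operator. -/
def HasSigns (s t : K) (X : Module.End K (Fock2 K n)) : Prop :=
  sgn1 K n * X = s • (X * sgn1 K n) ∧ sgn2 K n * X = t • (X * sgn2 K n)

namespace HasSigns

variable {s t : K} {X Y : Module.End K (Fock2 K n)}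

lemma add (h : HasSigns s t X) (h' : HasSigns s t Y) : HasSigns s t (X + Y) :=
  ⟨by rw [mul_add, h.1, h'.1, add_mul, smul_add], by rw [mul_add, h.2, h'.2, add_mul, smul_add]⟩

lemma sum {ι : Type*} (S : Finset ι) {X : ι → Module.End K (Fock2 K n)}
    (h : ∀ i, HasSigns s t (X i)) : HasSigns s t (∑ i ∈ S, X i) :=
  ⟨by rw [Finset.mul_sum, Finset.sum_mul, Finset.smul_sum]; exact
      Finset.sum_congr rfl fun i _ => (h i).1,
    by rw [Finset.mul_sum, Finset.sum_mul, Finset.smul_sum]; exact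
      Finset.sum_congr rfl fun i _ => (h i).2⟩

lemma of_lift {c : Lat n → K} {δ : Lat n} (h : IsLift X (ws c δ))
    (hs : (-1 : K) ^ (∑ a, δ.1 a) = s) (ht : (-1 : K) ^ (∑ a, δ.2 a) = t) : HasSigns s t X :=
  ⟨by simpa using isLift_sgn1.mul_eq h IsLift.zero (sgn1Lat_ws c δ s hs),
    by simpa using isLift_sgn2.mul_eq h IsLift.zero (sgn2Lat_ws c δ t ht)⟩

end HasSigns

lemma hasSigns_opJ (q : K) : HasSigns (-1) (-1) (opJ n q) :=
  HasSigns.sum _ fun a =>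
    (HasSigns.of_lift (isLift_jUp q a) (by simp) (by simp)).add
      (HasSigns.of_lift (isLift_jDown q a) (by simp) (by simp))

lemma hasSigns_opA (q : K) (hn : 1 ≤ n) : HasSigns 1 1 (opA n q) :=
  HasSigns.of_lift (isLift_opA q ⟨0, hn⟩ rfl) (by simp) (by simp)

lemma hasSigns_opB (q : K) (hn : 1 ≤ n) : HasSigns 1 1 (opB n q) :=
  HasSigns.of_lift (isLift_opB q ⟨0, hn⟩ rfl) (by simp) (by simp)

lemma hasSigns_opC (q : K) (a : Fin n) : HasSigns (-1) (-1) (opC q a) :=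
  HasSigns.of_lift (isLift_opC q a) (by simp) (by simp)

lemma hasSigns_deltaF (q : K) {r : ℕ} (h1 : 1 ≤ r) (h2 : r ≤ n) :
    HasSigns 1 1 (deltaF n q 1 1 r) := by
  rcases node_cases h1 h2 with ⟨a, b, hab, rfl⟩ | ⟨a, ha, rfl⟩
  · exact (HasSigns.of_lift (isLift_map (isShift_opF_mid q 1 a b hab) isShift_id)
      (by simp) (by simp)).add (HasSigns.of_lift (isLift_map (isShift_opKinv_mid q a b hab)
        (isShift_opF_mid q 1 a b hab)) (by simp) (by simp))
  · exact (HasSigns.of_lift (isLift_map (isShift_opF_last q 1 a ha) isShift_id)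
      (by simp) (by simp)).add (HasSigns.of_lift (isLift_map (isShift_opKinv_last q a ha)
        (isShift_opF_last q 1 a ha)) (by simp) (by simp))

lemma hasSigns_deltaK (q : K) {r : ℕ} (hn : 1 ≤ n) (hr : r ≤ n) :
    HasSigns 1 1 (deltaK n q r) := by
  obtain ⟨c, hc, -⟩ := isShift_opK q hr hn
  exact HasSigns.of_lift (isLift_map hc hc) (by simp) (by simp)

/-! ### `J` and the parity operators against all the generators of index at least 1 -/

section Generic

variable {q : K} (hq0 : q ≠ 0) (hq : ∀ k : ℕ, 1 ≤ k → q ^ k ≠ 1)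
include hq0 hq

lemma opJ_deltaF {r : ℕ} (h1 : 1 ≤ r) (h2 : r ≤ n) :
    opJ n q * deltaF n q 1 1 r = deltaF n q 1 1 r * opJ n q := by
  rcases node_cases h1 h2 with ⟨a, b, hab, rfl⟩ | ⟨a, ha, rfl⟩
  · exact opJ_deltaF_mid hq0 hq a b hab
  · exact opJ_deltaF_last hq0 hq a ha

variable [CharZero K]

/-- A self-adjoint operator that commutes with `k_r` and `f_r` commutes with `e_r`. -/
lemma comm_deltaE_of_comm {X : Module.End K (Fock2 K n)} (hX : IsAdj (form2 n q) X X) {r : ℕ}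
    (h1 : 1 ≤ r) (h2 : r ≤ n) (hK : X * deltaK n q r = deltaK n q r * X)
    (hF : X * deltaF n q 1 1 r = deltaF n q 1 1 r * X) :
    X * deltaE n q 1 1 r = deltaE n q 1 1 r * X := by
  obtain ⟨c, hc, h⟩ := isAdj_deltaE (n := n) hq0 hq h1 h2
  have h3 := h.symm (form2_symm q)
  have h4 := h3.mul hX
  have h5 := hX.mul h3
  have h6 : (c • (deltaK n q r * deltaF n q 1 1 r)) * X =
      X * (c • (deltaK n q r * deltaF n q 1 1 r)) := by
    rw [smul_mul_assoc, mul_smul_comm, mul_assoc, ← hF, ← mul_assoc, ← mul_assoc, hK]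
  rw [h6] at h4
  exact h4.unique hq0 hq h5

lemma opJ_deltaE {r : ℕ} (h1 : 1 ≤ r) (h2 : r ≤ n) :
    opJ n q * deltaE n q 1 1 r = deltaE n q 1 1 r * opJ n q :=
  comm_deltaE_of_comm hq0 hq (isAdj_opJ hq0) h1 h2 (opJ_deltaK hq0 h2) (opJ_deltaF hq0 hq h1 h2)

/-- The parity operators are self-adjoint, so the statement for `k_r` and `f_r` passes to `e_r`
through the form. -/
lemma hasSigns_deltaE {r : ℕ} (h1 : 1 ≤ r) (h2 : r ≤ n) : HasSigns 1 1 (deltaE n q 1 1 r) := by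
  have hK := hasSigns_deltaK q (h1.trans h2) h2
  have hF := hasSigns_deltaF (n := n) q h1 h2
  simp only [HasSigns, one_smul] at hK hF ⊢
  exact ⟨comm_deltaE_of_comm hq0 hq (isAdj_sgn1 q) h1 h2 hK.1 hF.1,
    comm_deltaE_of_comm hq0 hq (isAdj_sgn2 q) h1 h2 hK.2 hF.2⟩

end Generic

/-! ### The degree that the `f_r` raise -/

/-- The operator on `V ⊗ V` that is diagonal in the kets, with the eigenvalues `c`. -/
def diag2 (c : Lat n → K) : Module.End K (Fock2 K n) :=
  TensorProduct.lift (Finsupp.linearCombination K fun m : Occ n =>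
    Finsupp.linearCombination K fun p : Occ n => c (up m, up p) • kk K m p)

lemma diag2_kk (c : Lat n → K) (m p : Occ n) :
    diag2 c (kk K m p) = c (up m, up p) • kk K m p := by
  rw [diag2, kk, TensorProduct.lift.tmul]
  simp [ket, kk]

lemma isLift_diag2 (c : Lat n → K) : IsLift (diag2 c) (ws c 0) := by
  have : iota K n ∘ₗ diag2 c = ws c 0 ∘ₗ iota K n := by
    refine ext_kk fun m p => ?_
    rw [LinearMap.comp_apply, LinearMap.comp_apply, iota_kk, ws_single, diag2_kk, map_smul, iota_kk]
    simp
  exact fun t => LinearMap.congr_fun this t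

/-- A degree for which all the `f_r`, `1 ≤ r ≤ n`, are raising operators. -/
def latDeg (μ : Lat n) : ℤ := ∑ a : Fin n, ((n : ℤ) - a) * (μ.1 a + μ.2 a)

lemma latDeg_add (μ ν : Lat n) : latDeg (μ + ν) = latDeg μ + latDeg ν := by
  simp only [latDeg, ← Finset.sum_add_distrib]
  refine Finset.sum_congr rfl fun a _ => ?_
  simp only [Prod.fst_add, Prod.snd_add, Pi.add_apply]
  ring

lemma latDeg_neg (μ : Lat n) : latDeg (-μ) = -latDeg μ := by
  simp only [latDeg, ← Finset.sum_neg_distrib]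
  refine Finset.sum_congr rfl fun a _ => ?_
  simp only [Prod.fst_neg, Prod.snd_neg, Pi.neg_apply]
  ring

lemma latDeg_single (a : Fin n) (k : ℤ) :
    latDeg (Pi.single a k, 0) = (n - a) * k ∧ latDeg (0, Pi.single a k) = (n - a) * k := by
  constructor
  all_goals
    rw [latDeg, Finset.sum_eq_single a]
    · simp
    · intro b _ hb; simp [hb]
    · simp

lemma latDeg_nonneg (m p : Occ n) : 0 ≤ latDeg (up m, up p) :=
  Finset.sum_nonneg fun a _ => mul_nonneg (by omega) (by simp only [up_apply]; omega)

/-- The projection on the part of degree `d`. -/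
def degProj (K : Type*) [Field K] (n : ℕ) (d : ℤ) : Module.End K (Fock2 K n) :=
  diag2 fun μ => if latDeg μ = d then 1 else 0

lemma degProj_ws (c : Lat n → K) (δ : Lat n) (d : ℤ) :
    ws (fun μ => if latDeg μ = d then 1 else 0) 0 * ws c δ =
      ws c δ * ws (fun μ => if latDeg μ = d - latDeg δ then 1 else 0) 0 := by
  rw [ws_mul, ws_mul]
  refine ws_congr (add_comm _ _) fun μ => ?_
  rw [latDeg_add, add_zero]
  by_cases h : latDeg μ = d - latDeg δ
  · rw [if_pos h, if_pos (by omega), mul_comm]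
  · rw [if_neg h, if_neg (by omega), mul_comm]

/-- Sites have weights `n, …, 1` from first to last. An inner `f_r` moves a quantum to the
neighbouring site of weight one more, and `f_n` adds two quanta of weight 1; the shifts are 1 and 2.
-/
lemma degProj_deltaF (q : K) {r : ℕ} (h1 : 1 ≤ r) (h2 : r ≤ n) :
    ∃ h : ℤ, 0 < h ∧ ∀ d, degProj K n d * deltaF n q 1 1 r =
      deltaF n q 1 1 r * degProj K n (d - h) := by
  rcases node_cases h1 h2 with ⟨a, b, hab, rfl⟩ | ⟨a, ha, rfl⟩
  · have hF := (isLift_map (isShift_opF_mid q 1 a b hab) isShift_id).add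
      (isLift_map (isShift_opKinv_mid q a b hab) (isShift_opF_mid q 1 a b hab))
    have e1 : latDeg (Pi.single a 1 - Pi.single b 1, (0 : Fin n → ℤ)) = 1 := by
      have : ((Pi.single a 1 - Pi.single b 1, 0) : Lat n) =
        (Pi.single a 1, 0) + -(Pi.single b 1, 0) := by simp [sub_eq_add_neg]
      rw [this, latDeg_add, latDeg_neg, (latDeg_single a 1).1, (latDeg_single b 1).1, hab]
      push_cast; ring
    have e2 : latDeg ((0 : Fin n → ℤ), Pi.single a 1 - Pi.single b 1) = 1 := by
      have : ((0, Pi.single a 1 - Pi.single b 1) : Lat n) =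
        (0, Pi.single a 1) + -(0, Pi.single b 1) := by simp [sub_eq_add_neg]
      rw [this, latDeg_add, latDeg_neg, (latDeg_single a 1).2, (latDeg_single b 1).2, hab]
      push_cast; ring
    refine ⟨1, one_pos, fun d => ((isLift_diag2 _).mul hF).eq ?_⟩
    rw [mul_add, degProj_ws, degProj_ws, e1, e2, ← add_mul]
    exact hF.mul (isLift_diag2 _)
  · have hF := (isLift_map (isShift_opF_last q 1 a ha) isShift_id).add
      (isLift_map (isShift_opKinv_last q a ha) (isShift_opF_last q 1 a ha))
    have e0 : ((n : ℤ) - a) * 2 = 2 := by omega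
    have e1 : latDeg (Pi.single a 2, (0 : Fin n → ℤ)) = 2 := by rw [(latDeg_single a 2).1, e0]
    have e2 : latDeg ((0 : Fin n → ℤ), Pi.single a 2) = 2 := by rw [(latDeg_single a 2).2, e0]
    refine ⟨2, two_pos, fun d => ((isLift_diag2 _).mul hF).eq ?_⟩
    rw [mul_add, degProj_ws, degProj_ws, e1, e2, ← add_mul]
    exact hF.mul (isLift_diag2 _)

end Gradings

/-! ### The singular vectors -/

section Singular

variable {K : Type*} [Field K] {n : ℕ}

/-- The additive group structure on `V ⊗ V` that extends the monoid structure of the tensor product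
definitionally. -/
@[reducible] def fock2AddCommGroup (K : Type*) [Field K] (n : ℕ) : AddCommGroup (Fock2 K n) :=
  Module.addCommMonoidToAddCommGroup K

/-- The coefficients of the singular vectors. -/
def singCoeff (q : K) (l k : ℕ) : K := q ^ ((k : ℤ) * (2 * l - k - 1) / 2) * qBinom q l k

/-- The integer division in the exponent is exact because `k (k + 1)` is even. -/
lemma two_mul_singExp (l k : ℤ) : 2 * (k * (2 * l - k - 1) / 2) = k * (2 * l - k - 1) := by
  apply Int.mul_ediv_cancel'
  have := (Int.even_mul_succ_self k).two_dvd
  have h : k * (2 * l - k - 1) = 2 * (k * l) - k * (k + 1) := by ring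
  rw [h]
  exact dvd_sub (dvd_mul_right _ _) this

lemma parityNum_neg_iff (ε : ℤˣ) (k : ℕ) : (k + 1) % 2 = parityNum (-ε) ↔ k % 2 = parityNum ε := by
  rcases Int.units_eq_one_or ε with rfl | rfl
  · rw [parityNum, parityNum, if_neg (by decide), if_pos rfl]; omega
  · rw [parityNum, parityNum, if_pos (by decide), if_neg (by decide)]; omega

lemma parityNum_lt (ε : ℤˣ) : parityNum ε < 2 := by
  unfold parityNum; split_ifs <;> omega

lemma unit_cast_eq (ε : ℤˣ) : ((ε : ℤ) : K) = (-1) ^ parityNum ε := by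
  rcases Int.units_eq_one_or ε with rfl | rfl
  · simp [parityNum]
  · rw [parityNum, if_neg (by decide)]; simp

lemma singVec_eq (q : K) {z : Fin n} (hz : (z : ℕ) + 1 = n) {ε : ℤˣ} {l : ℕ}
    (h : ¬(ε = -1 ∧ l = 0)) :
    singVec n q ε l = ∑ k ∈ Finset.range (l + 1),
      (if k % 2 = parityNum ε then singCoeff q l k else 0) •
        kk K (Pi.single z k) (Pi.single z (l - k)) := by
  have h1 := unitVec_eq z
  rw [hz] at h1
  rw [singVec, if_neg h, Finset.sum_filter]
  refine Finset.sum_congr rfl fun k _ => ?_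
  have h2 : ∀ j : ℕ, j • unitVec n n = Pi.single z j := fun j => by
    rw [h1, ← Pi.single_smul]; simp
  split_ifs
  · rw [h2, h2]; rfl
  · simp

lemma singVec_zero_neg (q : K) {y z : Fin n} (hz : (z : ℕ) + 1 = n) (hy : (y : ℕ) + 1 = z) :
    singVec n q (-1) 0 = kk K (Pi.single y 1) (Pi.single z 1) +
      (-q) • kk K (Pi.single z 1) (Pi.single y 1) := by
  have h1 := unitVec_eq z
  have h2 := unitVec_eq y
  rw [hz] at h1
  rw [hy, show (z : ℕ) = n - 1 by omega] at h2
  rw [singVec, if_pos ⟨rfl, rfl⟩, if_pos (by omega), h1, h2, sub_eq_add_neg]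
  congr 1
  exact (neg_smul q (kk K (Pi.single z 1) (Pi.single y 1))).symm

lemma singVec_zero_neg_of_one (q : K) (hn : n < 2) : singVec n q (-1) 0 = 0 := by
  rw [singVec, if_pos ⟨rfl, rfl⟩, if_neg (by omega)]

/-- A subspace contains a singular vector as soon as it contains its kets. -/
lemma singVec_mem (q : K) {z : Fin n} (hz : (z : ℕ) + 1 = n) (ε : ℤˣ) (l : ℕ)
    (S : Submodule K (Fock2 K n))
    (h1 : ¬(ε = -1 ∧ l = 0) → ∀ k ≤ l, k % 2 = parityNum ε →
      kk K (Pi.single z k) (Pi.single z (l - k)) ∈ S)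
    (h2 : ε = -1 → l = 0 → ∀ y : Fin n, (y : ℕ) + 1 = z →
      kk K (Pi.single y 1) (Pi.single z 1) ∈ S ∧ kk K (Pi.single z 1) (Pi.single y 1) ∈ S) :
    singVec n q ε l ∈ S := by
  by_cases h : ε = -1 ∧ l = 0
  · rcases lt_or_ge n 2 with hn | hn
    · rw [h.1, h.2, singVec_zero_neg_of_one q hn]; exact S.zero_mem
    · have hy : ((⟨n - 2, by omega⟩ : Fin n) : ℕ) + 1 = z := by simp only; omega
      obtain ⟨h3, h4⟩ := h2 h.1 h.2 _ hy
      rw [h.1, h.2, singVec_zero_neg q hz hy]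
      exact S.add_mem h3 (S.smul_mem _ h4)
  · rw [singVec_eq q hz h]
    refine S.sum_mem fun k hk => ?_
    split_ifs with hp
    · exact S.smul_mem _ (h1 h k (by have := Finset.mem_range.mp hk; omega) hp)
    · simp

lemma sgn1_kk (m p : Occ n) : sgn1 K n (kk K m p) = (-1 : K) ^ (∑ a, m a) • kk K m p := by
  rw [sgn1, kk, TensorProduct.map_tmul, sgn_ket, LinearMap.id_apply, TensorProduct.smul_tmul']

lemma sgn2_kk (m p : Occ n) : sgn2 K n (kk K m p) = (-1 : K) ^ (∑ a, p a) • kk K m p := by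
  rw [sgn2, kk, TensorProduct.map_tmul, sgn_ket, LinearMap.id_apply, TensorProduct.tmul_smul]

lemma sum_single (a : Fin n) (k : ℕ) : ∑ i, (Pi.single a k : Occ n) i = k := by simp

lemma neg_one_pow_congr {j k : ℕ} (h : j % 2 = k % 2) : (-1 : K) ^ j = (-1) ^ k := by
  rw [neg_one_pow_eq_pow_mod_two, h, ← neg_one_pow_eq_pow_mod_two]

lemma sgn1_singVec (q : K) (hn : 1 ≤ n) (ε : ℤˣ) (l : ℕ) :
    sgn1 K n (singVec n q ε l) = ((ε : ℤ) : K) • singVec n q ε l := by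
  have hz : ((⟨n - 1, by omega⟩ : Fin n) : ℕ) + 1 = n := by simp only; omega
  have := singVec_mem q hz ε l (LinearMap.eqLocus (sgn1 K n) (((ε : ℤ) : K) • LinearMap.id)) ?_ ?_
  · simpa using this
  · intro _ k hk hp
    simp only [LinearMap.mem_eqLocus, sgn1_kk, sum_single, LinearMap.smul_apply,
      LinearMap.id_apply]
    rw [unit_cast_eq, neg_one_pow_eq_pow_mod_two, hp]
  · rintro rfl - y hy
    simp [LinearMap.mem_eqLocus, sgn1_kk, sum_single]

lemma sgn2_singVec (q : K) (hn : 1 ≤ n) (ε : ℤˣ) (l : ℕ) :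
    sgn2 K n (singVec n q ε l) = (((ε : ℤ) : K) * (-1) ^ l) • singVec n q ε l := by
  have hz : ((⟨n - 1, by omega⟩ : Fin n) : ℕ) + 1 = n := by simp only; omega
  have := singVec_mem q hz ε l (LinearMap.eqLocus (sgn2 K n)
    ((((ε : ℤ) : K) * (-1) ^ l) • LinearMap.id)) ?_ ?_
  · simpa using this
  · intro _ k hk hp
    simp only [LinearMap.mem_eqLocus, sgn2_kk, sum_single, LinearMap.smul_apply,
      LinearMap.id_apply]
    rw [unit_cast_eq, ← pow_add]
    congr 1
    apply neg_one_pow_congr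
    have := parityNum_lt ε
    omega
  · rintro rfl rfl y hy
    simp [LinearMap.mem_eqLocus, sgn2_kk, sum_single]

/-- The occupation number of the last site in a singular vector. -/
def singWeight (ε : ℤˣ) (l : ℕ) : ℕ := if ε = -1 ∧ l = 0 then 1 else l

lemma deltaK_last_kk {q : K} (hq0 : q ≠ 0) {z : Fin n} (hz : (z : ℕ) + 1 = n) (m p : Occ n) :
    deltaK n q n (kk K m p) = q ^ (-2 * ((m z + p z : ℕ) : ℤ) - 2) • kk K m p := by
  rw [deltaK, kk, TensorProduct.map_tmul, opK_ket, opK_ket, kEig_last q z hz, kEig_last q z hz,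
    TensorProduct.smul_tmul_smul, neg_mul_neg, ← zpow_add₀ hq0]
  congr 2; push_cast; ring

lemma deltaK_singVec {q : K} (hq0 : q ≠ 0) (hn : 1 ≤ n) (ε : ℤˣ) (l : ℕ) :
    deltaK n q n (singVec n q ε l) =
      q ^ (-2 * (singWeight ε l : ℤ) - 2) • singVec n q ε l := by
  have hz : ((⟨n - 1, by omega⟩ : Fin n) : ℕ) + 1 = n := by simp only; omega
  have := singVec_mem q hz ε l (LinearMap.eqLocus (deltaK n q n)
    (q ^ (-2 * (singWeight ε l : ℤ) - 2) • LinearMap.id)) ?_ ?_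
  · simpa using this
  · intro h k hk hp
    simp only [LinearMap.mem_eqLocus, deltaK_last_kk hq0 hz, LinearMap.smul_apply,
      LinearMap.id_apply, Pi.single_eq_same]
    rw [singWeight, if_neg h, Nat.add_sub_cancel' hk]
  · rintro rfl rfl y hy
    have hne : y ≠ ⟨n - 1, by omega⟩ := fun h => by rw [h] at hy; simp at hy
    simp [LinearMap.mem_eqLocus, deltaK_last_kk hq0 hz, singWeight, Pi.single_eq_of_ne hne.symm]

lemma degProj_kk (d : ℤ) (m p : Occ n) : degProj K n d (kk K m p) =
    if latDeg (up m, up p) = d then kk K m p else 0 := by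
  rw [degProj, diag2_kk]; split_ifs <;> simp

lemma up_single (a : Fin n) (k : ℕ) : up (Pi.single a k) = Pi.single a (k : ℤ) := by
  ext i
  by_cases h : i = a
  · subst h; simp
  · simp [h]

lemma latDeg_single_single (a b : Fin n) (j k : ℕ) :
    latDeg (up (Pi.single a j), up (Pi.single b k)) = (n - a) * j + (n - b) * k := by
  rw [up_single, up_single, ← (latDeg_single a j).1, ← (latDeg_single b k).2, ← latDeg_add]
  simp

/-- Singular vectors are homogeneous, so a projection either fixes or kills them. -/
lemma degProj_singVec (q : K) (hn : 1 ≤ n) (ε : ℤˣ) (l : ℕ) (d : ℤ) :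
    degProj K n d (singVec n q ε l) ∈ Submodule.span K {singVec n q ε l} := by
  have hz : ((⟨n - 1, by omega⟩ : Fin n) : ℕ) + 1 = n := by simp only; omega
  -- The last site has weight 1 and its neighbour weight 2, which gives degree 3 for `v^-_0`.
  set D : ℤ := if ε = -1 ∧ l = 0 then 3 else l with hD
  have := singVec_mem q hz ε l (LinearMap.eqLocus (degProj K n d)
    ((if D = d then (1 : K) else 0) • LinearMap.id)) ?_ ?_
  · rw [LinearMap.mem_eqLocus] at this
    rw [this]
    exact Submodule.smul_mem _ _ (Submodule.mem_span_singleton_self _)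
  · intro h k hk hp
    rw [if_neg h] at hD
    have e : latDeg (up (Pi.single (⟨n - 1, by omega⟩ : Fin n) k),
        up (Pi.single (⟨n - 1, by omega⟩ : Fin n) (l - k))) = D := by
      rw [latDeg_single_single, hD]; push_cast [hk, hn]; ring
    simp only [LinearMap.mem_eqLocus, degProj_kk, e, LinearMap.smul_apply, LinearMap.id_apply]
    split_ifs <;> simp
  · rintro rfl rfl y hy
    rw [if_pos ⟨rfl, rfl⟩] at hD
    have hy' : ((y : ℕ) : ℤ) = n - 2 := by simp only at hy; omega
    simp only [LinearMap.mem_eqLocus, degProj_kk, LinearMap.smul_apply, LinearMap.id_apply,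
      latDeg_single_single, hD]
    push_cast [hn]
    rw [hy', show ((n : ℤ) - (n - 2)) * 1 + (n - (n - 1)) * 1 = 3 by ring,
      show ((n : ℤ) - (n - 1)) * 1 + (n - (n - 2)) * 1 = 3 by ring]
    split_ifs <;> simp

/-! ### The action of `J` and of the `e_r` on the singular vectors -/

lemma jUp_kk (q : K) (a : Fin n) (m p : Occ n) : jUp n q a (kk K m p) =
    (q ^ tail a (up m) * (q ^ (-tail a (up p)) * qInt q (p a))) •
      kk K (m + Pi.single a 1) (p - Pi.single a 1) := by
  rw [jUp, kk, TensorProduct.map_tmul, raise_ket, lower_ket, TensorProduct.smul_tmul_smul]; rfl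

lemma jDown_kk (q : K) (a : Fin n) (m p : Occ n) : jDown n q a (kk K m p) =
    (q ^ (tail a (up m) + m a - 1) * qInt q (m a) * q ^ (-tail a (up p) - p a)) •
      kk K (m - Pi.single a 1) (p + Pi.single a 1) := by
  rw [jDown, kk, TensorProduct.map_tmul, raise_ket, lower_ket, TensorProduct.smul_tmul_smul]; rfl

lemma single_add_one (a : Fin n) (k : ℕ) :
    (Pi.single a k + Pi.single a 1 : Occ n) = Pi.single a (k + 1) := (Pi.single_add _ _ _).symm

lemma single_sub (a : Fin n) (k j : ℕ) :
    (Pi.single a k - Pi.single a j : Occ n) = Pi.single a (k - j) := by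
  ext i
  by_cases h : i = a
  · subst h; simp
  · simp [h]

lemma opJ_single (q : K) (hq0 : q ≠ 0) (z : Fin n) (k j : ℕ) :
    opJ n q (kk K (Pi.single z k) (Pi.single z j)) =
      qInt q j • kk K (Pi.single z (k + 1)) (Pi.single z (j - 1)) +
        (q ^ ((k : ℤ) - j - 1) * qInt q k) • kk K (Pi.single z (k - 1)) (Pi.single z (j + 1)) := by
  rw [opJ, LinearMap.sum_apply, Finset.sum_eq_single z]
  · rw [LinearMap.add_apply, jUp_kk, jDown_kk, single_add_one, single_sub, single_add_one,
      single_sub, up_single, up_single, tail_single, tail_single]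
    simp only [lt_irrefl, if_false, neg_zero, zpow_zero, one_mul, Pi.single_eq_same, zero_add]
    rw [mul_right_comm, ← zpow_add₀ hq0]
    congr 4; ring
  · intro b _ hb
    rw [LinearMap.add_apply, jUp_kk, jDown_kk, Pi.single_eq_of_ne hb, Pi.single_eq_of_ne hb]
    simp
  · simp

section Generic

variable {q : K} (hq0 : q ≠ 0) (hq : ∀ k : ℕ, 1 ≤ k → q ^ k ≠ 1) [CharZero K]
include hq0 hq

/-- The coefficients of `v^ε_l` enter the computations with `J` and `e_n` only through this
recursion. -/
lemma singCoeff_succ {l k : ℕ} (h : k < l) :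
    singCoeff q l (k + 1) * qInt q (k + 1) =
      singCoeff q l k * (q ^ ((l : ℤ) - k - 1) * qInt q (l - k)) := by
  have e : ((k + 1 : ℕ) : ℤ) * (2 * l - (k + 1 : ℕ) - 1) / 2 =
      (k : ℤ) * (2 * l - k - 1) / 2 + ((l : ℤ) - k - 1) := by
    have h1 := two_mul_singExp l (k + 1 : ℕ)
    have h2 := two_mul_singExp l k
    have h3 : ((k + 1 : ℕ) : ℤ) * (2 * l - (k + 1 : ℕ) - 1) =
      (k : ℤ) * (2 * l - k - 1) + 2 * ((l : ℤ) - k - 1) := by push_cast; ring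
    omega
  rw [singCoeff, singCoeff, e, zpow_add₀ hq0, mul_assoc, qBinom_succ_right hq0 hq h]
  ring

/-- Each coefficient of the target is split by `[l] = q^{k-l} [k] + q^k [l-k]`. After a shift of the
index the first part matches the terms from `jUp` and the second those from `jDown`, both by
`singCoeff_succ`. -/
lemma opJ_singVec (hn : 1 ≤ n) (ε : ℤˣ) {l : ℕ} (hl : l ≠ 0) :
    opJ n q (singVec n q ε l) = qi q l • singVec n q (-ε) l := by
  obtain ⟨z, hz⟩ : ∃ z : Fin n, (z : ℕ) + 1 = n := ⟨⟨n - 1, by omega⟩, by simp only; omega⟩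
  rw [singVec_eq q hz (by tauto), singVec_eq q hz (by tauto), map_sum, Finset.smul_sum]
  simp only [map_smul, opJ_single q hq0 z, smul_add, Finset.sum_add_distrib, smul_smul]
  have hsplit : ∀ k ∈ Finset.range (l + 1),
      (qi q l * if k % 2 = parityNum (-ε) then singCoeff q l k else 0) •
        kk K (Pi.single z k) (Pi.single z (l - k)) =
      ((if k % 2 = parityNum (-ε) then singCoeff q l k else 0) *
        (q ^ ((k : ℤ) - l) * qInt q k)) • kk K (Pi.single z k) (Pi.single z (l - k)) +
      ((if k % 2 = parityNum (-ε) then singCoeff q l k else 0) *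
        (q ^ (k : ℤ) * qInt q (l - k))) • kk K (Pi.single z k) (Pi.single z (l - k)) := by
    intro k hk
    have hk' : k ≤ l := by have := Finset.mem_range.mp hk; omega
    rw [← add_smul]
    congr 1
    have : qi q l = q ^ ((k : ℤ) - l) * qInt q k + q ^ (k : ℤ) * qInt q (l - k) := by
      rw [qInt_eq_qi, qInt_eq_qi, Nat.cast_sub hk']
      simp only [qi, neg_sub, zpow_sub₀ hq0, zpow_neg]
      have := q_sub_inv_ne hq0 hq
      field_simp
      ring
    rw [this]; ring
  rw [Finset.sum_congr rfl hsplit, Finset.sum_add_distrib]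
  congr 1
  · rw [Finset.sum_range_succ, Finset.sum_range_succ']
    simp only [Nat.sub_self, qInt_zero, mul_zero, zero_smul, add_zero]
    refine Finset.sum_congr rfl fun k hk => ?_
    have hk' := Finset.mem_range.mp hk
    rw [Nat.sub_sub]
    congr 1
    simp only [parityNum_neg_iff]
    split_ifs
    · have := singCoeff_succ hq0 hq hk'
      rw [mul_left_comm, this, mul_left_comm, ← mul_assoc (q ^ _) (q ^ _), ← zpow_add₀ hq0]
      rw [show ((k + 1 : ℕ) : ℤ) - l + (l - k - 1) = 0 by push_cast; ring, zpow_zero, one_mul]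
    · simp
  · rw [Finset.sum_range_succ', Finset.sum_range_succ]
    simp only [Nat.sub_self, qInt_zero, mul_zero, zero_smul, add_zero]
    refine Finset.sum_congr rfl fun k hk => ?_
    have hk' := Finset.mem_range.mp hk
    rw [show l - (k + 1) + 1 = l - k by omega, Nat.add_sub_cancel]
    congr 1
    have hp := parityNum_neg_iff (-ε) k
    rw [neg_neg] at hp
    simp only [hp]
    split_ifs
    · have := singCoeff_succ hq0 hq hk'
      rw [mul_left_comm, this, mul_left_comm, ← mul_assoc (q ^ _) (q ^ _), ← zpow_add₀ hq0]
      rw [Nat.cast_sub (by omega)]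
      congr 3; push_cast; ring
    · simp

/-- For `ε = -` the two kets of `v^-_0` have images under `J` proportional with ratio `q`, which the
coefficient `-q` compensates. -/
lemma opJ_singVec_zero (hn : 1 ≤ n) (ε : ℤˣ) : opJ n q (singVec n q ε 0) = 0 := by
  obtain ⟨z, hz⟩ : ∃ z : Fin n, (z : ℕ) + 1 = n := ⟨⟨n - 1, by omega⟩, by simp only; omega⟩
  rcases Int.units_eq_one_or ε with rfl | rfl
  · rw [singVec_eq q hz (by decide)]
    have h0 := opJ_single q hq0 z 0 0
    simp only [qInt_zero, zero_smul, mul_zero, add_zero, Pi.single_zero] at h0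
    simp only [zero_add, Finset.range_one, Finset.sum_singleton, Nat.sub_zero, Pi.single_zero,
      map_smul, h0, smul_zero]
  rcases lt_or_ge n 2 with hn2 | hn2
  · rw [singVec_zero_neg_of_one q hn2, map_zero]
  obtain ⟨y, hy⟩ : ∃ y : Fin n, (y : ℕ) + 1 = z := ⟨⟨n - 2, by omega⟩, by simp only; omega⟩
  have hne : y ≠ z := by rintro rfl; omega
  have hlt : y < z := by rw [Fin.lt_def]; omega
  have hgt : ¬ z < y := not_lt.mpr hlt.le
  rw [singVec_zero_neg q hz hy, map_add, map_smul]
  have h1 : qInt q 1 = 1 := by rw [qInt_eq_qi]; exact qi_one hq0 hq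
  have hother : ∀ a b c : Fin n, c ≠ a → c ≠ b →
      (jUp n q c + jDown n q c) (kk K (Pi.single a 1) (Pi.single b 1)) = 0 := by
    intro a b c ha hb
    rw [LinearMap.add_apply, jUp_kk, jDown_kk, Pi.single_eq_of_ne ha, Pi.single_eq_of_ne hb]
    simp
  have e1 : opJ n q (kk K (Pi.single y 1) (Pi.single z 1)) =
      q • kk K (Pi.single y 1 + Pi.single z 1) 0 + kk K 0 (Pi.single y 1 + Pi.single z 1) := by
    rw [opJ, LinearMap.sum_apply, Finset.sum_eq_add y z hne
      (fun c _ hc => hother _ _ c hc.1 hc.2) (by simp) (by simp)]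
    simp [jUp_kk, jDown_kk, up_single, tail_single, hlt, hgt, h1, Pi.single_eq_of_ne hne,
      Pi.single_eq_of_ne hne.symm]
    rw [add_comm, add_comm (Pi.single z 1) (Pi.single y 1)]
  have e2 : opJ n q (kk K (Pi.single z 1) (Pi.single y 1)) =
      kk K (Pi.single y 1 + Pi.single z 1) 0 + q⁻¹ • kk K 0 (Pi.single y 1 + Pi.single z 1) := by
    rw [opJ, LinearMap.sum_apply, Finset.sum_eq_add y z hne
      (fun c _ hc => hother _ _ c hc.2 hc.1) (by simp) (by simp)]
    simp [jUp_kk, jDown_kk, up_single, tail_single, hlt, hgt, h1, Pi.single_eq_of_ne hne,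
      Pi.single_eq_of_ne hne.symm]
    rw [add_comm (Pi.single z 1) (Pi.single y 1)]
  rw [e1, e2, smul_add, smul_smul, neg_mul, mul_inv_cancel₀ hq0]
  have : ∀ u v : Fock2 K n, q • u + v + (-q • u + (-1 : K) • v) = 0 := fun u v => by module
  exact this _ _

lemma deltaE_mid_kk (a b : Fin n) (hab : (b : ℕ) = a + 1) (m p : Occ n) :
    deltaE n q 1 1 ((a : ℕ) + 1) (kk K m p) =
      qInt q (p a) • kk K m (p - Pi.single a 1 + Pi.single b 1) +
      (qInt q (m a) * q ^ (-(p a : ℤ) + p b)) • kk K (m - Pi.single a 1 + Pi.single b 1) p := by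
  rw [deltaE, LinearMap.add_apply, kk, TensorProduct.map_tmul, TensorProduct.map_tmul, opK_ket,
    opE_mid_ket q 1 a b hab, opE_mid_ket q 1 a b hab, kEig_mid q a b hab,
    TensorProduct.smul_tmul_smul, LinearMap.id_apply, TensorProduct.tmul_smul]
  rfl

lemma deltaE_last_kk {z : Fin n} (hz : (z : ℕ) + 1 = n) (m p : Occ n) :
    deltaE n q 1 1 n (kk K m p) =
      (qInt q (p z) * qInt q (p z - 1) / qInt q 2 ^ 2) • kk K m (p - 2 • Pi.single z 1) +
      (qInt q (m z) * qInt q (m z - 1) / qInt q 2 ^ 2 * -q ^ (-2 * (p z : ℤ) - 1)) •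
        kk K (m - 2 • Pi.single z 1) p := by
  rw [deltaE, LinearMap.add_apply, kk, TensorProduct.map_tmul, TensorProduct.map_tmul, opK_ket,
    opE_last_ket q 1 z hz, opE_last_ket q 1 z hz, kEig_last q z hz,
    TensorProduct.smul_tmul_smul, LinearMap.id_apply, TensorProduct.tmul_smul]
  rfl

/-- The ket with `k` and `d` quanta receives one term from `1 ⊗ e_n` at `(k, d+2)` and one from `e_n
⊗ k_n` at `(k+2, d)`. Two uses of `singCoeff_succ` show that they cancel. The index shifts by 2, so
parity classes are not mixed. -/
lemma deltaE_last_singVec {z : Fin n} (hz : (z : ℕ) + 1 = n) (ε : ℤˣ) (l : ℕ)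
    (h : ¬(ε = -1 ∧ l = 0)) : deltaE n q 1 1 n (singVec n q ε l) = 0 := by
  have e2 : ∀ j : ℕ, (Pi.single z j - 2 • Pi.single z 1 : Occ n) = Pi.single z (j - 2) := fun j => by
    rw [← Pi.single_smul, single_sub]; simp
  rw [singVec_eq q hz h, map_sum]
  simp only [map_smul, deltaE_last_kk hq0 hq hz, smul_add, Finset.sum_add_distrib, smul_smul,
    Pi.single_eq_same, e2]
  rcases lt_or_ge l 2 with hl | hl
  · interval_cases l <;> simp [Finset.sum_range_succ]
  obtain ⟨l, rfl⟩ : ∃ l', l = l' + 2 := ⟨l - 2, by omega⟩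
  rw [Finset.sum_range_succ, Finset.sum_range_succ]
  conv_lhs =>
    rhs
    rw [Finset.sum_range_succ', Finset.sum_range_succ']
  have t1 : l + 2 - (l + 1) = 1 := by omega
  simp only [t1, Nat.sub_self, qInt_zero, mul_zero, zero_mul, zero_div, zero_smul, add_zero,
    zero_add]
  rw [← Finset.sum_add_distrib]
  refine Finset.sum_eq_zero fun k hk => ?_
  have hk' : k ≤ l := by have := Finset.mem_range.mp hk; omega
  obtain ⟨d, rfl⟩ := Nat.exists_eq_add_of_le hk'
  have s1 : k + d + 2 - k - 2 = d := by omega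
  have s2 : k + 1 + 1 - 2 = k := by omega
  have s3 : k + d + 2 - (k + 1 + 1) = d := by omega
  have s4 : k + d + 2 - k = d + 2 := by omega
  have s5 : k + d + 2 - (k + 1) = d + 1 := by omega
  rw [s1, s2, s3, s4, ← add_smul]
  have hpar : (k + 1 + 1) % 2 = k % 2 := by omega
  rw [hpar]
  have c1 := singCoeff_succ hq0 hq (show k < k + d + 2 by omega)
  have c2 := singCoeff_succ hq0 hq (show k + 1 < k + d + 2 by omega)
  rw [s4] at c1
  rw [s5] at c2
  split_ifs
  · have h2 : qInt q 2 ≠ 0 := qInt_ne_zero hq0 hq two_ne_zero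
    have key : singCoeff q (k + d + 2) (k + 1 + 1) * (qInt q (k + 1 + 1) * qInt q (k + 1)) *
        q ^ (-2 * (d : ℤ) - 1) =
        singCoeff q (k + d + 2) k * (qInt q (d + 2) * qInt q (d + 1)) := by
      have : singCoeff q (k + d + 2) (k + 1 + 1) * (qInt q (k + 1 + 1) * qInt q (k + 1)) =
          singCoeff q (k + d + 2) k * (qInt q (d + 2) * qInt q (d + 1)) *
            (q ^ (((k + d + 2 : ℕ) : ℤ) - k - 1) *
              q ^ (((k + d + 2 : ℕ) : ℤ) - (k + 1 : ℕ) - 1)) := by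
        rw [← mul_assoc, c2]
        linear_combination q ^ (((k + d + 2 : ℕ) : ℤ) - (k + 1 : ℕ) - 1) * qInt q (d + 1) * c1
      rw [this, ← zpow_add₀ hq0, mul_assoc, ← zpow_add₀ hq0]
      rw [show ((k + d + 2 : ℕ) : ℤ) - k - 1 + (((k + d + 2 : ℕ) : ℤ) - (k + 1 : ℕ) - 1) +
        (-2 * (d : ℤ) - 1) = 0 by push_cast; ring, zpow_zero, mul_one]
    have s6 : k + 1 + 1 - 1 = k + 1 := by omega
    have s7 : d + 2 - 1 = d + 1 := by omega
    rw [s6, s7]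
    have : singCoeff q (k + d + 2) k * (qInt q (d + 2) * qInt q (d + 1) / qInt q 2 ^ 2) +
        singCoeff q (k + d + 2) (k + 1 + 1) * (qInt q (k + 1 + 1) * qInt q (k + 1) /
          qInt q 2 ^ 2 * -q ^ (-2 * (d : ℤ) - 1)) = 0 := by
      field_simp
      linear_combination -key
    rw [this, zero_smul]
  · simp

/-- The singular vectors are killed by the raising generators of `U_q(C_n)`. -/
lemma deltaE_singVec (ε : ℤˣ) (l : ℕ) {r : ℕ} (h1 : 1 ≤ r) (h2 : r ≤ n) :
    deltaE n q 1 1 r (singVec n q ε l) = 0 := by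
  have hn : 1 ≤ n := h1.trans h2
  obtain ⟨z, hz⟩ : ∃ z : Fin n, (z : ℕ) + 1 = n := ⟨⟨n - 1, by omega⟩, by simp only; omega⟩
  by_cases h : ε = -1 ∧ l = 0
  · rw [h.1, h.2]
    rcases lt_or_ge n 2 with hn2 | hn2
    · rw [singVec_zero_neg_of_one q hn2, map_zero]
    obtain ⟨y, hy⟩ : ∃ y : Fin n, (y : ℕ) + 1 = z := ⟨⟨n - 2, by omega⟩, by simp only; omega⟩
    have hne : y ≠ z := by rintro rfl; omega
    rw [singVec_zero_neg q hz hy, map_add, map_smul]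
    rcases node_cases h1 h2 with ⟨a, b, hab, rfl⟩ | ⟨a, ha, rfl⟩
    · have haz : a ≠ z := by rintro rfl; omega
      rw [deltaE_mid_kk hq0 hq a b hab, deltaE_mid_kk hq0 hq a b hab]
      by_cases hay : a = y
      · subst hay
        obtain rfl : b = z := Fin.ext (by omega)
        have e1 : qInt q 1 = 1 := by rw [qInt_eq_qi]; exact qi_one hq0 hq
        simp [Pi.single_eq_of_ne hne, Pi.single_eq_of_ne hne.symm, e1]
        rw [← add_smul, add_neg_cancel, zero_smul]
      · simp [Pi.single_eq_of_ne haz, Pi.single_eq_of_ne hay]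
    · obtain rfl : a = z := Fin.ext (by omega)
      rw [deltaE_last_kk hq0 hq ha, deltaE_last_kk hq0 hq ha]
      simp [Pi.single_eq_of_ne hne.symm]
  · rcases node_cases h1 h2 with ⟨a, b, hab, rfl⟩ | ⟨a, ha, rfl⟩
    · have haz : a ≠ z := by rintro rfl; omega
      rw [singVec_eq q hz h, map_sum]
      refine Finset.sum_eq_zero fun k _ => ?_
      rw [map_smul, deltaE_mid_kk hq0 hq a b hab]
      simp [Pi.single_eq_of_ne haz]
    · exact deltaE_last_singVec hq0 hq ha ε l h

end Generic

end Singular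

/-! ### A functional that kills the images of the `f_r` and the singular vectors vanishes -/

section Functional

variable {K : Type*} [Field K] {n : ℕ}

lemma deltaF_mid_kk {q : K} (a b : Fin n) (hab : (b : ℕ) = a + 1) (m p : Occ n) :
    deltaF n q 1 1 ((a : ℕ) + 1) (kk K m p) =
      qInt q (m b) • kk K (m - Pi.single b 1 + Pi.single a 1) p +
      (q ^ ((m a : ℤ) - m b) * qInt q (p b)) • kk K m (p - Pi.single b 1 + Pi.single a 1) := by
  rw [deltaF, LinearMap.add_apply, kk, TensorProduct.map_tmul, TensorProduct.map_tmul, opKinv_ket,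
    opF_mid_ket q 1 a b hab, opF_mid_ket q 1 a b hab, kEig_mid q a b hab,
    TensorProduct.smul_tmul_smul, LinearMap.id_apply, ← TensorProduct.smul_tmul', ← zpow_neg,
    neg_add_eq_sub, neg_sub]
  rfl

lemma deltaF_last_kk {q : K} {z : Fin n} (hz : (z : ℕ) + 1 = n) (m p : Occ n) :
    deltaF n q 1 1 n (kk K m p) =
      kk K (m + 2 • Pi.single z 1) p + (-q ^ (2 * (m z : ℤ) + 1)) •
        kk K m (p + 2 • Pi.single z 1) := by
  rw [deltaF, LinearMap.add_apply, kk, TensorProduct.map_tmul, TensorProduct.map_tmul, opKinv_ket,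
    opF_last_ket q 1 z hz, opF_last_ket q 1 z hz, kEig_last q z hz,
    LinearMap.id_apply, ← TensorProduct.smul_tmul', inv_neg, ← zpow_neg]
  rw [show -(-2 * (m z : ℤ) - 1) = 2 * (m z : ℤ) + 1 by ring]
  rfl

variable {q : K} (hq0 : q ≠ 0) (hq : ∀ k : ℕ, 1 ≤ k → q ^ k ≠ 1) [CharZero K]
include hq0 hq

section Lam

variable {lam : Fock2 K n →ₗ[K] K}
  (hF : ∀ r, 1 ≤ r → r ≤ n → ∀ t, lam (deltaF n q 1 1 r t) = 0)
include hF

/-- Applying `f_r` to `|m + e_b⟩ ⊗ |p⟩` yields an exchange rule: a quantum of the left factor moves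
from `a` to the later site `b`, while one of the right factor moves back. -/
lemma functional_mid (a b : Fin n) (hab : (b : ℕ) = a + 1) (m p : Occ n) :
    qInt q (m b + 1) * lam (kk K (m + Pi.single a 1) p) +
      q ^ ((m a : ℤ) - m b - 1) * qInt q (p b) *
        lam (kk K (m + Pi.single b 1) (p - Pi.single b 1 + Pi.single a 1)) = 0 := by
  have hne : a ≠ b := by rintro rfl; omega
  have h := hF ((a : ℕ) + 1) (by omega) (by omega) (kk K (m + Pi.single b 1) p)
  rw [deltaF_mid_kk a b hab, map_add, map_smul, map_smul, add_tsub_cancel_right] at h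
  simpa [Pi.single_eq_of_ne hne, sub_sub] using h

/-- The relation from `f_n` moves pairs of quanta at the last site from the left factor to the right
one. -/
lemma functional_last {z : Fin n} (hz : (z : ℕ) + 1 = n) (m p : Occ n) :
    lam (kk K (m + Pi.single z 2) p) =
      q ^ (2 * (m z : ℤ) + 1) * lam (kk K m (p + Pi.single z 2)) := by
  have h := hF n (by omega) le_rfl (kk K m p)
  rw [deltaF_last_kk hz, map_add, map_smul, ← Pi.single_smul, smul_eq_mul] at h
  simp only [smul_eq_mul, mul_one] at h
  linear_combination h

/-- Apply `f_r` to `|m⟩ ⊗ |p - e_a + e_b⟩`: as `m_b = 0` the left term is absent, and the right one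
is a nonzero multiple of the ket in question. -/
lemma functional_eq_zero_of_right (a b : Fin n) (hab : (b : ℕ) = a + 1) {m p : Occ n}
    (hm : m b = 0) (hp : p a ≠ 0) : lam (kk K m p) = 0 := by
  have hne : a ≠ b := by rintro rfl; omega
  have h := hF ((a : ℕ) + 1) (by omega) (by omega)
    (kk K m (p - Pi.single a 1 + Pi.single b 1))
  rw [deltaF_mid_kk a b hab, map_add, map_smul, map_smul, smul_eq_mul, smul_eq_mul,
    add_tsub_cancel_right, hm,
    tsub_add_cancel_of_le (by
      intro i
      by_cases hi : i = a
      · subst hi; simp; omega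
      · simp [hi])] at h
  rw [qInt_zero, zero_mul, zero_add, mul_eq_zero, mul_eq_zero] at h
  rcases h with (h | h) | h
  · exact absurd h (zpow_ne_zero _ hq0)
  · refine absurd h (qInt_ne_zero hq0 hq ?_)
    simp
  · exact h

/-- Repeated use of `functional_last` empties the left factor down to its parity; the exponents `2k
+ 1` accumulate to `k(k-1)/2`. -/
lemma functional_single {z : Fin n} (hz : (z : ℕ) + 1 = n) (k j : ℕ) :
    lam (kk K (Pi.single z k) (Pi.single z j)) = q ^ ((k : ℤ) * (k - 1) / 2) *
      lam (kk K (Pi.single z (k % 2)) (Pi.single z (j + (k - k % 2)))) := by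
  induction k using Nat.strong_induction_on generalizing j with
  | _ k ih =>
    rcases lt_or_ge k 2 with hk | hk
    · interval_cases k <;> simp
    · obtain ⟨k, rfl⟩ : ∃ k', k = k' + 2 := ⟨k - 2, by omega⟩
      rw [Pi.single_add, functional_last hq0 hq hF hz, ← Pi.single_add, ih k (by omega),
        ← mul_assoc, ← zpow_add₀ hq0, Nat.add_mod_right]
      congr 2
      · have e : ((k + 2 : ℕ) : ℤ) * ((k + 2 : ℕ) - 1) = (k : ℤ) * (k - 1) + 2 * (2 * k + 1) := by
          push_cast; ring
        rw [e, Int.add_mul_ediv_left _ _ two_ne_zero]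
        simp; ring
      · rw [show j + 2 + (k - k % 2) = j + (k + 2 - k % 2) by have := Nat.mod_le k 2; omega]

/-- The exponents `k(2l-k-1)/2` and `k(k-1)/2` add up to `k(l-1)`. So the value on `v^ε_l` is one
single value times the parity part of a `q`-binomial sum, which is nonzero. -/
lemma functional_single_eq_zero {z : Fin n} (hz : (z : ℕ) + 1 = n) {ε : ℤˣ} {l : ℕ}
    (hl : parityNum ε ≤ l) (hv : lam (singVec n q ε l) = 0) :
    lam (kk K (Pi.single z (parityNum ε)) (Pi.single z (l - parityNum ε))) = 0 := by
  have h : ¬(ε = -1 ∧ l = 0) := by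
    rintro ⟨rfl, rfl⟩
    exact absurd hl (by decide)
  rw [singVec_eq q hz h, map_sum] at hv
  have e : ∀ k ∈ Finset.range (l + 1), lam ((if k % 2 = parityNum ε then singCoeff q l k else 0) •
      kk K (Pi.single z k) (Pi.single z (l - k))) =
      (if k % 2 = parityNum ε then q ^ ((k : ℤ) * (l - 1)) * qBinom q l k else 0) *
        lam (kk K (Pi.single z (parityNum ε)) (Pi.single z (l - parityNum ε))) := by
    intro k hk
    have hk := Finset.mem_range.mp hk
    rw [map_smul, smul_eq_mul, functional_single hq0 hq hF hz k]
    split_ifs with hp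
    · rw [hp, show l - k + (k - parityNum ε) = l - parityNum ε by
        have := Nat.mod_le k 2; omega, ← mul_assoc]
      congr 1
      rw [singCoeff, mul_right_comm, ← zpow_add₀ hq0]
      congr 2
      have h1 := two_mul_singExp l k
      have h2 : 2 * ((k : ℤ) * (k - 1) / 2) = k * (k - 1) := by
        apply Int.mul_ediv_cancel'
        have := (Int.even_mul_pred_self k).two_dvd
        exact this
      have h3 : (k : ℤ) * (2 * l - k - 1) + k * (k - 1) = 2 * (k * (l - 1)) := by ring
      omega
    · simp
  rw [Finset.sum_congr rfl e, ← Finset.sum_mul, ← Finset.sum_filter] at hv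
  exact (mul_eq_zero.mp hv).resolve_left
    (sum_qBinom_filter_ne_zero hq0 hq l (parityNum ε) (parityNum_lt ε) hl)

/-- Both kinds of relation push quanta of the left factor to later sites or out of it. The induction
is on its weight, and it ends with at most one quantum, at the last site. -/
lemma functional_reduce {z : Fin n} (hz : (z : ℕ) + 1 = n)
    (h0 : ∀ p, lam (kk K 0 p) = 0) (h1 : ∀ p, lam (kk K (Pi.single z 1) p) = 0) : lam = 0 := by
  suffices h : ∀ (w : ℕ) (m p : Occ n), ∑ a, (n - a) * m a = w → lam (kk K m p) = 0 from
    ext_kk fun m p => h _ m p rfl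
  intro w
  induction w using Nat.strong_induction_on with
  | _ w ih =>
    intro m p hw
    have wadd : ∀ m' m'' : Occ n, ∑ a : Fin n, (n - a) * (m' + m'') a =
        ∑ a : Fin n, (n - a) * m' a + ∑ a : Fin n, (n - a) * m'' a := fun m' m'' => by
      rw [← Finset.sum_add_distrib]
      exact Finset.sum_congr rfl fun a _ => by rw [Pi.add_apply, mul_add]
    have wsingle : ∀ (b : Fin n) (k : ℕ),
        ∑ a : Fin n, (n - a) * (Pi.single b k : Occ n) a = (n - b) * k := fun b k => by
      rw [Finset.sum_eq_single b]
      · simp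
      · intro c _ hc; simp [hc]
      · simp
    by_cases hm : ∃ a, a ≠ z ∧ m a ≠ 0
    · obtain ⟨a, haz, ha⟩ := hm
      have han : (a : ℕ) + 1 < n := by
        have : (a : ℕ) ≠ z := fun h => haz (Fin.ext h)
        omega
      have hm' : m - Pi.single a 1 + Pi.single a 1 = m := tsub_add_cancel_of_le (by
        intro i
        by_cases hi : i = a
        · subst hi; simp; omega
        · simp [hi])
      have := functional_mid hq0 hq hF a ⟨a + 1, han⟩ rfl (m - Pi.single a 1) p
      have hlow : lam (kk K (m - Pi.single a 1 + Pi.single ⟨a + 1, han⟩ 1)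
          (p - Pi.single ⟨a + 1, han⟩ 1 + Pi.single a 1)) = 0 := ih _ ?_ _ _ rfl
      · rw [hm', hlow, mul_zero, add_zero] at this
        exact (mul_eq_zero.mp this).resolve_left (qInt_ne_zero hq0 hq (Nat.succ_ne_zero _))
      · rw [← hw, ← hm', wadd, wadd, wsingle, wsingle, hm']
        simp only
        omega
    · push Not at hm
      have hmz : m = Pi.single z (m z) := by
        ext i
        by_cases hi : i = z
        · subst hi; simp
        · simp [hi, hm i hi]
      rcases lt_or_ge (m z) 2 with h2 | h2
      · rw [hmz]
        interval_cases m z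
        · simpa using h0 p
        · exact h1 p
      · obtain ⟨k, hk⟩ : ∃ k, m z = k + 2 := ⟨m z - 2, by omega⟩
        rw [hmz, hk, Pi.single_add, functional_last hq0 hq hF hz,
          ih ((n - z) * k) ?_ _ _ (wsingle z k), mul_zero]
        rw [← hw, hmz, hk, wsingle]
        exact Nat.mul_lt_mul_of_pos_left (by omega) (by omega)

theorem functional_eq_zero (hn : 1 ≤ n) (hv : ∀ ε l, lam (singVec n q ε l) = 0) : lam = 0 := by
  obtain ⟨z, hz⟩ : ∃ z : Fin n, (z : ℕ) + 1 = n := ⟨⟨n - 1, by omega⟩, by simp only; omega⟩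
  have hs0 : ∀ k, lam (kk K 0 (Pi.single z k)) = 0 := fun k => by
    have := functional_single_eq_zero hq0 hq hF hz (ε := 1) (Nat.zero_le k) (hv 1 k)
    simpa [parityNum] using this
  have hs1 : ∀ k, lam (kk K (Pi.single z 1) (Pi.single z k)) = 0 := fun k => by
    have := functional_single_eq_zero hq0 hq hF hz (ε := -1) (l := k + 1)
      (by rw [parityNum, if_neg (by decide)]; omega) (hv _ _)
    rw [parityNum, if_neg (by decide)] at this
    simpa using this
  have hsupp : ∀ p : Occ n, (∀ a, a ≠ z → p a = 0) → p = Pi.single z (p z) := fun p hp => by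
    ext i
    by_cases hi : i = z
    · subst hi; simp
    · simp [hi, hp i hi]
  refine functional_reduce hq0 hq hF hz (fun p => ?_) (fun p => ?_)
  · by_cases hp : ∃ a, a ≠ z ∧ p a ≠ 0
    · obtain ⟨a, haz, ha⟩ := hp
      have han : (a : ℕ) + 1 < n := by
        have : (a : ℕ) ≠ z := fun h => haz (Fin.ext h)
        omega
      exact functional_eq_zero_of_right hq0 hq hF a ⟨a + 1, han⟩ rfl rfl ha
    · push Not at hp
      rw [hsupp p hp]; exact hs0 _
  -- The left factor is now `e_z`. A quantum of `p` before the neighbour `y` of `z` makes the value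
  -- vanish; there remain `p = i e_y + k e_z`, where only `i = 1` needs more than the earlier
  -- lemmas.
  by_cases hp : ∃ a : Fin n, (a : ℕ) + 1 < z ∧ p a ≠ 0
  · obtain ⟨a, haz, ha⟩ := hp
    refine functional_eq_zero_of_right hq0 hq hF a ⟨a + 1, by omega⟩ rfl ?_ ha
    rw [Pi.single_eq_of_ne]
    intro h
    have := congrArg Fin.val h
    simp only at this
    omega
  push Not at hp
  rcases lt_or_ge n 2 with hn2 | hn2
  · rw [hsupp p fun a ha => absurd (Fin.ext (by omega)) ha]
    exact hs1 _
  obtain ⟨y, hy⟩ : ∃ y : Fin n, (y : ℕ) + 1 = z := ⟨⟨n - 2, by omega⟩, by simp only; omega⟩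
  have hne : y ≠ z := by rintro rfl; omega
  have hp2 : p = Pi.single y (p y) + Pi.single z (p z) := by
    ext i
    by_cases hiz : i = z
    · subst hiz; simp [Pi.single_eq_of_ne hne.symm]
    by_cases hiy : i = y
    · subst hiy; simp [Pi.single_eq_of_ne hne]
    · have : (i : ℕ) + 1 < z := by
        have h1 : (i : ℕ) ≠ z := fun h => hiz (Fin.ext h)
        have h2 : (i : ℕ) ≠ y := fun h => hiy (Fin.ext h)
        omega
      simp [hiy, hiz, hp i this]
  have q1 : qInt q 1 = 1 := by rw [qInt_eq_qi]; exact qi_one hq0 hq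
  have hmid : ∀ P : Occ n, lam (kk K (Pi.single y 1) P) + q⁻¹ * qInt q (P z) *
      lam (kk K (Pi.single z 1) (P - Pi.single z 1 + Pi.single y 1)) = 0 := fun P => by
    simpa [q1] using functional_mid hq0 hq hF y z hy.symm 0 P
  have hsub : ∀ i k : ℕ, (Pi.single y i + Pi.single z (k + 1) - Pi.single z 1 + Pi.single y 1 : Occ n)
      = Pi.single y (i + 1) + Pi.single z k := fun i k => by
    rw [Pi.single_add, ← add_assoc, add_tsub_cancel_right, Pi.single_add]
    abel
  rw [hp2]
  generalize p y = i
  generalize p z = k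
  rcases i with _ | _ | i
  · simpa using hs1 k
  · rw [zero_add]
    have hb : lam (kk K (Pi.single y 1) (Pi.single z (k + 1))) + q⁻¹ * qInt q (k + 1) *
        lam (kk K (Pi.single z 1) (Pi.single y 1 + Pi.single z k)) = 0 := by
      have := hmid (Pi.single z (k + 1))
      have e := hsub 0 k
      rw [Pi.single_zero, zero_add, zero_add] at e
      rwa [e, Pi.single_eq_same] at this
    rcases k with _ | k
    -- The one place where `v^-_0` is needed: without it the values on `|e_y⟩ ⊗ |e_z⟩` and `|e_z⟩ ⊗
    -- |e_y⟩` obey a single relation.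
    · have h := hv (-1) 0
      rw [singVec_zero_neg q hz hy, map_add, map_smul, smul_eq_mul] at h
      rw [zero_add, q1, mul_one, Pi.single_zero, add_zero] at hb
      have h2 : (q + q⁻¹) * lam (kk K (Pi.single z 1) (Pi.single y 1)) = 0 := by
        linear_combination hb - h
      rw [Pi.single_zero, add_zero]
      refine (mul_eq_zero.mp h2).resolve_left ?_
      have := zpow_add_zpow_ne_zero hq0 hq 1 (-1)
      simpa using this
    -- A second relation between the same two unknowns: exchange with two extra quanta on the left
    -- at `z`, which `functional_last` then moves to the right.
    · have h3 := functional_mid hq0 hq hF y z hy.symm (Pi.single z 2) (Pi.single z k)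
      rw [add_comm (Pi.single z 2 : Occ n) (Pi.single y 1), functional_last hq0 hq hF hz,
        Pi.single_eq_same, Pi.single_eq_of_ne hne, Pi.single_eq_of_ne hne.symm, Pi.single_eq_same,
        ← Pi.single_add] at h3
      have h4 : qInt q k * (q ^ (-3 : ℤ) * lam (kk K (Pi.single z 2 + Pi.single z 1)
          (Pi.single z k - Pi.single z 1 + Pi.single y 1))) =
          qInt q k * lam (kk K (Pi.single z 1) (Pi.single y 1 + Pi.single z (k + 1))) := by
        rcases k with _ | k
        · simp
        · have e := hsub 0 k
          rw [Pi.single_zero, zero_add, zero_add] at e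
          rw [e, add_comm (Pi.single z 2 : Occ n), functional_last hq0 hq hF hz, ← mul_assoc (q ^ _),
            ← zpow_add₀ hq0, add_assoc, ← Pi.single_add, Pi.single_eq_same]
          norm_num
      simp only [Nat.cast_zero, mul_zero, zero_add, zpow_one, Nat.cast_ofNat, zero_sub] at h3
      rw [show (-2 - 1 : ℤ) = -3 by norm_num] at h3
      have h5 : (qInt q 3 * qInt q (k + 2) - qInt q k) *
          lam (kk K (Pi.single z 1) (Pi.single y 1 + Pi.single z (k + 1))) = 0 := by
        have hqq : q * q⁻¹ = 1 := mul_inv_cancel₀ hq0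
        linear_combination qInt q 3 * q * hb - h3 + h4 - qInt q 3 * qInt q (k + 2) *
          lam (kk K (Pi.single z 1) (Pi.single y 1 + Pi.single z (k + 1))) * hqq
      refine (mul_eq_zero.mp h5).resolve_left ?_
      -- The determinant of the two relations; it factors and is therefore nonzero.
      have e : qInt q 3 * qInt q (k + 2) - qInt q k = qInt q 2 * qInt q (k + 3) := by
        have hqq : q * q⁻¹ = 1 := mul_inv_cancel₀ hq0
        have := q_sub_inv_ne hq0 hq
        simp only [qInt]
        generalize q⁻¹ = r at *
        field_simp
        linear_combination (q * r + 1) * (q - r) * (q ^ k - r ^ k) * hqq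
      rw [e]
      exact mul_ne_zero (qInt_ne_zero hq0 hq two_ne_zero) (qInt_ne_zero hq0 hq (by omega))
  · have h1 := hmid (Pi.single y (i + 1) + Pi.single z (k + 1))
    rw [hsub, functional_eq_zero_of_right hq0 hq hF y z hy.symm (Pi.single_eq_of_ne hne.symm 1)
      (by simp [Pi.single_eq_of_ne hne]), zero_add] at h1
    refine (mul_eq_zero.mp h1).resolve_left (mul_ne_zero (inv_ne_zero hq0) (qInt_ne_zero hq0 hq ?_))
    simp [Pi.single_eq_of_ne hne.symm]

end Lam

end Functional

/-! ### Gluing endomorphisms along a direct sum -/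

section Glue

variable {K V ι : Type*} [Field K] [AddCommGroup V] [Module K V]

/-- Endomorphisms given on the summands of a direct sum glue. -/
lemma exists_glue {U : ι → Submodule K V} (hi : iSupIndep U) (hs : ⨆ i, U i = ⊤)
    (G : ι → Module.End K V) : ∃ g : Module.End K V, ∀ i, ∀ t ∈ U i, g t = G i t := by
  classical
  have h := DirectSum.isInternal_submodule_of_iSupIndep_of_iSup_eq_top hi hs
  let e := LinearEquiv.ofBijective (DirectSum.coeLinearMap U) h
  refine ⟨DirectSum.toModule K ι V (fun i => G i ∘ₗ (U i).subtype) ∘ₗ e.symm.toLinearMap,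
    fun i t ht => ?_⟩
  have : e.symm t = DirectSum.lof K ι (fun i => U i) i ⟨t, ht⟩ := by
    rw [LinearEquiv.symm_apply_eq]
    exact (DirectSum.coeLinearMap_lof U i ⟨t, ht⟩).symm
  rw [LinearMap.comp_apply, LinearEquiv.coe_coe, this, DirectSum.toModule_lof]
  rfl

/-- A linear condition that holds on summands that span holds everywhere. -/
lemma eq_of_eqOn_iSup {W : Type*} [AddCommGroup W] [Module K W] {U : ι → Submodule K V}
    (hs : ⨆ i, U i = ⊤) {g g' : V →ₗ[K] W}
    (h : ∀ i, ∀ t ∈ U i, g t = g' t) : g = g' := by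
  have : ⨆ i, U i ≤ LinearMap.eqLocus g g' := iSup_le fun i t ht => h i t ht
  rw [hs] at this
  exact LinearMap.ext fun t => this (Submodule.mem_top (x := t))

/-- If the larger summands are independent and the smaller ones span, they agree. -/
lemma eq_of_le_of_iSupIndep {U E : ι → Submodule K V} (hE : iSupIndep E) (hUE : ∀ i, U i ≤ E i)
    (hs : ⨆ i, U i = ⊤) (i : ι) : U i = E i := by
  refine le_antisymm (hUE i) fun t ht => ?_
  have h1 : t ∈ U i ⊔ ⨆ (j) (_ : j ≠ i), U j := by
    have : ⨆ j, U j ≤ U i ⊔ ⨆ (j) (_ : j ≠ i), U j := iSup_le fun j => by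
      by_cases h : j = i
      · subst h; exact le_sup_left
      · exact (le_iSup₂ (f := fun j (_ : j ≠ i) => U j) j h).trans le_sup_right
    exact this (hs ▸ Submodule.mem_top)
  obtain ⟨u, hu, w, hw, rfl⟩ := Submodule.mem_sup.mp h1
  have h2 : w ∈ E i := by
    have := (E i).sub_mem ht (hUE i hu)
    rwa [add_sub_cancel_left] at this
  have h3 : w ∈ ⨆ (j) (_ : j ≠ i), E j := (iSup₂_mono fun j _ => hUE j) hw
  have h4 := (Submodule.disjoint_def.mp (hE i)) w h2 h3
  rw [h4, add_zero]
  exact hu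

end Glue

/-! ### The decomposition of `V ⊗ V` -/

section Decomposition

variable {K : Type*} [Field K] {n : ℕ}

attribute [local instance] fock2AddCommGroup

lemma singVec_mem_component (q : K) (ε : ℤˣ) (l : ℕ) :
    singVec n q ε l ∈ component n q ε l :=
  (Submodule.mem_sInf).mpr fun _ hW => hW.1

lemma deltaF_mem_component {q : K} {ε : ℤˣ} {l : ℕ} {r : ℕ} (h1 : 1 ≤ r) (h2 : r ≤ n)
    {t : Fock2 K n} (ht : t ∈ component n q ε l) :
    deltaF n q 1 1 r t ∈ component n q ε l :=
  (Submodule.mem_sInf).mpr fun W hW => hW.2 r h1 h2 t ((Submodule.mem_sInf).mp ht W hW)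

lemma component_le {q : K} {ε : ℤˣ} {l : ℕ} {W : Submodule K (Fock2 K n)}
    (h1 : singVec n q ε l ∈ W)
    (h2 : ∀ r, 1 ≤ r → r ≤ n → ∀ t ∈ W, deltaF n q 1 1 r t ∈ W) : component n q ε l ≤ W :=
  sInf_le ⟨h1, h2⟩

/-- Two operators that commute with the `f_r` agree on a component if they agree on its singular
vector. -/
lemma eqOn_component {q : K} {ε : ℤˣ} {l : ℕ} {X Y : Fock2 K n →ₗ[K] Fock2 K n}
    (hX : ∀ r, 1 ≤ r → r ≤ n → X * deltaF n q 1 1 r = deltaF n q 1 1 r * X)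
    (hY : ∀ r, 1 ≤ r → r ≤ n → Y * deltaF n q 1 1 r = deltaF n q 1 1 r * Y)
    (h : X (singVec n q ε l) = Y (singVec n q ε l)) :
    ∀ t ∈ component n q ε l, X t = Y t := by
  have : component n q ε l ≤ LinearMap.eqLocus X Y := by
    refine component_le h fun r h1 h2 t ht => ?_
    have e1 := LinearMap.congr_fun (hX r h1 h2) t
    have e2 := LinearMap.congr_fun (hY r h1 h2) t
    rw [Module.End.mul_apply, Module.End.mul_apply] at e1 e2
    rw [LinearMap.mem_eqLocus, e1, e2, (LinearMap.mem_eqLocus.mp ht)]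
  exact fun t ht => this ht

/-- The joint eigenspace of the two parity operators and of `J²` that will turn out to be
`V^ε_l`. -/
def jointEig (n : ℕ) (q : K) (ε : ℤˣ) (l : ℕ) : Submodule K (Fock2 K n) :=
  LinearMap.eqLocus (sgn1 K n) (((ε : ℤ) : K) • LinearMap.id) ⊓
    (LinearMap.eqLocus (sgn2 K n) ((((ε : ℤ) : K) * (-1) ^ l) • LinearMap.id) ⊓
      LinearMap.eqLocus (opJ n q * opJ n q) (qi q l ^ 2 • LinearMap.id))

lemma mem_jointEig {q : K} {ε : ℤˣ} {l : ℕ} {t : Fock2 K n} : t ∈ jointEig n q ε l ↔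
    sgn1 K n t = ((ε : ℤ) : K) • t ∧ sgn2 K n t = (((ε : ℤ) : K) * (-1) ^ l) • t ∧
      opJ n q (opJ n q t) = qi q l ^ 2 • t := by
  simp [jointEig, Submodule.mem_inf, LinearMap.mem_eqLocus, Module.End.mul_apply]

lemma HasSigns.apply1 {s t : K} {X : Module.End K (Fock2 K n)} (h : HasSigns s t X)
    (u : Fock2 K n) : sgn1 K n (X u) = s • X (sgn1 K n u) := LinearMap.congr_fun h.1 u

lemma HasSigns.apply2 {s t : K} {X : Module.End K (Fock2 K n)} (h : HasSigns s t X)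
    (u : Fock2 K n) : sgn2 K n (X u) = t • X (sgn2 K n u) := LinearMap.congr_fun h.2 u

lemma jointEig_stable {q : K} {ε : ℤˣ} {l : ℕ} {X : Module.End K (Fock2 K n)}
    (hX : HasSigns 1 1 X) (hJ : opJ n q * X = X * opJ n q) {t : Fock2 K n}
    (ht : t ∈ jointEig n q ε l) : X t ∈ jointEig n q ε l := by
  rw [mem_jointEig] at ht ⊢
  have hJ' : ∀ u, opJ n q (X u) = X (opJ n q u) := fun u => LinearMap.congr_fun hJ u
  refine ⟨?_, ?_, ?_⟩
  · rw [hX.apply1, ht.1, map_smul, one_smul]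
  · rw [hX.apply2, ht.2.1, map_smul, one_smul]
  · rw [hJ', hJ', ht.2.2, map_smul]

/-! ### Blocks of given parities -/

lemma mem_parityBlock_kk (m p : Occ n) :
    kk K m p ∈ parityBlock K n ((-1) ^ ∑ a, m a) ((-1) ^ ∑ a, p a) :=
  ⟨⟨ket K m, Submodule.subset_span ⟨m, rfl, rfl⟩⟩ ⊗ₜ ⟨ket K p, Submodule.subset_span ⟨p, rfl, rfl⟩⟩,
    rfl⟩

lemma sgn_of_mem_parityPart {ε : ℤˣ} {u : Fock K n} (hu : u ∈ parityPart K n ε) :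
    sgn K n u = ((ε : ℤ) : K) • u := by
  have : parityPart K n ε ≤ LinearMap.eqLocus (sgn K n) (((ε : ℤ) : K) • LinearMap.id) := by
    refine Submodule.span_le.mpr ?_
    rintro _ ⟨m, rfl, rfl⟩
    simp [sgn_ket]
  simpa using this hu

lemma unit_cast_sq (ε : ℤˣ) : ((ε : ℤ) : K) * ((ε : ℤ) : K) = 1 := by
  rcases Int.units_eq_one_or ε with rfl | rfl <;> simp

section CharZero

variable [CharZero K]

lemma unit_cast_ne {ε ε' : ℤˣ} (h : ε ≠ ε') : ((ε : ℤ) : K) ≠ ((ε' : ℤ) : K) := fun e =>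
  h (Units.ext (Int.cast_injective e))

/-- The projection on a block of given parities. -/
def blockProj (K : Type*) [Field K] (n : ℕ) (ε₁ ε₂ : ℤˣ) : Module.End K (Fock2 K n) :=
  (4⁻¹ : K) • ((LinearMap.id + ((ε₁ : ℤ) : K) • sgn1 K n) *
    (LinearMap.id + ((ε₂ : ℤ) : K) • sgn2 K n))

lemma blockProj_apply {ε₁ ε₂ : ℤˣ} {s t : K} {u : Fock2 K n} (h1 : sgn1 K n u = s • u)
    (h2 : sgn2 K n u = t • u) : blockProj K n ε₁ ε₂ u =
      (4⁻¹ * ((1 + ((ε₁ : ℤ) : K) * s) * (1 + ((ε₂ : ℤ) : K) * t))) • u := by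
  simp only [blockProj, LinearMap.smul_apply, Module.End.mul_apply, LinearMap.add_apply,
    LinearMap.id_apply, h1, h2, map_add, map_smul]
  module

/-- For the converse, `blockProj` maps every ket into the block and fixes any vector with the
prescribed parities. -/
lemma mem_parityBlock {ε₁ ε₂ : ℤˣ} {t : Fock2 K n} : t ∈ parityBlock K n ε₁ ε₂ ↔
    sgn1 K n t = ((ε₁ : ℤ) : K) • t ∧ sgn2 K n t = ((ε₂ : ℤ) : K) • t := by
  constructor
  · rintro ⟨w, rfl⟩
    induction w using TensorProduct.induction_on with
    | zero => simp
    | tmul u v =>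
      rw [TensorProduct.mapIncl, TensorProduct.map_tmul, sgn1, sgn2, TensorProduct.map_tmul,
        TensorProduct.map_tmul]
      simp only [Submodule.subtype_apply, LinearMap.id_apply]
      rw [sgn_of_mem_parityPart u.2, sgn_of_mem_parityPart v.2, TensorProduct.smul_tmul',
        TensorProduct.tmul_smul]
      exact ⟨rfl, rfl⟩
    | add a b ha hb =>
      simp only [map_add, smul_add, ha.1, ha.2, hb.1, hb.2, and_self]
  · rintro ⟨h1, h2⟩
    have key : ∀ u : Fock2 K n, blockProj K n ε₁ ε₂ u ∈ parityBlock K n ε₁ ε₂ := by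
      intro u
      induction u using TensorProduct.induction_on with
      | zero => simp
      | add a b ha hb => rw [map_add]; exact Submodule.add_mem _ ha hb
      | tmul u v =>
        induction u using Finsupp.induction_linear with
        | zero => simp
        | add a b ha hb => rw [TensorProduct.add_tmul, map_add]; exact Submodule.add_mem _ ha hb
        | single m c =>
          induction v using Finsupp.induction_linear with
          | zero => simp
          | add a b ha hb => rw [TensorProduct.tmul_add, map_add]; exact Submodule.add_mem _ ha hb
          | single p d =>
            have e : (Finsupp.single m c ⊗ₜ Finsupp.single p d : Fock2 K n) =
                (c * d) • kk K m p := by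
              rw [kk, ket, ket, ← TensorProduct.smul_tmul_smul]; simp
            rw [e, map_smul, blockProj_apply (sgn1_kk m p) (sgn2_kk m p)]
            refine Submodule.smul_mem _ _ ?_
            have hm := unit_cast_sq (K := K) ((-1) ^ ∑ a, m a)
            by_cases hm : (-1 : ℤˣ) ^ (∑ a, m a) = ε₁
            · by_cases hp : (-1 : ℤˣ) ^ (∑ a, p a) = ε₂
              · have := mem_parityBlock_kk (K := K) m p
                rw [hm, hp] at this
                exact Submodule.smul_mem _ _ this
              · have : 1 + ((ε₂ : ℤ) : K) * (-1) ^ (∑ a, p a) = 0 := by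
                  rcases Int.units_eq_one_or ε₂ with rfl | rfl <;>
                  rcases neg_one_pow_eq_or ℤˣ (∑ a, p a) with h | h <;>
                  first
                  | exact absurd h hp
                  | (have h' := congrArg (fun u : ℤˣ => ((u : ℤ) : K)) h
                     push_cast at h'
                     simp [h'])
                rw [this]; simp
            · have : 1 + ((ε₁ : ℤ) : K) * (-1) ^ (∑ a, m a) = 0 := by
                rcases Int.units_eq_one_or ε₁ with rfl | rfl <;>
                rcases neg_one_pow_eq_or ℤˣ (∑ a, m a) with h | h <;>
                first
                | exact absurd h hm
                | (have h' := congrArg (fun u : ℤˣ => ((u : ℤ) : K)) h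
                   push_cast at h'
                   simp [h'])
              rw [this]; simp
    have := key t
    rw [blockProj_apply h1 h2, unit_cast_sq, unit_cast_sq] at this
    norm_num at this
    exact this

end CharZero

/-! ### The components as joint eigenspaces and their direct sum -/

section Generic

variable {q : K} (hq0 : q ≠ 0) (hq : ∀ k : ℕ, 1 ≤ k → q ^ k ≠ 1) [CharZero K]
include hq0 hq

lemma opJ_singVec_all (hn : 1 ≤ n) (ε : ℤˣ) (l : ℕ) :
    opJ n q (singVec n q ε l) = qi q l • singVec n q (-ε) l := by
  rcases eq_or_ne l 0 with rfl | hl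
  · rw [opJ_singVec_zero hq0 hq hn, Nat.cast_zero, qi_zero, zero_smul]
  · exact opJ_singVec hq0 hq hn ε hl

lemma singVec_mem_jointEig (hn : 1 ≤ n) (ε : ℤˣ) (l : ℕ) :
    singVec n q ε l ∈ jointEig n q ε l := by
  rw [mem_jointEig]
  refine ⟨sgn1_singVec q hn ε l, sgn2_singVec q hn ε l, ?_⟩
  rw [opJ_singVec_all hq0 hq hn, map_smul, opJ_singVec_all hq0 hq hn, neg_neg, smul_smul, sq]

lemma deltaF_mem_jointEig {ε : ℤˣ} {l : ℕ} {r : ℕ} (h1 : 1 ≤ r) (h2 : r ≤ n) {t : Fock2 K n}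
    (ht : t ∈ jointEig n q ε l) : deltaF n q 1 1 r t ∈ jointEig n q ε l :=
  jointEig_stable (hasSigns_deltaF q h1 h2) (opJ_deltaF hq0 hq h1 h2) ht

lemma component_le_jointEig (hn : 1 ≤ n) (ε : ℤˣ) (l : ℕ) :
    component n q ε l ≤ jointEig n q ε l :=
  component_le (singVec_mem_jointEig hq0 hq hn ε l)
    fun _ h1 h2 _ ht => deltaF_mem_jointEig hq0 hq h1 h2 ht

/-- Eigenvectors of a self-adjoint operator with different eigenvalues are orthogonal: `sgn1`
distinguishes `ε`, and `J²` distinguishes `l` because `[l]² = [l']²` forces `l = ±l'`. -/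
lemma form2_eq_zero_of_jointEig {ε ε' : ℤˣ} {l l' : ℕ} (h : (ε, l) ≠ (ε', l')) {u v : Fock2 K n}
    (hu : u ∈ jointEig n q ε l) (hv : v ∈ jointEig n q ε' l') : form2 n q u v = 0 := by
  rw [mem_jointEig] at hu hv
  by_cases he : ε = ε'
  · subst he
    have hl : l ≠ l' := fun e => h (by rw [e])
    have hJ := isAdj_opJ (n := n) hq0
    have e : form2 n q (opJ n q (opJ n q u)) v = form2 n q u (opJ n q (opJ n q v)) := by
      rw [hJ, hJ]
    rw [hu.2.2, hv.2.2, map_smul, map_smul, LinearMap.smul_apply, smul_eq_mul, smul_eq_mul] at e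
    have e2 : (qi q l ^ 2 - qi q l' ^ 2) * form2 n q u v = 0 := by linear_combination e
    refine (mul_eq_zero.mp e2).resolve_left (sub_ne_zero.mpr fun h3 => hl ?_)
    rcases qi_sq_eq hq0 hq h3 with h4 | h4 <;> omega
  · have e := isAdj_sgn1 (n := n) q u v
    rw [hu.1, hv.1, map_smul, map_smul, LinearMap.smul_apply, smul_eq_mul, smul_eq_mul] at e
    have e2 : (((ε : ℤ) : K) - ((ε' : ℤ) : K)) * form2 n q u v = 0 := by linear_combination e
    exact (mul_eq_zero.mp e2).resolve_left (sub_ne_zero.mpr (unit_cast_ne he))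

/-- A proper subspace lies in the kernel of a nonzero functional, which `functional_eq_zero`
forbids. -/
lemma iSup_range_sup_singVec (hn : 1 ≤ n) {S : Submodule K (Fock2 K n)}
    (hF : ∀ r, 1 ≤ r → r ≤ n → ∀ t, deltaF n q 1 1 r t ∈ S)
    (hv : ∀ ε l, singVec n q ε l ∈ S) : S = ⊤ := by
  by_contra h
  obtain ⟨f, hf, hS⟩ := Submodule.exists_le_ker_of_lt_top S (lt_top_iff_ne_top.mpr h)
  exact hf (functional_eq_zero hq0 hq (fun r h1 h2 t => hS (hF r h1 h2 t)) hn fun ε l => hS (hv ε l))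

/-- Modulo the images of the `f_r`, the singular vectors span. Since the `f_r` raise the degree,
which is nonnegative on kets, the part of degree `d` can be produced from parts of smaller degree
and singular vectors. -/
theorem iSup_component (hn : 1 ≤ n) : ⨆ a : ℤˣ × ℕ, component n q a.1 a.2 = ⊤ := by
  set W := ⨆ a : ℤˣ × ℕ, component n q a.1 a.2 with hW
  have hWv : ∀ ε l, singVec n q ε l ∈ W := fun ε l =>
    (le_iSup (fun a : ℤˣ × ℕ => component n q a.1 a.2) (ε, l)) (singVec_mem_component q ε l)
  have hWF : ∀ r, 1 ≤ r → r ≤ n → ∀ t ∈ W, deltaF n q 1 1 r t ∈ W := fun r h1 h2 => by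
    have : W ≤ W.comap (deltaF n q 1 1 r) := iSup_le fun a t ht =>
      (le_iSup (fun a : ℤˣ × ℕ => component n q a.1 a.2) a) (deltaF_mem_component h1 h2 ht)
    exact fun t ht => this ht
  have hneg : ∀ d : ℤ, d < 0 → ∀ u, degProj K n d u = 0 := fun d hd u => by
    have : degProj K n d = 0 := ext_kk fun m p => by
      rw [degProj_kk, if_neg (by have := latDeg_nonneg m p; omega), LinearMap.zero_apply]
    rw [this, LinearMap.zero_apply]
  have key : ∀ (N : ℕ) (d : ℤ), d < N → ∀ u, degProj K n d u ∈ W := by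
    intro N
    induction N with
    | zero => intro d hd u; rw [hneg d (by simpa using hd)]; exact W.zero_mem
    | succ N ih =>
      intro d hd u
      -- The degree `d` part of `f_r t` is `f_r` of a part of smaller degree, already in `W`; the
      -- degree `d` part of a singular vector is a multiple of it.
      have : W.comap (degProj K n d) = ⊤ := by
        refine iSup_range_sup_singVec hq0 hq hn (fun r h1 h2 t => ?_) (fun ε l => ?_)
        · obtain ⟨h, hpos, hh⟩ := degProj_deltaF (K := K) (n := n) q h1 h2
          have e := LinearMap.congr_fun (hh d) t
          rw [Module.End.mul_apply, Module.End.mul_apply] at e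
          rw [Submodule.mem_comap, e]
          exact hWF r h1 h2 _ (ih _ (by push_cast at hd; omega) _)
        · rw [Submodule.mem_comap]
          exact (Submodule.span_singleton_le_iff_mem _ _).mpr (hWv ε l) (degProj_singVec q hn ε l d)
      have hu : u ∈ W.comap (degProj K n d) := this ▸ Submodule.mem_top
      exact hu
  have : LinearMap.range (LinearMap.id : Fock2 K n →ₗ[K] Fock2 K n) ≤ W := by
    rintro _ ⟨u, rfl⟩
    rw [LinearMap.id_apply]
    induction u using TensorProduct.induction_on with
    | zero => exact W.zero_mem
    | add a b ha hb => exact W.add_mem ha hb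
    | tmul u v =>
      induction u using Finsupp.induction_linear with
      | zero => rw [TensorProduct.zero_tmul]; exact W.zero_mem
      | add a b ha hb => rw [TensorProduct.add_tmul]; exact W.add_mem ha hb
      | single m c =>
        induction v using Finsupp.induction_linear with
        | zero => rw [TensorProduct.tmul_zero]; exact W.zero_mem
        | add a b ha hb => rw [TensorProduct.tmul_add]; exact W.add_mem ha hb
        | single p d =>
          have e : (Finsupp.single m c ⊗ₜ Finsupp.single p d : Fock2 K n) =
              (c * d) • kk K m p := by
            rw [kk, ket, ket, ← TensorProduct.smul_tmul_smul]; simp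
          rw [e]
          refine W.smul_mem _ ?_
          have := key ((latDeg (up m, up p)).toNat + 1) (latDeg (up m, up p)) (by omega) (kk K m p)
          rwa [degProj_kk, if_pos rfl] at this
  rw [LinearMap.range_id] at this
  exact top_le_iff.mp this

lemma iSup_jointEig (hn : 1 ≤ n) : ⨆ a : ℤˣ × ℕ, jointEig n q a.1 a.2 = ⊤ :=
  top_le_iff.mp ((iSup_component hq0 hq hn).symm.le.trans
    (iSup_mono fun a => component_le_jointEig hq0 hq hn a.1 a.2))

/-- A vector both in one eigenspace and in the sum of the others is orthogonal to the others by the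
first membership and to its own eigenspace by the second, hence to everything. -/
theorem iSupIndep_jointEig (hn : 1 ≤ n) :
    iSupIndep (fun a : ℤˣ × ℕ => jointEig n q a.1 a.2) := by
  intro a
  refine Submodule.disjoint_def.mpr fun t h1 h2 => form2_nondeg hq0 hq fun v => ?_
  have hv : v ∈ ⨆ a : ℤˣ × ℕ, jointEig n q a.1 a.2 := iSup_jointEig hq0 hq hn ▸ Submodule.mem_top
  have : ⨆ a : ℤˣ × ℕ, jointEig n q a.1 a.2 ≤ LinearMap.ker (form2 n q t) := by
    refine iSup_le fun b w hw => ?_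
    rw [LinearMap.mem_ker]
    by_cases hab : b = a
    · subst hab
      have : ⨆ (c) (_ : c ≠ b), jointEig n q c.1 c.2 ≤ LinearMap.ker (form2 n q w) :=
        iSup₂_le fun c hc s hs => form2_eq_zero_of_jointEig hq0 hq hc.symm hw hs
      rw [form2_symm]
      exact this h2
    · exact form2_eq_zero_of_jointEig hq0 hq (Ne.symm hab) h1 hw
  exact this hv

lemma component_eq_jointEig (hn : 1 ≤ n) (ε : ℤˣ) (l : ℕ) :
    component n q ε l = jointEig n q ε l :=
  eq_of_le_of_iSupIndep (U := fun a : ℤˣ × ℕ => component n q a.1 a.2)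
    (E := fun a : ℤˣ × ℕ => jointEig n q a.1 a.2) (iSupIndep_jointEig hq0 hq hn)
    (fun a => component_le_jointEig hq0 hq hn a.1 a.2) (iSup_component hq0 hq hn) (ε, l)

theorem iSupIndep_component (hn : 1 ≤ n) :
    iSupIndep (fun a : ℤˣ × ℕ => component n q a.1 a.2) :=
  (iSupIndep_jointEig hq0 hq hn).mono fun a => component_le_jointEig hq0 hq hn a.1 a.2

/-! ### The projectors and the transfer operators -/

lemma opJ_component_zero (hn : 1 ≤ n) (ε : ℤˣ) {t : Fock2 K n} (ht : t ∈ component n q ε 0) :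
    opJ n q t = 0 :=
  eqOn_component (X := opJ n q) (Y := 0) (fun _ h1 h2 => opJ_deltaF hq0 hq h1 h2)
    (fun _ _ _ => by rw [zero_mul, mul_zero]) (opJ_singVec_zero hq0 hq hn ε) t ht

theorem existsUnique_isProjector (hn : 1 ≤ n) (ε : ℤˣ) (l : ℕ) :
    ∃! P, IsProjector n q ε l P := by
  classical
  obtain ⟨g, hg⟩ := exists_glue (iSupIndep_component hq0 hq hn) (iSup_component hq0 hq hn)
    (fun a => if a = (ε, l) then LinearMap.id else 0)
  refine ⟨g, ⟨fun t ht => ?_, fun ε' l' h t ht => ?_⟩, fun P hP => ?_⟩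
  · rw [hg (ε, l) t ht, if_pos rfl, LinearMap.id_apply]
  · rw [hg (ε', l') t ht, if_neg h, LinearMap.zero_apply]
  · refine eq_of_eqOn_iSup (iSup_component hq0 hq hn) fun a t ht => ?_
    rw [hg a t ht]
    split_ifs with h
    · subst h; exact hP.1 t ht
    · exact hP.2 a.1 a.2 h t ht

/-- A transfer operator on the components. -/
lemma IsTransfer.apply (hn : 1 ≤ n) {ε : ℤˣ} {l : ℕ} (hl : l ≠ 0) {P : Module.End K (Fock2 K n)}
    (hP : IsTransfer n q ε l P) :
    (∀ t ∈ component n q ε l, P t = (qi q l)⁻¹ • opJ n q t) ∧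
      ∀ (ε' : ℤˣ) (l' : ℕ), (ε', l') ≠ (ε, l) → ∀ t ∈ component n q ε' l', P t = 0 := by
  have hPF := fun r h1 h2 => (hP.1 r h1 h2).2.2
  refine ⟨fun t ht => ?_, fun ε' l' h t ht => ?_⟩
  · refine eqOn_component (X := P) (Y := (qi q l)⁻¹ • opJ n q) hPF (fun r h1 h2 => ?_) ?_ t ht
    · rw [smul_mul_assoc, mul_smul_comm, opJ_deltaF hq0 hq h1 h2]
    · rw [hP.2.1, LinearMap.smul_apply, opJ_singVec hq0 hq hn ε hl, smul_smul,
        inv_mul_cancel₀ (qi_ne_zero hq0 hq (by exact_mod_cast hl)), one_smul]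
  · exact eqOn_component (X := P) (Y := 0) hPF (fun r h1 h2 => by rw [zero_mul, mul_zero])
      (hP.2.2 ε' l' h) t ht

/-- An operator that is a linear combination of `1` and `J` on each component is classical
linear. -/
lemma isClassicalLinear_of_components (hn : 1 ≤ n) {X : Module.End K (Fock2 K n)} (a b : ℤˣ × ℕ → K)
    (h : ∀ i, ∀ t ∈ component n q i.1 i.2, X t = a i • t + b i • opJ n q t) :
    IsClassicalLinear n q X := by
  have key : ∀ Y : Module.End K (Fock2 K n), HasSigns 1 1 Y → opJ n q * Y = Y * opJ n q →
      X * Y = Y * X := fun Y hY hJ => by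
    refine eq_of_eqOn_iSup (iSup_component hq0 hq hn) fun i t ht => ?_
    have hYt : Y t ∈ component n q i.1 i.2 := by
      rw [component_eq_jointEig hq0 hq hn] at ht ⊢
      exact jointEig_stable hY hJ ht
    have hJ' : opJ n q (Y t) = Y (opJ n q t) := LinearMap.congr_fun hJ t
    rw [Module.End.mul_apply, Module.End.mul_apply, h i t ht, h i _ hYt, hJ', map_add, map_smul,
      map_smul]
  exact fun r h1 h2 => ⟨key _ (hasSigns_deltaK q hn h2) (opJ_deltaK hq0 h2),
    key _ (hasSigns_deltaE hq0 hq h1 h2) (opJ_deltaE hq0 hq h1 h2),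
    key _ (hasSigns_deltaF q h1 h2) (opJ_deltaF hq0 hq h1 h2)⟩

theorem existsUnique_isTransfer (hn : 1 ≤ n) (ε : ℤˣ) {l : ℕ} (hl : l ≠ 0) :
    ∃! P, IsTransfer n q ε l P := by
  classical
  obtain ⟨g, hg⟩ := exists_glue (iSupIndep_component hq0 hq hn) (iSup_component hq0 hq hn)
    (fun a => if a = (ε, l) then (qi q l)⁻¹ • opJ n q else 0)
  refine ⟨g, ⟨?_, ?_, fun ε' l' h => ?_⟩, fun P hP => ?_⟩
  · refine isClassicalLinear_of_components hq0 hq hn (fun _ => 0)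
      (fun a => if a = (ε, l) then (qi q l)⁻¹ else 0) fun i t ht => ?_
    rw [hg i t ht]
    split_ifs <;> simp
  · rw [hg (ε, l) _ (singVec_mem_component q ε l), if_pos rfl, LinearMap.smul_apply,
      opJ_singVec hq0 hq hn ε hl, smul_smul,
      inv_mul_cancel₀ (qi_ne_zero hq0 hq (by exact_mod_cast hl)), one_smul]
  · rw [hg (ε', l') _ (singVec_mem_component q ε' l'), if_neg h, LinearMap.zero_apply]
  · have hP' := hP.apply hq0 hq hn hl
    refine eq_of_eqOn_iSup (iSup_component hq0 hq hn) fun a t ht => ?_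
    rw [hg a t ht]
    split_ifs with h
    · subst h; exact hP'.1 t ht
    · exact hP'.2 a.1 a.2 h t ht

/-- A block of given parities is spanned by the components in it. -/
lemma parityBlock_le (hn : 1 ≤ n) (ε : ℤˣ) (s : ℕ) (hs : s < 2) :
    parityBlock K n ε (ε * (-1) ^ s) ≤ ⨆ l : ℕ, component n q ε (2 * l + s) := by
  intro t ht
  rw [mem_parityBlock] at ht
  have h4 : blockProj K n ε (ε * (-1) ^ s) t = t := by
    rw [blockProj_apply ht.1 ht.2, unit_cast_sq, unit_cast_sq]; norm_num
  rw [← h4]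
  have : ⨆ a : ℤˣ × ℕ, component n q a.1 a.2 ≤
      (⨆ l : ℕ, component n q ε (2 * l + s)).comap (blockProj K n ε (ε * (-1) ^ s)) := by
    refine iSup_le fun a u hu => ?_
    have hu' := mem_jointEig.mp (component_le_jointEig hq0 hq hn _ _ hu)
    rw [Submodule.mem_comap, blockProj_apply hu'.1 hu'.2.1]
    by_cases h1 : a.1 = ε
    · by_cases h2 : a.2 % 2 = s
      · refine Submodule.smul_mem _ _ (Submodule.mem_iSup_of_mem (a.2 / 2) ?_)
        rw [← h1, ← h2, Nat.div_add_mod]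
        exact hu
      · have e : 1 + (((ε * (-1) ^ s : ℤˣ) : ℤ) : K) * (((a.1 : ℤ) : K) * (-1) ^ a.2) = 0 := by
          have h3 : (-1 : K) ^ a.2 = (-1) ^ (s + 1) := neg_one_pow_congr (by omega)
          have h5 := unit_cast_sq (K := K) ε
          have h6 : (-1 : K) ^ s * (-1) ^ s = 1 := by rw [← mul_pow]; simp
          rw [h1, h3]
          push_cast
          linear_combination (-1 : K) ^ s * (-1) ^ (s + 1) * h5 - h6
        rw [e, mul_zero, mul_zero, zero_smul]
        exact Submodule.zero_mem _
    · have e : 1 + ((ε : ℤ) : K) * ((a.1 : ℤ) : K) = 0 := by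
        rcases Int.units_eq_one_or ε with rfl | rfl <;>
        rcases Int.units_eq_one_or a.1 with h | h <;> simp_all
      rw [e, zero_mul, mul_zero, zero_smul]
      exact Submodule.zero_mem _
  rw [iSup_component hq0 hq hn] at this
  exact this (Submodule.mem_top (x := t))

end Generic

end Decomposition

/-! ### The action of `e_0` and `f_0` on the eigenvectors of `J` -/

section NodeZero

variable {K : Type*} [Field K] {n : ℕ}

attribute [local instance] fock2AddCommGroup

/-- For `J v = [s] v'` and `J v' = [s] v` this is in the eigenspace of `J²` with eigenvalue
`[s + 2]²`. -/
def shiftVec (q : K) (a : Fin n) (s : ℤ) (v v' : Fock2 K n) : Fock2 K n :=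
  q ^ (-s) • opA n q v + ((-q ^ s) • opB n q v + (q * qi q 2) • opC q a v')

/-- For `J v = [s] v'` and `J v' = [s] v` this is in the eigenspace of `J²` with eigenvalue
`[s]²`. -/
def stayVec (q : K) (a : Fin n) (s : ℤ) (v v' : Fock2 K n) : Fock2 K n :=
  q ^ (2 : ℤ) • opA n q v + (opB n q v + (q ^ (2 : ℤ) * ((q - q⁻¹) * qi q s)) • opC q a v')

/-- The coefficient of `shiftVec` in the action of `e_0`. -/
def shiftCoeff (q x y : K) (s : ℤ) : K :=
  (q ^ (-s) * y - q ^ (s + 2) * x) /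
    (q * (q ^ s + q ^ (-s)) * (q ^ (s + 1) + q ^ (-s - 1)))

/-- The coefficient of `stayVec` in the action of `e_0`. -/
def stayCoeff (q x y : K) (s : ℤ) : K :=
  (x + y) * (q + q⁻¹) / (q * (q ^ (s + 1) + q ^ (-s - 1)) * (q ^ (s - 1) + q ^ (-s + 1)))

section Generic

variable {q : K} (hq0 : q ≠ 0) (hq : ∀ k : ℕ, 1 ≤ k → q ^ k ≠ 1) [CharZero K]
include hq0 hq

/-- By the relations with `A`, `B`, `C`, the operator `J` acts on the combinations of `A v`, `B v`,
`C v'` through a 3 by 3 matrix; `(q^{-s}, -q^s, q[2])` is its eigenvector for `[s+2]`. -/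
lemma opJ_shiftVec {a : Fin n} (ha : (a : ℕ) = 0) {s : ℤ} {v v' : Fock2 K n}
    (h : opJ n q v = qi q s • v') (h' : opJ n q v' = qi q s • v) :
    opJ n q (shiftVec q a s v v') = qi q (s + 2) • shiftVec q a s v' v := by
  have eA := LinearMap.congr_fun (opJ_opA hq0 hq a ha) v
  have eB := LinearMap.congr_fun (opJ_opB hq0 hq a ha) v
  have eC := LinearMap.congr_fun (opJ_opC hq0 hq a ha) v'
  simp only [Module.End.mul_apply, LinearMap.add_apply, LinearMap.smul_apply, h, h', map_smul,
    one_smul] at eA eB eC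
  rw [shiftVec, shiftVec, map_add, map_add, map_smul, map_smul, map_smul, eA, eB, eC]
  have h0 := q_sub_inv_ne hq0 hq
  have h1 := zpow_ne_zero s hq0
  have c1 : q ^ (-s) * (q ^ (-2 : ℤ) * qi q s) + q * qi q 2 * q⁻¹ = qi q (s + 2) * q ^ (-s) := by
    simp only [qi, zpow_add₀ hq0, zpow_neg, neg_add]
    field_simp
    ring
  have c2 : -q ^ s * (q ^ (2 : ℤ) * qi q s) + q * qi q 2 * -q⁻¹ = qi q (s + 2) * -q ^ s := by
    simp only [qi, zpow_add₀ hq0, zpow_neg, neg_add]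
    field_simp
    ring
  have c3 : q ^ (-s) * qi q 2 + -q ^ s * (-q ^ (2 : ℤ) * qi q 2) + q * qi q 2 * qi q s =
      qi q (s + 2) * (q * qi q 2) := by
    simp only [qi, zpow_add₀ hq0, zpow_neg, neg_add]
    field_simp
    ring
  linear_combination (norm := module) c1 • opA n q v' + c2 • opB n q v' + c3 • opC q a v

/-- The eigenvector for `[s]` of the same 3 by 3 matrix. -/
lemma opJ_stayVec {a : Fin n} (ha : (a : ℕ) = 0) {s : ℤ} {v v' : Fock2 K n}
    (h : opJ n q v = qi q s • v') (h' : opJ n q v' = qi q s • v) :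
    opJ n q (stayVec q a s v v') = qi q s • stayVec q a s v' v := by
  have eA := LinearMap.congr_fun (opJ_opA hq0 hq a ha) v
  have eB := LinearMap.congr_fun (opJ_opB hq0 hq a ha) v
  have eC := LinearMap.congr_fun (opJ_opC hq0 hq a ha) v'
  simp only [Module.End.mul_apply, LinearMap.add_apply, LinearMap.smul_apply, h, h', map_smul,
    one_smul] at eA eB eC
  rw [stayVec, stayVec, map_add, map_add, map_smul, map_smul, eA, eB, eC]
  have hqq : q * q⁻¹ = 1 := mul_inv_cancel₀ hq0
  have h2 : q ^ (2 : ℤ) * q ^ (-2 : ℤ) = 1 := by rw [← zpow_add₀ hq0]; simp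
  have hz : q ^ (2 : ℤ) = q * q := by rw [zpow_ofNat, sq]
  have c1 : q ^ (2 : ℤ) * (q ^ (-2 : ℤ) * qi q s) + q ^ (2 : ℤ) * ((q - q⁻¹) * qi q s) * q⁻¹ =
      qi q s * q ^ (2 : ℤ) := by
    rw [← mul_assoc, h2, hz]
    linear_combination (qi q s * q * q - qi q s * (q * q⁻¹ + 1)) * hqq
  have c2 : q ^ (2 : ℤ) * qi q s + q ^ (2 : ℤ) * ((q - q⁻¹) * qi q s) * -q⁻¹ = qi q s := by
    rw [hz]
    linear_combination (-qi q s * q * q + qi q s * (q * q⁻¹ + 1)) * hqq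
  have c3 : q ^ (2 : ℤ) * qi q 2 + -q ^ (2 : ℤ) * qi q 2 = 0 := by ring
  linear_combination (norm := module) c1 • opA n q v' + c2 • opB n q v' + c3 • opC q a v

/-- The three eigenvectors, the third obtained from `(s, v')` by passing to `(-s, -v')`, form a
basis of the combinations of `A v`, `B v`, `C v'`; the coefficients come from inverting that matrix.
Its denominators are of the form `q^a + q^b`. -/
lemma deltaE_zero_apply (x y : K) (a : Fin n) (s : ℤ) (v v' : Fock2 K n) :
    deltaE n q x y 0 v = shiftCoeff q x y s • shiftVec q a s v v' +
      (shiftCoeff q x y (-s) • shiftVec q a (-s) v ((-1 : K) • v') +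
        stayCoeff q x y s • stayVec q a s v v') := by
  have h0 := q_sub_inv_ne hq0 hq
  have h1 := zpow_ne_zero s hq0
  have d1 := zpow_add_zpow_ne_zero hq0 hq s (-s)
  have d2 := zpow_add_zpow_ne_zero hq0 hq (s + 1) (-s - 1)
  have d3 := zpow_add_zpow_ne_zero hq0 hq (s - 1) (-s + 1)
  have hs2 : qi q 2 = q + q⁻¹ := qi_two hq0 hq
  have e1 : shiftCoeff q x y s * q ^ (-s) + shiftCoeff q x y (-s) * q ^ s +
      stayCoeff q x y s * q ^ (2 : ℤ) = y := by
    simp only [shiftCoeff, stayCoeff, neg_neg, zpow_add₀ hq0, zpow_sub₀ hq0, zpow_neg,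
      zpow_one, zpow_ofNat] at d1 d2 d3 ⊢
    generalize q ^ s = Q at *
    have d1' : Q ^ 2 + 1 ≠ 0 := fun h => d1 (by field_simp; linear_combination h)
    have d2' : q ^ 2 * Q ^ 2 + 1 ≠ 0 := fun h => d2 (by field_simp; linear_combination h)
    have d3' : Q ^ 2 + q ^ 2 ≠ 0 := fun h => d3 (by field_simp; linear_combination h)
    have d4' : 1 + Q ^ 2 ≠ 0 := fun h => d1' (by linear_combination h)
    have d5' : q ^ 2 + Q ^ 2 ≠ 0 := fun h => d3' (by linear_combination h)
    have d6' : Q ^ 2 * q ^ 2 + 1 ≠ 0 := fun h => d2' (by linear_combination h)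
    field_simp
    ring
  have e2 : -(shiftCoeff q x y s * q ^ s) - shiftCoeff q x y (-s) * q ^ (-s) +
      stayCoeff q x y s = x := by
    simp only [shiftCoeff, stayCoeff, neg_neg, zpow_add₀ hq0, zpow_sub₀ hq0, zpow_neg,
      zpow_one, zpow_ofNat] at d1 d2 d3 ⊢
    generalize q ^ s = Q at *
    have d1' : Q ^ 2 + 1 ≠ 0 := fun h => d1 (by field_simp; linear_combination h)
    have d2' : q ^ 2 * Q ^ 2 + 1 ≠ 0 := fun h => d2 (by field_simp; linear_combination h)
    have d3' : Q ^ 2 + q ^ 2 ≠ 0 := fun h => d3 (by field_simp; linear_combination h)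
    have d4' : 1 + Q ^ 2 ≠ 0 := fun h => d1' (by linear_combination h)
    have d5' : q ^ 2 + Q ^ 2 ≠ 0 := fun h => d3' (by linear_combination h)
    have d6' : Q ^ 2 * q ^ 2 + 1 ≠ 0 := fun h => d2' (by linear_combination h)
    field_simp
    ring
  have e3 : shiftCoeff q x y s * (q * qi q 2) - shiftCoeff q x y (-s) * (q * qi q 2) +
      stayCoeff q x y s * (q ^ (2 : ℤ) * ((q - q⁻¹) * qi q s)) = 0 := by
    rw [hs2, qi, mul_div_cancel₀ _ h0]
    simp only [shiftCoeff, stayCoeff, neg_neg, zpow_add₀ hq0, zpow_sub₀ hq0, zpow_neg,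
      zpow_one, zpow_ofNat] at d1 d2 d3 ⊢
    generalize q ^ s = Q at *
    have d1' : Q ^ 2 + 1 ≠ 0 := fun h => d1 (by field_simp; linear_combination h)
    have d2' : q ^ 2 * Q ^ 2 + 1 ≠ 0 := fun h => d2 (by field_simp; linear_combination h)
    have d3' : Q ^ 2 + q ^ 2 ≠ 0 := fun h => d3 (by field_simp; linear_combination h)
    have d4' : 1 + Q ^ 2 ≠ 0 := fun h => d1' (by linear_combination h)
    have d5' : q ^ 2 + Q ^ 2 ≠ 0 := fun h => d3' (by linear_combination h)
    have d6' : Q ^ 2 * q ^ 2 + 1 ≠ 0 := fun h => d2' (by linear_combination h)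
    field_simp
    ring
  rw [deltaE_zero, LinearMap.add_apply, LinearMap.smul_apply, LinearMap.smul_apply, shiftVec,
    shiftVec, stayVec, map_smul, neg_neg]
  linear_combination (norm := module) (-e1) • opA n q v - e2 • opB n q v - e3 • opC q a v'

/-- The adjoint of `e_0` on `V`. -/
lemma isAdj_opE_zero (hn : 1 ≤ n) : IsAdj (form1 n q) (opE n q 1 0)
    ((-qInt q 2 ^ 2) • (opK n q 0 ∘ₗ opF n q 1 0)) := by
  obtain ⟨a, ha⟩ : ∃ a : Fin n, (a : ℕ) = 0 := ⟨⟨0, hn⟩, rfl⟩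
  have hup : IsAdj (form1 n q) (raise a fun _ => 1)
      (lower a fun m => q ^ (m a - 1) * qInt q (m a)) :=
    isAdj_raise a _ _ (fun m hm => by simp [hm]) fun m => by simp
  have e1 : opE n q 1 0 = raise a (fun _ => 1) * raise a (fun _ => 1) := ext_ket fun m => by
    simp only [opE_zero_ket q 1 a ha, Module.End.mul_apply, raise_ket, one_smul, add_assoc]
    rw [← two_smul ℕ (Pi.single a 1 : Occ n)]
  rw [e1]
  convert hup.mul hup using 1
  refine ext_ket fun m => ?_
  simp only [LinearMap.smul_apply, LinearMap.comp_apply, opF_zero_ket q 1 a ha, map_smul,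
    opK_ket, kEig_zero q a ha, Module.End.mul_apply, lower_ket, smul_smul, Pi.sub_apply,
    Pi.single_eq_same, tsub_tsub]
  rw [show Pi.single a 1 + Pi.single a 1 = (2 • Pi.single a 1 : Occ n) from (two_smul _ _).symm]
  congr 1
  have hq2 : qInt q 2 ≠ 0 := qInt_ne_zero hq0 hq two_ne_zero
  simp only [Pi.smul_apply, Pi.single_eq_same, smul_eq_mul, mul_one, inv_one]
  rcases h : m a with _ | _ | k
  · simp
  · simp
  · rw [show k + 1 + 1 - 2 = k by omega, show k + 1 + 1 - 1 = k + 1 by omega]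
    field_simp
    ring

/-- The parameters get exchanged: `f_0` carries the inverse parameter, and multiplying by `x y`
turns `y^{-1}` into `x`. -/
lemma isAdj_deltaE_zero (hn : 1 ≤ n) {x y : K} (hx : x ≠ 0) (hy : y ≠ 0) :
    IsAdj (form2 n q) (deltaE n q x y 0)
      ((-qInt q 2 ^ 2 * (x * y)) • (deltaK n q 0 * deltaF n q y x 0)) := by
  have hE : ∀ x : K, opE n q x 0 = x • opE n q 1 0 := fun x => ext_ket fun m => by
    simp [opE, ket]
  have hF : ∀ x : K, opF n q x 0 = x⁻¹ • opF n q 1 0 := fun x => ext_ket fun m => by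
    simp [opF, ket, mul_comm]
  have h := isAdj_opE_zero hq0 hq hn
  have hK : IsAdj (form1 n q) (opK n q 0) (opK n q 0) := isAdj_diag _ (opK_ket q 0)
  have := (isAdj_map (IsAdj.id (B := form1 n q)) (h.smul y)).add (isAdj_map (h.smul x) hK)
  rw [deltaE, hE x, hE y]
  refine (congrArg (IsAdj (form2 n q) _) ?_).mp this
  rw [deltaK, deltaF, mul_add, Module.End.mul_eq_comp, Module.End.mul_eq_comp,
    ← TensorProduct.map_comp, ← TensorProduct.map_comp, opK_mul_opKinv hq0, LinearMap.comp_id,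
    hF x, hF y, LinearMap.comp_smul, LinearMap.comp_smul]
  simp only [TensorProduct.map_smul_left, TensorProduct.map_smul_right, smul_add, smul_smul]
  rw [add_comm]
  congr 2
  · field_simp
  · field_simp

end Generic

end NodeZero

section Spectrum

variable {K : Type*} [Field K]

/-! ### The eigenvalues of `P R(z)` -/

/-- The eigenvalues of `P R(z)` on the components, up to a transfer operator for odd `l`. -/
def specNat (q c z : K) (l : ℕ) : K :=
  if l % 2 = 0 then
    ∏ j ∈ Finset.Icc 1 (l / 2), (z - q ^ (4 * j - 2)) / (1 - q ^ (4 * j - 2) * z)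
  else (c / (1 - z)) * ∏ j ∈ Finset.Icc 1 (l / 2), (z - q ^ (4 * j)) / (1 - q ^ (4 * j) * z)

/-- The eigenvalue of `P R(z)` on the eigenvectors of `J` with eigenvalue `[s]`. -/
def spec (q c z : K) (s : ℤ) : K :=
  if 0 ≤ s then specNat q c z s.natAbs else (-1) ^ s.natAbs * specNat q c z s.natAbs

lemma spec_natCast (q c z : K) (l : ℕ) : spec q c z l = specNat q c z l := by
  simp [spec]

lemma spec_neg_natCast (q c z : K) (l : ℕ) :
    spec q c z (-(l : ℤ)) = (-1) ^ l * specNat q c z l := by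
  rw [spec, Int.natAbs_neg, Int.natAbs_natCast]
  split_ifs with h
  · obtain rfl : l = 0 := by omega
    simp
  · rfl

lemma specNat_add_two {q z : K} (c : K) (hz : ∀ k : ℕ, 1 - q ^ k * z ≠ 0) (l : ℕ) :
    specNat q c z (l + 2) * (1 - q ^ (2 * l + 2) * z) =
      specNat q c z l * (z - q ^ (2 * l + 2)) := by
  rw [specNat, specNat, Nat.add_mod_right, show (l + 2) / 2 = l / 2 + 1 by omega,
    Finset.prod_Icc_succ_top (by omega), Finset.prod_Icc_succ_top (by omega)]
  split_ifs with h
  · rw [show 4 * (l / 2 + 1) - 2 = 2 * l + 2 by omega, mul_assoc,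
      div_mul_cancel₀ _ (hz (2 * l + 2))]
  · rw [show 4 * (l / 2 + 1) = 2 * l + 2 by omega, mul_assoc, mul_assoc,
      div_mul_cancel₀ _ (hz (2 * l + 2)), mul_assoc]

lemma one_sub_ne_zero {q z : K} (hz : ∀ k : ℤ, z ≠ q ^ k) (k : ℤ) :
    1 - q ^ k * z ≠ 0 := fun h => hz (-k) (by
  rw [zpow_neg]
  exact eq_inv_of_mul_eq_one_right (sub_eq_zero.mp h).symm)

/-- For `s ≥ 0` this is the definition of the products; for `s ≤ -2` it is the same recursion read
backwards, where the sign `(-1)^l` does not change in steps of 2. -/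
lemma spec_add_two {q z : K} (c : K) (hq0 : q ≠ 0) (hz : ∀ k : ℤ, z ≠ q ^ k) (s : ℤ) :
    spec q c z (s + 2) * (1 - q ^ (2 * s + 2) * z) = spec q c z s * (z - q ^ (2 * s + 2)) := by
  have hz' : ∀ k : ℕ, 1 - q ^ k * z ≠ 0 := fun k => by
    have := one_sub_ne_zero hz k
    rwa [zpow_natCast] at this
  rcases le_or_gt 0 s with h | h
  · obtain ⟨l, rfl⟩ := Int.eq_ofNat_of_zero_le h
    have := specNat_add_two c hz' l
    rw [show ((l : ℤ) + 2) = ((l + 2 : ℕ) : ℤ) by push_cast; ring, spec_natCast, spec_natCast,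
      show 2 * (l : ℤ) + 2 = ((2 * l + 2 : ℕ) : ℤ) by push_cast; ring, zpow_natCast, this]
  -- Here the branches meet: both sides contain `1 - z` up to sign, and oddness of `spec` on odd
  -- integers is exactly what is needed.
  rcases eq_or_ne s (-1) with rfl | h1
  · have e1 : spec q c z (-1) = -specNat q c z 1 := by
      have := spec_neg_natCast q c z 1
      simpa using this
    have e2 : spec q c z (-1 + 2) = specNat q c z 1 := by
      have := spec_natCast q c z 1
      simpa using this
    rw [e1, e2]
    simp only [mul_neg, mul_one, neg_add_cancel, zpow_zero]
    ring
  · obtain ⟨l, rfl⟩ : ∃ l : ℕ, s = -((l + 2 : ℕ) : ℤ) := ⟨(-s - 2).toNat, by omega⟩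
    have := specNat_add_two c hz' l
    rw [spec_neg_natCast, show -((l + 2 : ℕ) : ℤ) + 2 = -(l : ℤ) by push_cast; ring,
      spec_neg_natCast, show 2 * -((l + 2 : ℕ) : ℤ) + 2 = -((2 * l + 2 : ℕ) : ℤ) by push_cast; ring,
      zpow_neg, zpow_natCast, pow_add (-1 : K) l 2]
    have h2 : q ^ (2 * l + 2) ≠ 0 := pow_ne_zero _ hq0
    field_simp
    linear_combination this

end Spectrum

/-! ### Braidings -/

section Braiding

variable {K : Type*} [Field K] {n : ℕ}

attribute [local instance] fock2AddCommGroup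

/-- The exchange of the two factors. -/
def swap (K : Type*) [Field K] (n : ℕ) : Module.End K (Fock2 K n) :=
  (TensorProduct.comm K (Fock K n) (Fock K n)).toLinearMap

lemma swap_map (X Y : Module.End K (Fock K n)) :
    swap K n * TensorProduct.map X Y = TensorProduct.map Y X * swap K n :=
  TensorProduct.ext' fun _ _ => rfl

lemma swap_swap (t : Fock2 K n) : swap K n (swap K n t) = t := by
  rw [swap]
  exact (TensorProduct.comm K (Fock K n) (Fock K n)).symm_apply_apply t

lemma swap_mul_swap : swap K n * swap K n = 1 := LinearMap.ext fun t => swap_swap t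

lemma swap_mul_cancel {X Y : Module.End K (Fock2 K n)} (h : swap K n * X = swap K n * Y) : X = Y := by
  have := congrArg (swap K n * ·) h
  simpa only [← mul_assoc, swap_mul_swap, one_mul] using this

lemma permR_eq (R : Module.End K (Fock2 K n)) : permR R = swap K n * R := rfl

lemma swap_deltaE' (q x y : K) (r : ℕ) :
    swap K n * deltaE' n q x y r = deltaE n q y x r * swap K n := by
  rw [deltaE', deltaE, mul_add, add_mul, swap_map, swap_map]

lemma swap_deltaF' (q x y : K) (r : ℕ) :
    swap K n * deltaF' n q x y r = deltaF n q y x r * swap K n := by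
  rw [deltaF', deltaF, mul_add, add_mul, swap_map, swap_map, add_comm]

lemma swap_deltaK (q : K) (r : ℕ) : swap K n * deltaK n q r = deltaK n q r * swap K n :=
  swap_map _ _

lemma swap_sgn1 : swap K n * sgn1 K n = sgn2 K n * swap K n := swap_map _ _

lemma swap_sgn2 : swap K n * sgn2 K n = sgn1 K n * swap K n := swap_map _ _

/-- The intertwining properties of `P R(z)`. -/
structure IsBraiding (n : ℕ) (q x y : K) (D : Module.End K (Fock2 K n)) : Prop where
  sgn12 : sgn1 K n * D = D * sgn2 K n
  sgn21 : sgn2 K n * D = D * sgn1 K n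
  comm_k : ∀ r ≤ n, D * deltaK n q r = deltaK n q r * D
  comm_e : ∀ r ≤ n, D * deltaE n q x y r = deltaE n q y x r * D
  comm_f : ∀ r ≤ n, D * deltaF n q x y r = deltaF n q y x r * D

variable [CharZero K]

/-- The exchange of the factors turns `Δ'` with parameters `(x, y)` into `Δ` with `(y, x)`, and
interchanges the two parity operators. -/
lemma IsQuantumR.isBraiding {q c x y : K} {R : Module.End K (Fock2 K n)}
    (h : IsQuantumR n q c x y R) : IsBraiding n q x y (permR R) where
  sgn12 := by
    rw [permR_eq, ← mul_assoc, ← swap_sgn2, mul_assoc, mul_assoc]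
    congr 1
    refine ext_kk fun m p => ?_
    have := (mem_parityBlock.mp (h.block _ _ _ (mem_parityBlock_kk (K := K) m p))).2
    rw [Module.End.mul_apply, Module.End.mul_apply, this, sgn2_kk, map_smul]
    push_cast
    rfl
  sgn21 := by
    rw [permR_eq, ← mul_assoc, ← swap_sgn1, mul_assoc, mul_assoc]
    congr 1
    refine ext_kk fun m p => ?_
    have := (mem_parityBlock.mp (h.block _ _ _ (mem_parityBlock_kk (K := K) m p))).1
    rw [Module.End.mul_apply, Module.End.mul_apply, this, sgn1_kk, map_smul]
    push_cast
    rfl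
  comm_k r hr := by rw [permR_eq, mul_assoc, ← h.comm_k r hr, ← mul_assoc, swap_deltaK, mul_assoc]
  comm_e r hr := by rw [permR_eq, mul_assoc, ← h.comm_e r hr, ← mul_assoc, swap_deltaE', mul_assoc]
  comm_f r hr := by rw [permR_eq, mul_assoc, ← h.comm_f r hr, ← mul_assoc, swap_deltaF', mul_assoc]

lemma IsBraiding.isQuantumR {q c x y : K} {D : Module.End K (Fock2 K n)}
    (h : IsBraiding n q x y D) {a : Fin n} (ha : (a : ℕ) = 0) (h0 : D (kk K 0 0) = kk K 0 0)
    (h1 : D (kk K 0 (Pi.single a 1)) = (c / (1 - x / y)) • kk K (Pi.single a 1) 0)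
    (h2 : D (kk K (Pi.single a 1) 0) = (c / (1 - x / y)) • kk K 0 (Pi.single a 1))
    (h3 : D (kk K (Pi.single a 1) (Pi.single a 1)) =
      ((x / y - q ^ 2) / (1 - x / y * q ^ 2)) • kk K (Pi.single a 1) (Pi.single a 1)) :
    IsQuantumR n q c x y (permR D) := by
  have e : unitVec n 1 = Pi.single a 1 := by rw [← unitVec_eq a, ha]
  have hs : ∀ t : Fock2 K n, permR D t = swap K n (D t) := fun t => rfl
  refine ⟨fun ε₁ ε₂ t ht => ?_, fun r hr => ?_, fun r hr => ?_, fun r hr => ?_, ?_, ?_, ?_, ?_⟩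
  · rw [mem_parityBlock] at ht ⊢
    have s1 := LinearMap.congr_fun (swap_sgn2 (K := K) (n := n)) (D t)
    have s2 := LinearMap.congr_fun (swap_sgn1 (K := K) (n := n)) (D t)
    have s3 := LinearMap.congr_fun h.sgn12 t
    have s4 := LinearMap.congr_fun h.sgn21 t
    simp only [Module.End.mul_apply] at s1 s2 s3 s4
    rw [hs, ← s1, ← s2, s3, s4, ht.1, ht.2]
    simp only [map_smul, and_self]
  · refine swap_mul_cancel ?_
    rw [permR_eq, ← mul_assoc, swap_deltaK, mul_assoc, ← mul_assoc (swap K n), swap_mul_swap,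
      one_mul, ← h.comm_k r hr, ← mul_assoc, ← mul_assoc, swap_mul_swap, one_mul]
  · refine swap_mul_cancel ?_
    rw [permR_eq, ← mul_assoc, swap_deltaE', mul_assoc, ← mul_assoc (swap K n), swap_mul_swap,
      one_mul, ← h.comm_e r hr, ← mul_assoc, ← mul_assoc, swap_mul_swap, one_mul]
  · refine swap_mul_cancel ?_
    rw [permR_eq, ← mul_assoc, swap_deltaF', mul_assoc, ← mul_assoc (swap K n), swap_mul_swap,
      one_mul, ← h.comm_f r hr, ← mul_assoc, ← mul_assoc, swap_mul_swap, one_mul]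
  · exact (congrArg (swap K n) h0).trans rfl
  · rw [e]
    refine (congrArg (swap K n) h1).trans ?_
    rw [map_smul]; rfl
  · rw [e]
    refine (congrArg (swap K n) h2).trans ?_
    rw [map_smul]; rfl
  · rw [e]
    refine (congrArg (swap K n) h3).trans ?_
    rw [map_smul]; rfl

end Braiding

/-! ### The existence of the `R` matrix -/

section Existence

variable {K : Type*} [Field K] {n : ℕ} [CharZero K]

attribute [local instance] fock2AddCommGroup

variable {q : K} (hq0 : q ≠ 0) (hq : ∀ k : ℕ, 1 ≤ k → q ^ k ≠ 1)
include hq0 hq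

lemma iSupIndep_eigenspace_opJ :
    iSupIndep fun s : ℤ => Module.End.eigenspace (opJ n q) (qi q s) :=
  (Module.End.eigenspaces_iSupIndep (opJ n q)).comp fun _ _ h => qi_inj hq0 hq h

/-- On a component with `l > 0`, `J²` is `[l]²`, so `t` is half the sum of the eigenvectors `t ± J t
/ [l]`, with eigenvalues `±[l] = [±l]`. For `l = 0` the component is in the kernel of `J`. -/
lemma iSup_eigenspace_opJ (hn : 1 ≤ n) :
    ⨆ s : ℤ, Module.End.eigenspace (opJ n q) (qi q s) = ⊤ := by
  refine top_le_iff.mp ((iSup_component hq0 hq hn).symm.le.trans (iSup_le fun a t ht => ?_))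
  have hJ := (mem_jointEig.mp (component_le_jointEig hq0 hq hn _ _ ht)).2.2
  have hmem : ∀ (s : ℤ) (u : Fock2 K n), opJ n q u = qi q s • u →
      u ∈ ⨆ s : ℤ, Module.End.eigenspace (opJ n q) (qi q s) := fun s u hu =>
    Submodule.mem_iSup_of_mem s (Module.End.mem_eigenspace_iff.mpr hu)
  by_cases hl : a.2 = 0
  · refine hmem 0 t ?_
    rw [hl] at ht
    rw [opJ_component_zero hq0 hq hn _ ht, qi_zero, zero_smul]
  · have hne : qi q a.2 ≠ 0 := qi_ne_zero hq0 hq (by exact_mod_cast hl)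
    have e : t = (2⁻¹ : K) • (t + (qi q a.2)⁻¹ • opJ n q t) +
        (2⁻¹ : K) • (t + (-(qi q a.2)⁻¹) • opJ n q t) := by
      have : (2⁻¹ : K) + 2⁻¹ = 1 := by norm_num
      linear_combination (norm := module) -this • t
    rw [e]
    refine Submodule.add_mem _ (Submodule.smul_mem _ _ (hmem a.2 _ ?_))
      (Submodule.smul_mem _ _ (hmem (-a.2) _ ?_))
    · rw [map_add, map_smul, hJ, smul_add, smul_smul, smul_smul, mul_inv_cancel₀ hne, sq,
        inv_mul_cancel_left₀ hne]
      module
    · rw [map_add, map_smul, hJ, smul_add, smul_smul, smul_smul, qi_neg, neg_mul_neg,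
        mul_inv_cancel₀ hne, sq, neg_mul, inv_mul_cancel_left₀ hne]
      module

lemma exists_spectral (hn : 1 ≤ n) (c z : K) : ∃ D : Module.End K (Fock2 K n),
    ∀ (s : ℤ) (u : Fock2 K n), opJ n q u = qi q s • u → D u = spec q c z s • u := by
  obtain ⟨g, hg⟩ := exists_glue (iSupIndep_eigenspace_opJ (n := n) hq0 hq)
    (iSup_eigenspace_opJ hq0 hq hn) (fun s => spec q c z s • LinearMap.id)
  exact ⟨g, fun s u hu => hg s u (Module.End.mem_eigenspace_iff.mpr hu)⟩

section Spectral

variable {c z : K} {D : Module.End K (Fock2 K n)}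
  (hD : ∀ (s : ℤ) (u : Fock2 K n), opJ n q u = qi q s • u → D u = spec q c z s • u)
include hD

/-- `D` is a function of the diagonalizable operator `J`. -/
lemma spectral_comm (hn : 1 ≤ n) {X : Module.End K (Fock2 K n)}
    (hX : opJ n q * X = X * opJ n q) : D * X = X * D := by
  refine eq_of_eqOn_iSup (iSup_eigenspace_opJ hq0 hq hn) fun s u hu => ?_
  rw [Module.End.mem_eigenspace_iff] at hu
  have hX' : opJ n q (X u) = X (opJ n q u) := LinearMap.congr_fun hX u
  rw [Module.End.mul_apply, Module.End.mul_apply, hD s u hu, hD s (X u) (by rw [hX', hu, map_smul]),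
    map_smul]

lemma isAdj_spectral (hn : 1 ≤ n) : IsAdj (form2 n q) D D := by
  have : (form2 n q).comp D = (form2 n q).compl₂ D := by
    refine eq_of_eqOn_iSup (iSup_eigenspace_opJ hq0 hq hn) fun s u hu => ?_
    refine eq_of_eqOn_iSup (iSup_eigenspace_opJ hq0 hq hn) fun t v hv => ?_
    rw [Module.End.mem_eigenspace_iff] at hu hv
    rw [LinearMap.comp_apply, LinearMap.compl₂_apply, hD s u hu, hD t v hv, map_smul, map_smul,
      LinearMap.smul_apply]
    by_cases h : s = t
    · rw [h]
    · have e := isAdj_opJ (n := n) hq0 u v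
      rw [hu, hv, map_smul, map_smul, LinearMap.smul_apply, smul_eq_mul, smul_eq_mul] at e
      have e2 : (qi q s - qi q t) * form2 n q u v = 0 := by linear_combination e
      rw [(mul_eq_zero.mp e2).resolve_left (sub_ne_zero.mpr fun h' => h (qi_inj hq0 hq h')),
        smul_zero, smul_zero]
  exact fun u v => LinearMap.congr_fun₂ this u v

/-- The action on a component. -/
lemma spectral_apply {ε : ℤˣ} {l : ℕ} {t : Fock2 K n} (ht : t ∈ jointEig n q ε l) (hl : l ≠ 0) :
    D t = if l % 2 = 0 then specNat q c z l • t
      else (specNat q c z l * (qi q l)⁻¹) • opJ n q t := by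
  have hJ := (mem_jointEig.mp ht).2.2
  have hne : qi q l ≠ 0 := qi_ne_zero hq0 hq (by exact_mod_cast hl)
  have e : t = (2⁻¹ : K) • (t + (qi q l)⁻¹ • opJ n q t) +
      (2⁻¹ : K) • (t + (-(qi q l)⁻¹) • opJ n q t) := by
    have : (2⁻¹ : K) + 2⁻¹ = 1 := by norm_num
    linear_combination (norm := module) -this • t
  have h1 : D (t + (qi q l)⁻¹ • opJ n q t) = spec q c z l • (t + (qi q l)⁻¹ • opJ n q t) := by
    refine hD l _ ?_
    rw [map_add, map_smul, hJ, smul_add, smul_smul, smul_smul, mul_inv_cancel₀ hne, sq,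
        inv_mul_cancel_left₀ hne]
    module
  have h2 : D (t + (-(qi q l)⁻¹) • opJ n q t) =
      spec q c z (-(l : ℤ)) • (t + (-(qi q l)⁻¹) • opJ n q t) := by
    refine hD (-l) _ ?_
    rw [map_add, map_smul, hJ, smul_add, smul_smul, smul_smul, qi_neg, neg_mul_neg,
        mul_inv_cancel₀ hne, sq, neg_mul, inv_mul_cancel_left₀ hne]
    module
  have hDt : D t = (2⁻¹ : K) • D (t + (qi q l)⁻¹ • opJ n q t) +
      (2⁻¹ : K) • D (t + (-(qi q l)⁻¹) • opJ n q t) := by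
    conv_lhs => rw [e, map_add, map_smul, map_smul]
  rw [hDt, h1, h2, spec_natCast, spec_neg_natCast]
  have : (2⁻¹ : K) + 2⁻¹ = 1 := by norm_num
  split_ifs with h
  · have h3 : (-1 : K) ^ l = 1 := (Nat.even_iff.mpr h).neg_one_pow
    rw [h3]
    linear_combination (norm := module) (specNat q c z l * this) • t
  · have h3 : (-1 : K) ^ l = -1 := (Nat.odd_iff.mpr (by omega)).neg_one_pow
    rw [h3]
    linear_combination (norm := module) ((specNat q c z l * (qi q l)⁻¹) * this) • opJ n q t

lemma spectral_apply_component (hn : 1 ≤ n) {ε : ℤˣ} {l : ℕ} {t : Fock2 K n}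
    (ht : t ∈ component n q ε l) : D t = if l % 2 = 0 then specNat q c z l • t
      else (specNat q c z l * (qi q l)⁻¹) • opJ n q t := by
  by_cases hl : l = 0
  · subst hl
    rw [if_pos rfl, hD 0 t (by rw [opJ_component_zero hq0 hq hn ε ht, qi_zero, zero_smul])]
    exact congrArg (· • t) (spec_natCast q c z 0)
  · exact spectral_apply hq0 hq hD (component_le_jointEig hq0 hq hn ε l ht) hl

end Spectral

/-- With `z = x / y` the numerators `q^{-s} y - q^{s+2} x` and `q^{-s} x - q^{s+2} y` are `q^{-s} y`
times `1 - q^{2s+2} z` and `z - q^{2s+2}`, the factors of `spec_add_two`. -/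
lemma spectral_shiftCoeff {c x y : K} (hy : y ≠ 0) (hz : ∀ k : ℤ, x / y ≠ q ^ k) (s : ℤ) :
    spec q c (x / y) (s + 2) * shiftCoeff q x y s = spec q c (x / y) s * shiftCoeff q y x s := by
  have h := spec_add_two c hq0 hz s
  have h2 : q ^ (-s) * q ^ (2 * s + 2) = q ^ (s + 2) := by
    rw [← zpow_add₀ hq0]; congr 1; ring
  have h3 : x / y * y = x := div_mul_cancel₀ x hy
  rw [shiftCoeff, shiftCoeff, ← mul_div_assoc, ← mul_div_assoc]
  congr 1
  rw [← h2]
  generalize spec q c (x / y) (s + 2) = A at *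
  generalize spec q c (x / y) s = B at *
  generalize x / y = z at *
  rw [← h3]
  linear_combination q ^ (-s) * y * h

lemma spectral_shiftCoeff_neg {c x y : K} (hy : y ≠ 0) (hz : ∀ k : ℤ, x / y ≠ q ^ k) (s : ℤ) :
    spec q c (x / y) (s - 2) * shiftCoeff q x y (-s) =
      spec q c (x / y) s * shiftCoeff q y x (-s) := by
  have h := spec_add_two c hq0 hz (s - 2)
  have h2 : q ^ s * q ^ (-(2 * (s - 2) + 2)) = q ^ (-s + 2) := by
    rw [← zpow_add₀ hq0]; congr 1; ring
  have h4 : q ^ (-(2 * (s - 2) + 2)) * q ^ (2 * (s - 2) + 2) = 1 := by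
    rw [← zpow_add₀ hq0]; simp
  have h3 : x / y * y = x := div_mul_cancel₀ x hy
  rw [shiftCoeff, shiftCoeff, ← mul_div_assoc, ← mul_div_assoc, neg_neg]
  congr 1
  rw [← h2]
  rw [sub_add_cancel] at h
  generalize spec q c (x / y) (s - 2) = A at *
  generalize spec q c (x / y) s = B at *
  generalize x / y = z at *
  generalize q ^ (-(2 * (s - 2) + 2)) = T at *
  generalize q ^ (2 * (s - 2) + 2) = T' at *
  rw [← h3]
  linear_combination q ^ s * y * (T * h + (B * z - A) * h4)

/-- On an eigenvector, both sides are expanded in the eigenvectors for `[s+2]`, `[s-2]`, `[s]`. The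
first two coefficients agree by the recursion for `spec`, the last because `stayCoeff` is symmetric
in `x` and `y`. -/
lemma spectral_deltaE_zero (hn : 1 ≤ n) {c x y : K} (hy : y ≠ 0) (hz : ∀ k : ℤ, x / y ≠ q ^ k)
    {D : Module.End K (Fock2 K n)}
    (hD : ∀ (s : ℤ) (u : Fock2 K n), opJ n q u = qi q s • u → D u = spec q c (x / y) s • u) :
    D * deltaE n q x y 0 = deltaE n q y x 0 * D := by
  obtain ⟨a, ha⟩ : ∃ a : Fin n, (a : ℕ) = 0 := ⟨⟨0, hn⟩, rfl⟩
  refine eq_of_eqOn_iSup (iSup_eigenspace_opJ hq0 hq hn) fun s u hu => ?_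
  rw [Module.End.mem_eigenspace_iff] at hu
  have h1 := hD (s + 2) (shiftVec q a s u u) (opJ_shiftVec hq0 hq ha hu hu)
  have h2 := hD s (stayVec q a s u u) (opJ_stayVec hq0 hq ha hu hu)
  have hneg : ∀ w : Fock2 K n, shiftVec q a (-s) ((-1 : K) • w) w =
      (-1 : K) • shiftVec q a (-s) w ((-1 : K) • w) := fun w => by
    simp only [shiftVec, map_smul]
    module
  -- `opJ_shiftVec` at `-s` gives `[-s+2]` times the vector with its arguments exchanged; that
  -- exchange costs a sign, so the eigenvalue is `[s-2]`.
  have h3 := hD (s - 2) (shiftVec q a (-s) u ((-1 : K) • u)) (by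
    rw [opJ_shiftVec hq0 hq ha (s := -s) (v := u) (v' := (-1 : K) • u), hneg,
      show -s + 2 = -(s - 2) by ring, qi_neg]
    · module
    · rw [hu, qi_neg]; module
    · rw [map_smul, hu, qi_neg]; module)
  rw [Module.End.mul_apply, Module.End.mul_apply, hD s u hu, map_smul,
    deltaE_zero_apply hq0 hq x y a s u u, deltaE_zero_apply hq0 hq y x a s u u, map_add, map_add,
    map_smul, map_smul, map_smul, h1, h2, h3]
  have c1 := spectral_shiftCoeff hq0 hq (c := c) hy hz s
  have c2 := spectral_shiftCoeff_neg hq0 hq (c := c) hy hz s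
  have c3 : stayCoeff q x y s = stayCoeff q y x s := by rw [stayCoeff, stayCoeff, add_comm x y]
  rw [c3]
  linear_combination (norm := module) c1 • shiftVec q a s u u +
    c2 • shiftVec q a (-s) u ((-1 : K) • u)

lemma deltaK_injective {r : ℕ} : Function.Injective (deltaK n q r) := by
  have : TensorProduct.map (opKinv n q r) (opKinv n q r) * deltaK n q r = 1 := by
    rw [deltaK, Module.End.mul_eq_comp, ← TensorProduct.map_comp, opKinv_mul_opK hq0,
      TensorProduct.map_id]
    rfl
  exact fun u v h => by
    have h' := congrArg (TensorProduct.map (opKinv n q r) (opKinv n q r)) h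
    rw [← Module.End.mul_apply, ← Module.End.mul_apply, this] at h'
    exact h'

/-- Node 0 is the only one that is not a consequence of commuting with `J`. The parities are
exchanged because `D` is a scalar on even components and a multiple of `J` on odd ones. -/
lemma isBraiding_spectral (hn : 1 ≤ n) {c x y : K} (hx : x ≠ 0) (hy : y ≠ 0)
    (hz : ∀ k : ℤ, x / y ≠ q ^ k) {D : Module.End K (Fock2 K n)}
    (hD : ∀ (s : ℤ) (u : Fock2 K n), opJ n q u = qi q s • u → D u = spec q c (x / y) s • u) :
    IsBraiding n q x y D := by
  have hsg : ∀ i : ℤˣ × ℕ, ∀ t ∈ component n q i.1 i.2,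
      sgn1 K n (D t) = D (sgn2 K n t) ∧ sgn2 K n (D t) = D (sgn1 K n t) := by
    intro i t ht
    have ht' := mem_jointEig.mp (component_le_jointEig hq0 hq hn _ _ ht)
    rw [ht'.1, ht'.2.1, map_smul, map_smul, spectral_apply_component hq0 hq hD hn ht]
    split_ifs with h
    · have h3 : (-1 : K) ^ i.2 = 1 := (Nat.even_iff.mpr h).neg_one_pow
      rw [map_smul, map_smul, ht'.1, ht'.2.1, h3]
      constructor <;> module
    · have h3 : (-1 : K) ^ i.2 = -1 := (Nat.odd_iff.mpr (by omega)).neg_one_pow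
      rw [map_smul, map_smul, (hasSigns_opJ q).apply1, (hasSigns_opJ q).apply2, ht'.1, ht'.2.1,
        map_smul, map_smul, h3]
      constructor <;> module
  have hE := spectral_deltaE_zero hq0 hq hn hy hz hD
  have hK : ∀ r ≤ n, D * deltaK n q r = deltaK n q r * D := fun r hr =>
    spectral_comm hq0 hq hD hn (opJ_deltaK hq0 hr)
  refine ⟨?_, ?_, hK, fun r hr => ?_, fun r hr => ?_⟩
  · exact eq_of_eqOn_iSup (iSup_component hq0 hq hn) fun i t ht => (hsg i t ht).1
  · exact eq_of_eqOn_iSup (iSup_component hq0 hq hn) fun i t ht => (hsg i t ht).2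
  · rcases Nat.eq_zero_or_pos r with rfl | h
    · exact hE
    · rw [deltaE_congr q x y h.ne', deltaE_congr q y x h.ne']
      exact spectral_comm hq0 hq hD hn (opJ_deltaE hq0 hq h hr)
  · rcases Nat.eq_zero_or_pos r with rfl | h
    -- The adjoint of the relation for `e_0` is the relation for `k_0 f_0`, with the parameters
    -- exchanged twice; then `k_0` is cancelled.
    · have hDD := isAdj_spectral hq0 hq hD hn
      have a1 := hDD.mul (isAdj_deltaE_zero hq0 hq hn hx hy)
      have a2 := (isAdj_deltaE_zero hq0 hq hn hy hx).mul hDD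
      rw [hE] at a1
      have a3 := a1.unique hq0 hq a2
      have hne : -qInt q 2 ^ 2 * (x * y) ≠ 0 :=
        mul_ne_zero (neg_ne_zero.mpr (pow_ne_zero _ (qInt_ne_zero hq0 hq two_ne_zero)))
          (mul_ne_zero hx hy)
      rw [mul_comm y x, smul_mul_assoc, mul_smul_comm, ← mul_assoc D, hK 0 hr, mul_assoc,
        mul_assoc] at a3
      refine LinearMap.ext fun t => deltaK_injective hq0 hq (r := 0) ?_
      have a4 := LinearMap.congr_fun a3 t
      rw [LinearMap.smul_apply, LinearMap.smul_apply] at a4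
      exact (smul_right_injective _ hne a4).symm
    · rw [deltaF_congr q x y h.ne', deltaF_congr q y x h.ne']
      exact spectral_comm hq0 hq hD hn (opJ_deltaF hq0 hq h hr)

end Existence

/-! ### A braiding is determined by one constant on each component -/

section Uniqueness

variable {K : Type*} [Field K] {n : ℕ}

attribute [local instance] fock2AddCommGroup

/-! ### Coordinates -/

lemma coord_opA (q : K) {a : Fin n} (ha : (a : ℕ) = 0) (m p : Occ n) (u : Fock2 K n) :
    coord m (p + Pi.single a 2) (opA n q u) = coord m p u := by
  have : coord m (p + Pi.single a 2) ∘ₗ opA n q = coord m p := ext_kk fun m' p' => by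
    rw [LinearMap.comp_apply, opA, kk, TensorProduct.map_tmul, opE_zero_ket q 1 a ha, one_smul,
      ← Pi.single_smul, LinearMap.id_apply]
    change coord _ _ (kk K _ _) = coord _ _ (kk K _ _)
    rw [coord_kk, coord_kk]
    simp
  exact LinearMap.congr_fun this u

lemma coord_opB (q : K) {a : Fin n} (ha : (a : ℕ) = 0) {m : Occ n} (hm : m a = 0) (p : Occ n)
    (u : Fock2 K n) : coord m p (opB n q u) = 0 := by
  have : coord m p ∘ₗ opB n q = 0 := ext_kk fun m' p' => by
    rw [LinearMap.comp_apply, opB, kk, TensorProduct.map_tmul, opE_zero_ket q 1 a ha, opK_ket,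
      TensorProduct.smul_tmul_smul, map_smul]
    have : coord m p (kk K (m' + 2 • Pi.single a 1) p') = 0 := by
      rw [coord_kk, if_neg]
      rintro ⟨rfl, -⟩
      simp at hm
    exact (congrArg _ this).trans (smul_zero _)
  exact LinearMap.congr_fun this u

lemma coord_opC (q : K) {a : Fin n} {m : Occ n} (hm : m a = 0) (p : Occ n)
    (u : Fock2 K n) : coord m p (opC q a u) = 0 := by
  have : coord m p ∘ₗ opC q a = 0 := ext_kk fun m' p' => by
    rw [LinearMap.comp_apply, opC, kk, TensorProduct.map_tmul, raise_ket, raise_ket,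
      TensorProduct.smul_tmul_smul, map_smul]
    have : coord m p (kk K (m' + Pi.single a 1) (p' + Pi.single a 1)) = 0 := by
      rw [coord_kk, if_neg]
      rintro ⟨rfl, -⟩
      simp at hm
    exact (congrArg _ this).trans (smul_zero _)
  exact LinearMap.congr_fun this u

/-- `B` and `C` both add quanta at `a` in the first factor, so only the `A` term is visible at such
a coordinate. This is the test for nonvanishing. -/
lemma coord_shiftVec (q : K) {a : Fin n} (ha : (a : ℕ) = 0) {m : Occ n} (hm : m a = 0) (p : Occ n)
    (s : ℤ) (v v' : Fock2 K n) :
    coord m (p + Pi.single a 2) (shiftVec q a s v v') = q ^ (-s) * coord m p v := by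
  rw [shiftVec, map_add, map_add, map_smul, map_smul, map_smul, coord_opA q ha, coord_opB q ha hm,
    coord_opC q hm]
  simp

lemma coord_singVec (q : K) {z : Fin n} (hz : (z : ℕ) + 1 = n) {ε : ℤˣ} {l k : ℕ}
    (h : ¬(ε = -1 ∧ l = 0)) (hk : k ≤ l) (hp : k % 2 = parityNum ε) :
    coord (Pi.single z k) (Pi.single z (l - k)) (singVec n q ε l) = singCoeff q l k := by
  rw [singVec_eq q hz h, map_sum, Finset.sum_eq_single k]
  · rw [if_pos hp, map_smul, coord_kk]; simp
  · intro j _ hj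
    rw [map_smul, coord_kk, if_neg (c := _ ∧ _) fun h1 => hj (Pi.single_injective z h1.1).symm,
      smul_zero]
  · intro h1
    exact absurd (Finset.mem_range.mpr (by omega)) h1

/-! ### Weights -/

section Generic

variable {q : K} (hq0 : q ≠ 0) (hq : ∀ k : ℕ, 1 ≤ k → q ^ k ≠ 1) [CharZero K]
include hq0 hq

lemma singCoeff_ne_zero (l k : ℕ) : singCoeff q l k ≠ 0 :=
  mul_ne_zero (zpow_ne_zero _ hq0) (qBinom_ne_zero hq0 hq l k)

lemma deltaK_mid_kk (a b : Fin n) (hab : (b : ℕ) = a + 1) (m p : Occ n) :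
    deltaK n q ((a : ℕ) + 1) (kk K m p) =
      q ^ (((m b + p b : ℕ) : ℤ) - ((m a + p a : ℕ) : ℤ)) • kk K m p := by
  rw [deltaK, kk, TensorProduct.map_tmul, opK_ket, opK_ket, kEig_mid q a b hab,
    kEig_mid q a b hab, TensorProduct.smul_tmul_smul, ← zpow_add₀ hq0]
  congr 2; push_cast; ring

/-- The singular vectors are weight vectors. -/
lemma exists_deltaK_singVec (ε : ℤˣ) (l : ℕ) {r : ℕ} (h1 : 1 ≤ r) (h2 : r ≤ n) :
    ∃ κ : K, κ ≠ 0 ∧ deltaK n q r (singVec n q ε l) = κ • singVec n q ε l := by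
  have hn : 1 ≤ n := h1.trans h2
  obtain ⟨z, hz⟩ : ∃ z : Fin n, (z : ℕ) + 1 = n := ⟨⟨n - 1, by omega⟩, by simp only; omega⟩
  rcases node_cases h1 h2 with ⟨a, b, hab, rfl⟩ | ⟨a, ha, rfl⟩
  · have key : ∀ w : Occ n, (¬(ε = -1 ∧ l = 0) → w = Pi.single z l) →
        (ε = -1 → l = 0 → ∀ y : Fin n, (y : ℕ) + 1 = z → w = Pi.single y 1 + Pi.single z 1) →
        deltaK n q ((a : ℕ) + 1) (singVec n q ε l) =
          q ^ ((w b : ℤ) - w a) • singVec n q ε l := fun w hw1 hw2 => by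
      have := singVec_mem q hz ε l (LinearMap.eqLocus (deltaK n q ((a : ℕ) + 1))
        (q ^ ((w b : ℤ) - w a) • LinearMap.id)) ?_ ?_
      · simpa using this
      · intro h k hk _
        simp only [LinearMap.mem_eqLocus, deltaK_mid_kk hq0 hq a b hab, LinearMap.smul_apply,
          LinearMap.id_apply, ← Pi.add_apply]
        rw [← Pi.single_add, Nat.add_sub_cancel' hk, hw1 h]
      · intro h h' y hy
        simp only [LinearMap.mem_eqLocus, deltaK_mid_kk hq0 hq a b hab, LinearMap.smul_apply,
          LinearMap.id_apply, hw2 h h' y hy, Pi.add_apply]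
        refine ⟨trivial, ?_⟩
        rw [add_comm ((Pi.single z 1 : Occ n) b), add_comm ((Pi.single z 1 : Occ n) a)]
    by_cases h : ε = -1 ∧ l = 0
    · have hy : ((⟨n - 2, by omega⟩ : Fin n) : ℕ) + 1 = z := by simp only; omega
      refine ⟨_, zpow_ne_zero _ hq0, key (Pi.single ⟨n - 2, by omega⟩ 1 + Pi.single z 1)
        (fun h' => absurd h h') fun _ _ y hy' => ?_⟩
      have : y = ⟨n - 2, by omega⟩ := Fin.ext (by simp only; omega)
      rw [this]
    · exact ⟨_, zpow_ne_zero _ hq0, key (Pi.single z l) (fun _ => rfl) fun h1 h2 => absurd ⟨h1, h2⟩ h⟩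
  · exact ⟨_, zpow_ne_zero _ hq0, deltaK_singVec hq0 hn ε l⟩

/-- A singular weight vector is orthogonal to the images of the `f_r`. -/
lemma form2_deltaF_eq_zero {u : Fock2 K n} {r : ℕ} (h1 : 1 ≤ r) (h2 : r ≤ n)
    (hE : deltaE n q 1 1 r u = 0) {κ : K} (hκ : κ ≠ 0) (hK : deltaK n q r u = κ • u)
    (t : Fock2 K n) : form2 n q u (deltaF n q 1 1 r t) = 0 := by
  obtain ⟨c, hc, h⟩ := isAdj_deltaE (n := n) hq0 hq h1 h2
  have e := h u t
  rw [hE, LinearMap.smul_apply, Module.End.mul_apply, map_smul, ← isAdj_deltaK q r, hK, map_zero,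
    LinearMap.zero_apply, map_smul, LinearMap.smul_apply, smul_eq_mul, smul_eq_mul] at e
  exact ((mul_eq_zero.mp ((mul_eq_zero.mp e.symm).resolve_left hc)).resolve_left hκ)

/-- A singular weight vector that is orthogonal to all but one of the singular vectors is a multiple
of the remaining one. -/
lemma exists_smul_singVec (hn : 1 ≤ n) {u : Fock2 K n} {ε : ℤˣ} {l : ℕ}
    (hu : ∀ r, 1 ≤ r → r ≤ n → ∀ t, form2 n q u (deltaF n q 1 1 r t) = 0)
    (ho : ∀ ε' l', (ε', l') ≠ (ε, l) → form2 n q u (singVec n q ε' l') = 0) :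
    ∃ δ : K, u = δ • singVec n q ε l := by
  have hzero : ∀ w : Fock2 K n,
      (∀ r, 1 ≤ r → r ≤ n → ∀ t, form2 n q w (deltaF n q 1 1 r t) = 0) →
      (∀ ε' l', form2 n q w (singVec n q ε' l') = 0) → w = 0 := fun w h1 h2 =>
    form2_nondeg hq0 hq fun t => by
      rw [functional_eq_zero hq0 hq h1 hn h2, LinearMap.zero_apply]
  set v := singVec n q ε l with hv
  have hvF : ∀ r, 1 ≤ r → r ≤ n → ∀ t, form2 n q v (deltaF n q 1 1 r t) = 0 := fun r h1 h2 t => by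
    obtain ⟨κ, hκ, hK⟩ := exists_deltaK_singVec hq0 hq ε l h1 h2
    exact form2_deltaF_eq_zero hq0 hq h1 h2 (deltaE_singVec hq0 hq ε l h1 h2) hκ hK t
  have hvo : ∀ ε' l', (ε', l') ≠ (ε, l) → form2 n q v (singVec n q ε' l') = 0 := fun ε' l' h =>
    form2_eq_zero_of_jointEig hq0 hq h.symm (singVec_mem_jointEig hq0 hq hn ε l)
      (singVec_mem_jointEig hq0 hq hn ε' l')
  by_cases hvv : form2 n q v v = 0
  · have hv0 : v = 0 := hzero v hvF fun ε' l' => by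
      by_cases h : (ε', l') = (ε, l)
      · obtain ⟨rfl, rfl⟩ := Prod.mk.inj h; exact hvv
      · exact hvo ε' l' h
    refine ⟨0, ?_⟩
    rw [zero_smul]
    refine hzero u hu fun ε' l' => ?_
    by_cases h : (ε', l') = (ε, l)
    · obtain ⟨rfl, rfl⟩ := Prod.mk.inj h
      rw [← hv, hv0, map_zero]
    · exact ho ε' l' h
  · refine ⟨form2 n q u v / form2 n q v v, ?_⟩
    have : u + (-(form2 n q u v / form2 n q v v)) • v = 0 := by
      refine hzero _ (fun r h1 h2 t => ?_) fun ε' l' => ?_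
      · rw [map_add, map_smul, LinearMap.add_apply, LinearMap.smul_apply, hu r h1 h2, hvF r h1 h2]
        simp
      · rw [map_add, map_smul, LinearMap.add_apply, LinearMap.smul_apply, smul_eq_mul]
        by_cases h : (ε', l') = (ε, l)
        · obtain ⟨rfl, rfl⟩ := Prod.mk.inj h
          rw [← hv, neg_mul, div_mul_cancel₀ _ hvv, add_neg_cancel]
        · rw [ho ε' l' h, hvo ε' l' h]; simp
    linear_combination (norm := module) this

/-! ### The braidings on the components -/

section Braidings

variable {x y : K} {D : Module.End K (Fock2 K n)} (hD : IsBraiding n q x y D)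
include hD

lemma IsBraiding.comm_deltaF {r : ℕ} (h1 : 1 ≤ r) (h2 : r ≤ n) :
    D * deltaF n q 1 1 r = deltaF n q 1 1 r * D := by
  have := hD.comm_f r h2
  rwa [deltaF_congr q x y (by omega), deltaF_congr q y x (by omega)] at this

lemma IsBraiding.comm_deltaE {r : ℕ} (h1 : 1 ≤ r) (h2 : r ≤ n) :
    D * deltaE n q 1 1 r = deltaE n q 1 1 r * D := by
  have := hD.comm_e r h2
  rwa [deltaE_congr q x y (by omega), deltaE_congr q y x (by omega)] at this

lemma eq_zero_of_eigenvalue_ne {B : Fock2 K n →ₗ[K] Fock2 K n →ₗ[K] K}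
    {X : Module.End K (Fock2 K n)} (hX : IsAdj B X X) {u v : Fock2 K n} {s t : K}
    (hu : X u = s • u) (hv : X v = t • v) (hst : s ≠ t) : B u v = 0 := by
  have e := hX u v
  rw [hu, hv, map_smul, map_smul, LinearMap.smul_apply, smul_eq_mul, smul_eq_mul] at e
  have e2 : (s - t) * B u v = 0 := by linear_combination e
  exact (mul_eq_zero.mp e2).resolve_left (sub_ne_zero.mpr hst)

/-- The image is again a singular weight vector, hence orthogonal to the images of the `f_r`.
Parities and the weight at the last node then make it orthogonal to all but one singular vector. -/
lemma IsBraiding.exists_singVec (hn : 1 ≤ n) (ε : ℤˣ) (l : ℕ) :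
    ∃ δ : K, D (singVec n q ε l) = δ • singVec n q (ε * (-1) ^ l) l := by
  set v := singVec n q ε l with hv
  refine exists_smul_singVec hq0 hq hn (fun r h1 h2 t => ?_) fun ε' l' h => ?_
  · obtain ⟨κ, hκ, hK⟩ := exists_deltaK_singVec hq0 hq ε l h1 h2
    refine form2_deltaF_eq_zero hq0 hq h1 h2 ?_ hκ (κ := κ) ?_ t
    · have := LinearMap.congr_fun (hD.comm_deltaE hq0 hq h1 h2) v
      rw [Module.End.mul_apply, Module.End.mul_apply, deltaE_singVec hq0 hq ε l h1 h2,
        map_zero] at this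
      exact this.symm
    · have := LinearMap.congr_fun (hD.comm_k r h2) v
      rw [Module.End.mul_apply, Module.End.mul_apply, hK, map_smul] at this
      exact this.symm
  · have s1 : sgn1 K n (D v) = (((ε * (-1) ^ l : ℤˣ) : ℤ) : K) • D v := by
      have := LinearMap.congr_fun hD.sgn12 v
      rw [Module.End.mul_apply, Module.End.mul_apply, sgn2_singVec q hn, map_smul] at this
      rw [this]; push_cast; rfl
    have s2 : sgn2 K n (D v) = ((ε : ℤ) : K) • D v := by
      have := LinearMap.congr_fun hD.sgn21 v
      rwa [Module.End.mul_apply, Module.End.mul_apply, sgn1_singVec q hn, map_smul] at this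
    by_cases he : ε' = ε * (-1) ^ l
    swap
    · exact eq_zero_of_eigenvalue_ne hq0 hq hD (isAdj_sgn1 q) s1 (sgn1_singVec q hn ε' l')
        (unit_cast_ne (Ne.symm he))
    -- Needed because the weight at node `n` does not tell `v^-_0` from `v^ε_1`; the parity of `l`
    -- does.
    by_cases hpar : l % 2 = l' % 2
    swap
    · refine eq_zero_of_eigenvalue_ne hq0 hq hD (isAdj_sgn2 q) s2 (sgn2_singVec q hn ε' l') ?_
      have h3 : (-1 : K) ^ l' = (-1) ^ (l + 1) := neg_one_pow_congr (by omega)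
      have h6 : (-1 : K) ^ l * (-1) ^ l = 1 := by rw [← mul_pow]; simp
      rw [he, h3]
      push_cast
      intro h4
      have h5 : (2 : K) * ((ε : ℤ) : K) = 0 := by linear_combination h4 - ((ε : ℤ) : K) * h6
      have h7 := unit_cast_sq (K := K) ε
      rw [(mul_eq_zero.mp h5).resolve_left two_ne_zero] at h7
      simp at h7
    have hl : l' ≠ l := fun hl => h (by rw [he, hl])
    have s3 : deltaK n q n (D v) = q ^ (-2 * (singWeight ε l : ℤ) - 2) • D v := by
      have := LinearMap.congr_fun (hD.comm_k n le_rfl) v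
      rw [Module.End.mul_apply, Module.End.mul_apply, deltaK_singVec hq0 hn, map_smul] at this
      exact this.symm
    refine eq_zero_of_eigenvalue_ne hq0 hq hD (isAdj_deltaK q n) s3 (deltaK_singVec hq0 hn ε' l')
      fun h4 => ?_
    have h5 := zpow_inj hq0 hq h4
    simp only [singWeight] at h5
    split_ifs at h5 <;> omega

/-- A braiding on a component. -/
lemma IsBraiding.exists_component (hn : 1 ≤ n) (ε : ℤˣ) (l : ℕ) : ∃ δ : K,
    ∀ t ∈ component n q ε l, D t = if l % 2 = 0 then δ • t else δ • opJ n q t := by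
  obtain ⟨δ, hδ⟩ := hD.exists_singVec hq0 hq hn ε l
  have hF := fun r h1 h2 => hD.comm_deltaF hq0 hq (r := r) h1 h2
  split_ifs with h
  · refine ⟨δ, eqOn_component (X := D) (Y := δ • LinearMap.id) hF
      (fun r _ _ => LinearMap.ext fun t => (map_smul (deltaF n q 1 1 r) δ t).symm) ?_⟩
    have h3 : (-1 : ℤˣ) ^ l = 1 := (Nat.even_iff.mpr h).neg_one_pow
    rw [hδ, h3, mul_one]; rfl
  · have hne : qi q l ≠ 0 := qi_ne_zero hq0 hq (by
      have : l ≠ 0 := by rintro rfl; simp at h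
      exact_mod_cast this)
    refine ⟨δ * (qi q l)⁻¹, eqOn_component (X := D) (Y := (δ * (qi q l)⁻¹) • opJ n q) hF
      (fun r h1 h2 => ?_) ?_⟩
    · rw [smul_mul_assoc, mul_smul_comm, opJ_deltaF hq0 hq h1 h2]
    · have h3 : (-1 : ℤˣ) ^ l = -1 := (Nat.odd_iff.mpr (by omega)).neg_one_pow
      rw [hδ, h3, mul_neg_one, LinearMap.smul_apply, opJ_singVec_all hq0 hq hn, smul_smul,
        inv_mul_cancel_right₀ hne]

/-- A braiding that kills a nonzero vector of a component kills the component. -/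
lemma IsBraiding.eq_zero_on_component (hn : 1 ≤ n) {ε : ℤˣ} {l : ℕ} {t : Fock2 K n}
    (ht : t ∈ component n q ε l) (ht0 : t ≠ 0) (h : D t = 0) :
    ∀ u ∈ component n q ε l, D u = 0 := by
  obtain ⟨δ, hδ⟩ := hD.exists_component hq0 hq hn ε l
  have hδ0 : δ = 0 := by
    have e := hδ t ht
    rw [h] at e
    split_ifs at e with hl
    · exact (smul_eq_zero.mp e.symm).resolve_right ht0
    · refine (smul_eq_zero.mp e.symm).resolve_right fun hJ => ht0 ?_
      have hJJ := (mem_jointEig.mp (component_le_jointEig hq0 hq hn _ _ ht)).2.2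
      rw [hJ, map_zero] at hJJ
      refine (smul_eq_zero.mp hJJ.symm).resolve_left (pow_ne_zero _ (qi_ne_zero hq0 hq ?_))
      have : l ≠ 0 := by rintro rfl; simp at hl
      exact_mod_cast this
  intro u hu
  rw [hδ u hu, hδ0]
  split_ifs <;> exact zero_smul K _

/-- On each component `D` is a multiple of the identity or of `J`. -/
lemma IsBraiding.comm_opJ_sq (hn : 1 ≤ n) (t : Fock2 K n) :
    opJ n q (opJ n q (D t)) = D (opJ n q (opJ n q t)) := by
  have : opJ n q * opJ n q * D = D * (opJ n q * opJ n q) := by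
    refine eq_of_eqOn_iSup (iSup_component hq0 hq hn) fun i u hu => ?_
    obtain ⟨δ, hδ⟩ := hD.exists_component hq0 hq hn i.1 i.2
    have hJJ := (mem_jointEig.mp (component_le_jointEig hq0 hq hn _ _ hu)).2.2
    simp only [Module.End.mul_apply]
    rw [hJJ, map_smul, hδ u hu]
    split_ifs
    · rw [map_smul, map_smul, hJJ, smul_comm]
    · rw [map_smul, map_smul, hJJ, map_smul, smul_comm]
  exact LinearMap.congr_fun this t

end Braidings

end Generic

end Uniqueness

/-! ### The uniqueness of the `R` matrix -/

section Steps

variable {K : Type*} [Field K] {n : ℕ}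

attribute [local instance] fock2AddCommGroup

variable {q : K} (hq0 : q ≠ 0) (hq : ∀ k : ℕ, 1 ≤ k → q ^ k ≠ 1) [CharZero K]
include hq0 hq

/-- A zero of the numerator would give `x / y = q^{-(2s+2)}`. -/
lemma shiftCoeff_ne_zero {x y : K} (hy : y ≠ 0) (hz : ∀ k : ℤ, x / y ≠ q ^ k) (s : ℤ) :
    shiftCoeff q x y s ≠ 0 := by
  refine div_ne_zero (fun h => hz (-(2 * s + 2)) ?_) (mul_ne_zero (mul_ne_zero hq0
    (zpow_add_zpow_ne_zero hq0 hq _ _)) (zpow_add_zpow_ne_zero hq0 hq _ _))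
  have e : q ^ (-(2 * s + 2)) * q ^ (s + 2) = q ^ (-s) := by
    rw [← zpow_add₀ hq0]; congr 1; ring
  have h1 : q ^ (s + 2) ≠ 0 := zpow_ne_zero _ hq0
  rw [div_eq_iff hy]
  refine mul_left_cancel₀ h1 ?_
  linear_combination -y * e - h

lemma shiftVec_mem_jointEig {a : Fin n} (ha : (a : ℕ) = 0) {ε : ℤˣ} {l l' : ℕ} {s : ℤ}
    {v v' : Fock2 K n} (hv : v ∈ jointEig n q ε l) (hv' : v' ∈ jointEig n q (-ε) l)
    (hJ : opJ n q v = qi q s • v') (hJ' : opJ n q v' = qi q s • v)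
    (hl : (l' : ℤ) = s + 2 ∨ (l' : ℤ) = -(s + 2)) (hpar : l % 2 = l' % 2) :
    shiftVec q a s v v' ∈ jointEig n q ε l' := by
  have hn : 1 ≤ n := by have := a.2; omega
  have hA := hasSigns_opA (K := K) q hn
  have hB := hasSigns_opB (K := K) q hn
  have hC := hasSigns_opC (K := K) q a
  rw [mem_jointEig] at hv hv' ⊢
  refine ⟨?_, ?_, ?_⟩
  · simp only [shiftVec, map_add, map_smul, hA.apply1, hB.apply1, hC.apply1, hv.1, hv'.1]
    push_cast
    module
  · simp only [shiftVec, map_add, map_smul, hA.apply2, hB.apply2, hC.apply2, hv.2.1, hv'.2.1]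
    rw [neg_one_pow_congr (K := K) hpar]
    push_cast
    module
  · rw [opJ_shiftVec hq0 hq ha hJ hJ', map_smul, opJ_shiftVec hq0 hq ha hJ' hJ, smul_smul, ← sq]
    rcases hl with h | h
    · rw [h]
    · rw [h, qi_neg, neg_sq]

section Braidings

variable {x y : K} (hy : y ≠ 0) (hz : ∀ k : ℤ, x / y ≠ q ^ k) {D : Module.End K (Fock2 K n)}
  (hD : IsBraiding n q x y D)
include hy hz hD

/-- If `D` kills `v`, it also kills `e_0 v`; the latter is expanded in eigenvectors. -/
lemma IsBraiding.deltaE_zero_apply {v : Fock2 K n} (hv : D v = 0) (a : Fin n) (s : ℤ)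
    (v' : Fock2 K n) : shiftCoeff q x y s • D (shiftVec q a s v v') +
      (shiftCoeff q x y (-s) • D (shiftVec q a (-s) v ((-1 : K) • v')) +
        stayCoeff q x y s • D (stayVec q a s v v')) = 0 := by
  have h := LinearMap.congr_fun (hD.comm_e 0 (Nat.zero_le n)) v
  rw [Module.End.mul_apply, Module.End.mul_apply, hv, map_zero,
    QOscillator.deltaE_zero_apply hq0 hq x y a s v v', map_add, map_add, map_smul, map_smul,
    map_smul] at h
  exact h

/-- `D` commutes with `J²`, so the three terms keep their eigenvalues `[s+2]²`, `[s-2]²`, `[s]²`.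
The first differs from the second for `s ≠ 0` and from the third for `s ≠ -1`, so a quadratic
polynomial in `J²` isolates the first term. -/
lemma IsBraiding.shiftVec_eq_zero {a : Fin n} (ha : (a : ℕ) = 0) {s : ℤ} (hs0 : s ≠ 0)
    (hs1 : s ≠ -1) {v v' : Fock2 K n} (hJ : opJ n q v = qi q s • v')
    (hJ' : opJ n q v' = qi q s • v) (hv : D v = 0) : D (shiftVec q a s v v') = 0 := by
  have hn : 1 ≤ n := by have := a.2; omega
  have h0 := hD.deltaE_zero_apply hq0 hq hy hz hv a s v'
  have hT := hD.comm_opJ_sq hq0 hq hn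
  have eX : opJ n q (opJ n q (D (shiftVec q a s v v'))) =
      qi q (s + 2) ^ 2 • D (shiftVec q a s v v') := by
    rw [hT, opJ_shiftVec hq0 hq ha hJ hJ', map_smul, opJ_shiftVec hq0 hq ha hJ' hJ, smul_smul,
      ← sq, map_smul]
  have hJ1 : opJ n q v = qi q (-s) • ((-1 : K) • v') := by rw [hJ, qi_neg]; module
  have hJ2 : opJ n q ((-1 : K) • v') = qi q (-s) • v := by rw [map_smul, hJ', qi_neg]; module
  have eY : opJ n q (opJ n q (D (shiftVec q a (-s) v ((-1 : K) • v')))) =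
      qi q (-s + 2) ^ 2 • D (shiftVec q a (-s) v ((-1 : K) • v')) := by
    rw [hT, opJ_shiftVec hq0 hq ha hJ1 hJ2, map_smul, opJ_shiftVec hq0 hq ha hJ2 hJ1, smul_smul,
      ← sq, map_smul]
  have eZ : opJ n q (opJ n q (D (stayVec q a s v v'))) = qi q s ^ 2 • D (stayVec q a s v v') := by
    rw [hT, opJ_stayVec hq0 hq ha hJ hJ', map_smul, opJ_stayVec hq0 hq ha hJ' hJ, smul_smul,
      ← sq, map_smul]
  have hne := shiftCoeff_ne_zero hq0 hq hy hz s
  have d1 : qi q (s + 2) ^ 2 - qi q (-s + 2) ^ 2 ≠ 0 := sub_ne_zero.mpr fun h => by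
    rcases qi_sq_eq hq0 hq h with h | h <;> omega
  have d2 : qi q (s + 2) ^ 2 - qi q s ^ 2 ≠ 0 := sub_ne_zero.mpr fun h => by
    rcases qi_sq_eq hq0 hq h with h | h <;> omega
  generalize D (shiftVec q a s v v') = X at *
  generalize D (shiftVec q a (-s) v ((-1 : K) • v')) = Y at *
  generalize D (stayVec q a s v v') = Z at *
  have h1 := congrArg (fun w => opJ n q (opJ n q w)) h0
  simp only [map_add, map_smul, map_zero, eX, eY, eZ] at h1
  have h2 := congrArg (fun w => opJ n q (opJ n q w)) h1
  simp only [map_add, map_smul, map_zero, eX, eY, eZ] at h2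
  have h3 : ((qi q (s + 2) ^ 2 - qi q (-s + 2) ^ 2) * (qi q (s + 2) ^ 2 - qi q s ^ 2) *
      shiftCoeff q x y s) • X = 0 := by
    linear_combination (norm := module) h2 - (qi q (-s + 2) ^ 2 + qi q s ^ 2) • h1 +
      (qi q (-s + 2) ^ 2 * qi q s ^ 2) • h0
  exact (smul_eq_zero.mp h3).resolve_left (mul_ne_zero (mul_ne_zero d1 d2) hne)

/-- At `s = 0` the two shifted terms coincide and add up, and applying `J²` removes the remaining
one. -/
lemma IsBraiding.shiftVec_zero_eq_zero {a : Fin n} (ha : (a : ℕ) = 0) {v : Fock2 K n}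
    (hJ : opJ n q v = 0) (hv : D v = 0) : D (shiftVec q a 0 v 0) = 0 := by
  have hn : 1 ≤ n := by have := a.2; omega
  have h0 := hD.deltaE_zero_apply hq0 hq hy hz hv a 0 0
  have hT := hD.comm_opJ_sq hq0 hq hn
  have hJ1 : opJ n q v = qi q 0 • (0 : Fock2 K n) := by rw [hJ, smul_zero]
  have hJ2 : opJ n q (0 : Fock2 K n) = qi q 0 • v := by rw [map_zero, qi_zero, zero_smul]
  have eX : opJ n q (opJ n q (D (shiftVec q a 0 v 0))) =
      qi q (0 + 2) ^ 2 • D (shiftVec q a 0 v 0) := by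
    rw [hT, opJ_shiftVec hq0 hq ha hJ1 hJ2, map_smul, opJ_shiftVec hq0 hq ha hJ2 hJ1, smul_smul,
      ← sq, map_smul]
  have eZ : opJ n q (opJ n q (D (stayVec q a 0 v 0))) = 0 := by
    rw [hT, opJ_stayVec hq0 hq ha hJ1 hJ2, qi_zero, zero_smul, map_zero, map_zero]
  rw [neg_zero, smul_zero] at h0
  have h1 := congrArg (fun w => opJ n q (opJ n q w)) h0
  simp only [map_add, map_smul, map_zero, eX, eZ, smul_zero] at h1
  have h3 : (2 * shiftCoeff q x y 0 * qi q (0 + 2) ^ 2) • D (shiftVec q a 0 v 0) = 0 := by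
    linear_combination (norm := module) h1
  exact (smul_eq_zero.mp h3).resolve_left (mul_ne_zero (mul_ne_zero two_ne_zero
    (shiftCoeff_ne_zero hq0 hq hy hz 0)) (pow_ne_zero _ (qi_ne_zero hq0 hq (by norm_num))))

omit hy hz hD in
lemma shiftVec_pos_ne_zero {a z : Fin n} (ha : (a : ℕ) = 0) (hz : (z : ℕ) + 1 = n) (s : ℤ) (l : ℕ)
    (v' : Fock2 K n) : shiftVec q a s (singVec n q 1 l) v' ≠ 0 := fun h => by
  have e := coord_shiftVec q ha (m := 0) rfl (Pi.single z l) s (singVec n q 1 l) v'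
  have e2 := coord_singVec q hz (ε := 1) (l := l) (k := 0)
    (fun h => absurd h.1 (by decide)) (Nat.zero_le l) rfl
  rw [Pi.single_zero, Nat.sub_zero] at e2
  rw [h, map_zero, e2] at e
  exact mul_ne_zero (zpow_ne_zero _ hq0) (singCoeff_ne_zero hq0 hq l 0) e.symm

/-- A braiding that vanishes on `V^ε_l`, `l ≥ 1`, vanishes on `V^ε_{l+2}`. -/
lemma IsBraiding.eq_zero_step (hn : 1 ≤ n) {ε : ℤˣ} {l : ℕ} (hl : l ≠ 0)
    (h : ∀ t ∈ component n q ε l, D t = 0) : ∀ t ∈ component n q ε (l + 2), D t = 0 := by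
  obtain ⟨z, hz'⟩ : ∃ z : Fin n, (z : ℕ) + 1 = n := ⟨⟨n - 1, by omega⟩, by simp only; omega⟩
  obtain ⟨a, ha⟩ : ∃ a : Fin n, (a : ℕ) = 0 := ⟨⟨0, hn⟩, rfl⟩
  have hJ := opJ_singVec hq0 hq hn ε hl
  have hJ' := opJ_singVec hq0 hq hn (-ε) hl
  rw [neg_neg] at hJ'
  have hmem : shiftVec q a l (singVec n q ε l) (singVec n q (-ε) l) ∈ component n q ε (l + 2) := by
    rw [component_eq_jointEig hq0 hq hn]
    exact shiftVec_mem_jointEig hq0 hq ha (singVec_mem_jointEig hq0 hq hn ε l)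
      (singVec_mem_jointEig hq0 hq hn (-ε) l) hJ hJ' (Or.inl (by push_cast; ring)) (by omega)
  refine hD.eq_zero_on_component hq0 hq hn hmem ?_ (hD.shiftVec_eq_zero hq0 hq hy hz ha
    (by exact_mod_cast hl) (by omega) hJ hJ' (h _ (singVec_mem_component q ε l)))
  rcases Int.units_eq_one_or ε with rfl | rfl
  · exact shiftVec_pos_ne_zero hq0 hq ha hz' _ _ _
  -- For `ε = -` the coordinate test does not apply directly; applying `J` leads to the vector for
  -- `ε = +`, up to the nonzero factor `[l+2]`.
  · intro h0
    have e := opJ_shiftVec hq0 hq ha hJ hJ'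
    rw [h0, map_zero, neg_neg] at e
    rcases smul_eq_zero.mp e.symm with h1 | h1
    · exact qi_ne_zero hq0 hq (by omega) h1
    · exact shiftVec_pos_ne_zero hq0 hq ha hz' _ _ _ h1

lemma IsBraiding.eq_zero_step_zero (hn : 1 ≤ n) (h : ∀ t ∈ component n q 1 0, D t = 0) :
    ∀ t ∈ component n q 1 2, D t = 0 := by
  obtain ⟨z, hz'⟩ : ∃ z : Fin n, (z : ℕ) + 1 = n := ⟨⟨n - 1, by omega⟩, by simp only; omega⟩
  obtain ⟨a, ha⟩ : ∃ a : Fin n, (a : ℕ) = 0 := ⟨⟨0, hn⟩, rfl⟩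
  have hJ := opJ_singVec_zero hq0 hq hn 1
  have hmem : shiftVec q a 0 (singVec n q 1 0) 0 ∈ component n q 1 2 := by
    rw [component_eq_jointEig hq0 hq hn]
    exact shiftVec_mem_jointEig hq0 hq ha (l := 0) (singVec_mem_jointEig hq0 hq hn 1 0)
      (Submodule.zero_mem _) (by rw [hJ, smul_zero]) (by rw [map_zero, qi_zero, zero_smul])
      (Or.inl (by norm_num)) rfl
  exact hD.eq_zero_on_component hq0 hq hn hmem (shiftVec_pos_ne_zero hq0 hq ha hz' _ _ _)
    (hD.shiftVec_zero_eq_zero hq0 hq hy hz ha hJ (h _ (singVec_mem_component q 1 0)))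

/-- A braiding that vanishes on `V^-_2` vanishes on `V^-_0`. -/
lemma IsBraiding.eq_zero_step_down (hn : 1 ≤ n) (h : ∀ t ∈ component n q (-1) 2, D t = 0) :
    ∀ t ∈ component n q (-1) 0, D t = 0 := by
  obtain ⟨z, hz'⟩ : ∃ z : Fin n, (z : ℕ) + 1 = n := ⟨⟨n - 1, by omega⟩, by simp only; omega⟩
  obtain ⟨a, ha⟩ : ∃ a : Fin n, (a : ℕ) = 0 := ⟨⟨0, hn⟩, rfl⟩
  rcases lt_or_ge n 2 with hn2 | hn2
  · have hF := fun r h1 h2 => hD.comm_deltaF hq0 hq (r := r) h1 h2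
    exact eqOn_component (X := D) (Y := 0) hF (fun r h1 h2 => by rw [zero_mul, mul_zero])
      (by rw [singVec_zero_neg_of_one q hn2, map_zero, map_zero])
  have haz : a ≠ z := by rintro rfl; omega
  have hJ := opJ_singVec hq0 hq hn (-1) two_ne_zero
  have hJ' := opJ_singVec hq0 hq hn (- -1) two_ne_zero
  rw [neg_neg (-1 : ℤˣ)] at hJ'
  have hJ1 : opJ n q (singVec n q (-1) 2) =
      qi q (-2) • ((-1 : K) • singVec n q (- -1) 2) := by
    rw [hJ, qi_neg, Nat.cast_ofNat]; module
  have hJ2 : opJ n q ((-1 : K) • singVec n q (- -1) 2) = qi q (-2) • singVec n q (-1) 2 := by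
    rw [map_smul, hJ', qi_neg, Nat.cast_ofNat]; module
  have hmem : shiftVec q a (-2) (singVec n q (-1) 2) ((-1 : K) • singVec n q (- -1) 2) ∈
      component n q (-1) 0 := by
    rw [component_eq_jointEig hq0 hq hn]
    exact shiftVec_mem_jointEig hq0 hq ha (l := 2) (singVec_mem_jointEig hq0 hq hn (-1) 2)
      (Submodule.smul_mem _ _ (singVec_mem_jointEig hq0 hq hn (- -1) 2)) hJ1 hJ2
      (Or.inl (by norm_num)) rfl
  refine hD.eq_zero_on_component hq0 hq hn hmem (fun h0 => ?_) (hD.shiftVec_eq_zero hq0 hq hy hz ha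
    (by norm_num) (by norm_num) hJ1 hJ2 (h _ (singVec_mem_component q (-1) 2)))
  -- The target eigenvalue is `[0]`, so `J` gives no information. The coordinate at the left factor
  -- `e_z` serves instead, where `a ≠ z` uses `n ≥ 2`.
  have e := coord_shiftVec q ha (m := Pi.single z 1) (Pi.single_eq_of_ne haz 1) (Pi.single z 1)
    (-2) (singVec n q (-1) 2) ((-1 : K) • singVec n q (- -1) 2)
  have e2 := coord_singVec q hz' (ε := -1) (l := 2) (k := 1) (by decide) one_le_two rfl
  rw [h0, map_zero, e2] at e
  exact mul_ne_zero (zpow_ne_zero _ hq0) (singCoeff_ne_zero hq0 hq 2 1) e.symm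

end Braidings

/-! ### The vectors in the normalization -/

lemma qInt_one : qInt q 1 = 1 := by rw [qInt_eq_qi]; exact qi_one hq0 hq

lemma opJ_kk_zero_zero (a : Fin n) : opJ n q (kk K (0 : Occ n) 0) = 0 := by
  simpa using opJ_single q hq0 a 0 0

lemma opJ_kk_zero_one (a : Fin n) :
    opJ n q (kk K 0 (Pi.single a 1)) = kk K (Pi.single a 1) 0 := by
  simpa [qInt_one hq0 hq] using opJ_single q hq0 a 0 1

lemma opJ_kk_one_zero (a : Fin n) :
    opJ n q (kk K (Pi.single a 1) 0) = kk K 0 (Pi.single a 1) := by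
  simpa [qInt_one hq0 hq] using opJ_single q hq0 a 1 0

lemma kk_zero_zero_mem (a : Fin n) : kk K (0 : Occ n) 0 ∈ jointEig n q 1 0 := by
  rw [mem_jointEig, opJ_kk_zero_zero hq0 hq a]
  simp [sgn1_kk, sgn2_kk]

lemma kk_zero_one_mem (a : Fin n) : kk K 0 (Pi.single a 1) ∈ jointEig n q 1 1 := by
  rw [mem_jointEig, opJ_kk_zero_one hq0 hq, opJ_kk_one_zero hq0 hq, Nat.cast_one, qi_one hq0 hq]
  simp [sgn1_kk, sgn2_kk]

lemma kk_one_zero_mem (a : Fin n) : kk K (Pi.single a 1) 0 ∈ jointEig n q (-1) 1 := by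
  rw [mem_jointEig, opJ_kk_one_zero hq0 hq, opJ_kk_zero_one hq0 hq, Nat.cast_one, qi_one hq0 hq]
  simp [sgn1_kk, sgn2_kk]

lemma kk_one_one_mem (a : Fin n) :
    kk K (Pi.single a 1) (Pi.single a 1) ∈ jointEig n q (-1) 2 := by
  have e1 := opJ_single q hq0 a 1 1
  have e2 := opJ_single q hq0 a 2 0
  have e3 := opJ_single q hq0 a 0 2
  have h1 := qInt_one hq0 hq
  simp only [qInt_zero, zero_smul, mul_zero, zero_add, add_zero, h1, mul_one, one_smul,
    Nat.sub_self, Pi.single_zero] at e1 e2 e3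
  norm_num at e1 e2 e3
  have h2 : qInt q 2 = q + q⁻¹ := by rw [qInt_eq_qi]; exact qi_two hq0 hq
  rw [mem_jointEig, e1, map_add, map_smul, e2, e3, ← qInt_eq_qi, h2]
  refine ⟨by simp [sgn1_kk], by simp [sgn2_kk], by module⟩

lemma kk_ne_zero (m p : Occ n) : kk K m p ≠ 0 := fun h => by
  have := coord_kk (K := K) m p m p
  rw [h, map_zero, if_pos ⟨rfl, rfl⟩] at this
  exact zero_ne_one this

/-- The four vectors lie in `V^+_0`, `V^+_1`, `V^-_1`, `V^-_2`. Vanishing spreads upwards in steps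
of 2, and `V^-_0`, which contains none of them, is reached downwards from `V^-_2`. -/
theorem IsBraiding.eq_zero {x y : K} (hy : y ≠ 0) (hz : ∀ k : ℤ, x / y ≠ q ^ k)
    {D : Module.End K (Fock2 K n)} (hD : IsBraiding n q x y D) (a : Fin n)
    (h0 : D (kk K 0 0) = 0)
    (h1 : D (kk K 0 (Pi.single a 1)) = 0) (h2 : D (kk K (Pi.single a 1) 0) = 0)
    (h3 : D (kk K (Pi.single a 1) (Pi.single a 1)) = 0) : D = 0 := by
  have hn : 1 ≤ n := by have := a.2; omega
  have hc := component_eq_jointEig (n := n) hq0 hq hn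
  have b0 := hD.eq_zero_on_component hq0 hq hn (by rw [hc]; exact kk_zero_zero_mem hq0 hq a)
    (kk_ne_zero hq0 hq _ _) h0
  have b1 := hD.eq_zero_on_component hq0 hq hn (by rw [hc]; exact kk_zero_one_mem hq0 hq a)
    (kk_ne_zero hq0 hq _ _) h1
  have b2 := hD.eq_zero_on_component hq0 hq hn (by rw [hc]; exact kk_one_zero_mem hq0 hq a)
    (kk_ne_zero hq0 hq _ _) h2
  have b3 := hD.eq_zero_on_component hq0 hq hn (by rw [hc]; exact kk_one_one_mem hq0 hq a)
    (kk_ne_zero hq0 hq _ _) h3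
  have step : ∀ (ε : ℤˣ) (l : ℕ), (∀ t ∈ component n q ε (l + 1), D t = 0) →
      ∀ t ∈ component n q ε (l + 1 + 2), D t = 0 := fun ε l h =>
    hD.eq_zero_step hq0 hq hy hz hn l.succ_ne_zero h
  have h12 : ∀ ε : ℤˣ, (∀ t ∈ component n q ε 1, D t = 0) ∧ (∀ t ∈ component n q ε 2, D t = 0) := by
    intro ε
    rcases Int.units_eq_one_or ε with rfl | rfl
    · exact ⟨b1, hD.eq_zero_step_zero hq0 hq hy hz hn b0⟩
    · exact ⟨b2, b3⟩
  have hpos : ∀ (ε : ℤˣ) (l : ℕ), (∀ t ∈ component n q ε (l + 1), D t = 0) ∧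
      (∀ t ∈ component n q ε (l + 2), D t = 0) := by
    intro ε l
    induction l with
    | zero => exact h12 ε
    | succ l ih => exact ⟨ih.2, step ε l ih.1⟩
  refine eq_of_eqOn_iSup (iSup_component hq0 hq hn) fun i t ht => ?_
  rw [LinearMap.zero_apply]
  obtain ⟨ε, _ | l⟩ := i
  · rcases Int.units_eq_one_or ε with rfl | rfl
    · exact b0 t ht
    · exact hD.eq_zero_step_down hq0 hq hy hz hn b3 t ht
  · exact (hpos ε l).1 t ht

omit hq0 hq [CharZero K] in
lemma IsBraiding.sub {x y : K} {D D' : Module.End K (Fock2 K n)} (h : IsBraiding n q x y D)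
    (h' : IsBraiding n q x y D') : IsBraiding n q x y (D - D') where
  sgn12 := by rw [mul_sub, sub_mul, h.sgn12, h'.sgn12]
  sgn21 := by rw [mul_sub, sub_mul, h.sgn21, h'.sgn21]
  comm_k r hr := by rw [mul_sub, sub_mul, h.comm_k r hr, h'.comm_k r hr]
  comm_e r hr := by rw [mul_sub, sub_mul, h.comm_e r hr, h'.comm_e r hr]
  comm_f r hr := by rw [mul_sub, sub_mul, h.comm_f r hr, h'.comm_f r hr]

/-- The intertwining conditions are linear, so the difference of two solutions is a braiding that
kills the normalization vectors. -/
theorem IsQuantumR.unique (hn : 1 ≤ n) {c x y : K} (hy : y ≠ 0) (hz : ∀ k : ℤ, x / y ≠ q ^ k)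
    {R R' : Module.End K (Fock2 K n)} (h : IsQuantumR n q c x y R)
    (h' : IsQuantumR n q c x y R') : R = R' := by
  obtain ⟨a, ha⟩ : ∃ a : Fin n, (a : ℕ) = 0 := ⟨⟨0, hn⟩, rfl⟩
  have e : unitVec n 1 = Pi.single a 1 := by rw [← unitVec_eq a, ha]
  have hsub : ∀ t, R t = R' t → (permR R - permR R') t = 0 := fun t ht => by
    rw [LinearMap.sub_apply, sub_eq_zero]
    exact congrArg (swap K n) ht
  have := (h.isBraiding.sub h'.isBraiding).eq_zero hq0 hq hy hz a
    (hsub _ (h.norm_pp.trans h'.norm_pp.symm))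
    (hsub _ (by rw [← e]; exact h.norm_pm.trans h'.norm_pm.symm))
    (hsub _ (by rw [← e]; exact h.norm_mp.trans h'.norm_mp.symm))
    (hsub _ (by rw [← e]; exact h.norm_mm.trans h'.norm_mm.symm))
  exact swap_mul_cancel (sub_eq_zero.mp this)

/-- The spectral operator gives the `R` matrix. -/
theorem isQuantumR_spectral (hn : 1 ≤ n) {c x y : K} (hx : x ≠ 0) (hy : y ≠ 0)
    (hz : ∀ k : ℤ, x / y ≠ q ^ k) {D : Module.End K (Fock2 K n)}
    (hD : ∀ (s : ℤ) (u : Fock2 K n), opJ n q u = qi q s • u → D u = spec q c (x / y) s • u) :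
    IsQuantumR n q c x y (permR D) := by
  obtain ⟨a, ha⟩ : ∃ a : Fin n, (a : ℕ) = 0 := ⟨⟨0, hn⟩, rfl⟩
  have h1 : specNat q c (x / y) 1 = c / (1 - x / y) := by simp [specNat]
  have h2 : specNat q c (x / y) 2 = (x / y - q ^ 2) / (1 - x / y * q ^ 2) := by
    simp [specNat, mul_comm]
  have q1 : qi q 1 = 1 := qi_one hq0 hq
  refine (isBraiding_spectral hq0 hq hn hx hy hz hD).isQuantumR ha ?_ ?_ ?_ ?_
  · rw [hD 0 _ (by rw [opJ_kk_zero_zero hq0 hq a, qi_zero, zero_smul])]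
    have : spec q c (x / y) 0 = 1 := by simp [spec, specNat]
    rw [this, one_smul]
  · rw [spectral_apply hq0 hq hD (kk_zero_one_mem hq0 hq a) one_ne_zero, if_neg (by decide),
      opJ_kk_zero_one hq0 hq, h1, Nat.cast_one, q1, inv_one, mul_one]
  · rw [spectral_apply hq0 hq hD (kk_one_zero_mem hq0 hq a) one_ne_zero, if_neg (by decide),
      opJ_kk_one_zero hq0 hq, h1, Nat.cast_one, q1, inv_one, mul_one]
  · rw [spectral_apply hq0 hq hD (kk_one_one_mem hq0 hq a) two_ne_zero, if_pos rfl, h2]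

end Steps

/-! ### The spectral decomposition -/

section FiniteSums

variable {K V : Type*} [Field K] [AddCommMonoid V] [Module K V]

/-- A pointwise finite expansion can be checked on subspaces that span. -/
lemma finite_and_eq_finsum {U : ℕ → Submodule K V} {X : Module.End K V} {P : ℕ → Module.End K V}
    {k : K} {c : ℕ → K}
    (h : ∀ j, ∀ t ∈ U j, (∀ l, l ≠ j → P l t = 0) ∧ X t = k • c j • P j t) :
    ∀ t ∈ ⨆ j, U j, {l : ℕ | P l t ≠ 0}.Finite ∧ X t = k • ∑ᶠ l, c l • P l t := by
  intro t ht
  induction ht using Submodule.iSup_induction' with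
  | mem j t ht =>
    obtain ⟨h1, h2⟩ := h j t ht
    refine ⟨(Set.finite_singleton j).subset fun l hl => by_contra fun hne => hl (h1 l hne), ?_⟩
    rw [h2, finsum_eq_single _ j fun l hl => by rw [h1 l hl, smul_zero]]
  | zero => simp
  | add s t _ _ hs ht =>
    have hsub : ∀ u : V, Function.support (fun l => c l • P l u) ⊆ {l | P l u ≠ 0} := fun u l hl hP =>
      hl (by simp only [hP, smul_zero])
    refine ⟨(hs.1.union ht.1).subset fun l hl => ?_, ?_⟩
    · by_contra hcon
      simp only [Set.mem_union, Set.mem_ofPred_eq, not_or, not_not] at hcon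
      exact hl (by rw [map_add, hcon.1, hcon.2, add_zero])
    · rw [map_add, hs.2, ht.2, ← smul_add, ← finsum_add_distrib (hs.1.subset (hsub s))
        (ht.1.subset (hsub t))]
      simp only [map_add, smul_add]

end FiniteSums

end

end QOscillator

/-! ### Assembly of the theorem -/

theorem proposition3p8 {K : Type*} [Field K] [CharZero K] (n : ℕ) (hn : 1 ≤ n)
    (q qh i x y : K) (hqh : qh ^ 2 = q) (hi : i ^ 2 = -1)
    (hq0 : q ≠ 0) (hq : ∀ k : ℕ, 1 ≤ k → q ^ k ≠ 1)
    (hx : x ≠ 0) (hy : y ≠ 0) (hz : ∀ k : ℤ, x / y ≠ q ^ k) :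
    -- `V ⊗ V` is the direct sum of the `V^ε_l`, so that the projectors make sense
    (iSupIndep (fun a : ℤˣ × ℕ => component n q a.1 a.2) ∧
      ⨆ a : ℤˣ × ℕ, component n q a.1 a.2 = ⊤) ∧
    -- the operators `P^ε_{2l}` and `P^ε_{2l+1}` exist and are unique
    (∀ (ε : ℤˣ) (l : ℕ), ∃! P, IsProjector n q ε (2 * l) P) ∧
    (∀ (ε : ℤˣ) (l : ℕ), ∃! P, IsTransfer n q ε (2 * l + 1) P) ∧
    -- the quantum `R` matrix exists and is unique
    (∃! R, IsQuantumR n q (-i * qh) x y R) ∧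
    -- the spectral decomposition, with pointwise finite sums
    ∀ (R : Module.End K (Fock2 K n)) (P : ℤˣ → ℕ → Module.End K (Fock2 K n)),
      IsQuantumR n q (-i * qh) x y R →
      (∀ ε l, IsProjector n q ε (2 * l) (P ε (2 * l))) →
      (∀ ε l, IsTransfer n q ε (2 * l + 1) (P ε (2 * l + 1))) →
      ∀ ε : ℤˣ,
        (∀ t ∈ parityBlock K n ε ε,
          {l : ℕ | P ε (2 * l) t ≠ 0}.Finite ∧
          permR R t = ∑ᶠ l : ℕ,
            (∏ j ∈ Finset.Icc 1 l,
              (x / y - q ^ (4 * j - 2)) / (1 - q ^ (4 * j - 2) * (x / y))) • P ε (2 * l) t) ∧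
        (∀ t ∈ parityBlock K n ε (-ε),
          {l : ℕ | P ε (2 * l + 1) t ≠ 0}.Finite ∧
          permR R t = (-i * qh / (1 - x / y)) • ∑ᶠ l : ℕ,
            (∏ j ∈ Finset.Icc 1 l,
              (x / y - q ^ (4 * j)) / (1 - q ^ (4 * j) * (x / y))) •
                P ε (2 * l + 1) t) := by
  obtain ⟨D, hD⟩ := exists_spectral hq0 hq hn (-i * qh) (x / y)
  have hRD := isQuantumR_spectral hq0 hq hn hx hy hz hD
  refine ⟨⟨iSupIndep_component hq0 hq hn, iSup_component hq0 hq hn⟩,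
    fun ε l => existsUnique_isProjector hq0 hq hn ε _,
    fun ε l => existsUnique_isTransfer hq0 hq hn ε (Nat.succ_ne_zero _),
    ⟨permR D, hRD, fun R hR => hR.unique hq0 hq hn hy hz hRD⟩, fun R P hR hP hT ε => ?_⟩
  have hRt : ∀ t, permR R t = D t := fun t => by
    rw [hR.unique hq0 hq hn hy hz hRD]
    exact swap_swap (D t)
  constructor
  · intro t ht
    have h := finite_and_eq_finsum (X := D) (U := fun l => component n q ε (2 * l))
      (P := fun l => P ε (2 * l)) (k := 1) (c := fun l => ∏ j ∈ Finset.Icc 1 l,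
        (x / y - q ^ (4 * j - 2)) / (1 - q ^ (4 * j - 2) * (x / y))) (fun j t ht => ?_) t ?_
    · rw [hRt]
      simpa using h
    · refine ⟨fun l hl => (hP ε l).2 ε (2 * j) (fun h => hl ?_) t ht, ?_⟩
      · have := (Prod.mk.inj h).2
        omega
      · rw [spectral_apply_component hq0 hq hD hn ht, if_pos (by omega), (hP ε j).1 t ht, one_smul,
          specNat, if_pos (by omega), Nat.mul_div_cancel_left j two_pos]
    -- Equal parities select the components with even `l`.
    · have := parityBlock_le hq0 hq hn ε 0 two_pos
      rw [pow_zero, mul_one] at this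
      exact this ht
  · intro t ht
    have h := finite_and_eq_finsum (X := D) (U := fun l => component n q ε (2 * l + 1))
      (P := fun l => P ε (2 * l + 1)) (k := -i * qh / (1 - x / y))
      (c := fun l => ∏ j ∈ Finset.Icc 1 l,
        (x / y - q ^ (4 * j)) / (1 - q ^ (4 * j) * (x / y))) (fun j t ht => ?_) t ?_
    · rw [hRt]
      exact h
    · have hT' := fun l => (hT ε l).apply hq0 hq hn (Nat.succ_ne_zero _)
      refine ⟨fun l hl => (hT' l).2 ε (2 * j + 1) (fun h => hl ?_) t ht, ?_⟩
      · have := (Prod.mk.inj h).2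
        omega
      · rw [spectral_apply_component hq0 hq hD hn ht, if_neg (by omega), (hT' j).1 t ht,
          specNat, if_neg (by omega), show (2 * j + 1) / 2 = j by omega, smul_smul, smul_smul,
          mul_assoc]
    · have := parityBlock_le hq0 hq hn ε 1 one_lt_two
      rw [pow_one, mul_neg_one] at this
      exact this ht
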